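/- Let $n\ge 0$ be an integer, $1<p<\infty$, and let $d$ be an integer with $dp\ge\log_2 9$. Write points of $\mathbb R^{n+1}$ as $(x,t)$ with $x\in\mathbb R^n$, $t\in\mathbb R$, let $|\cdot|$ be Lebesgue measure, $\mathrm{dist}_p((x,t),(y,s))=\max\{\|x-y\|_\infty,|t-s|^{1/p}\}$ and $\mathrm{dist}_p(z,E)=\inf_{w\in E}\mathrm{dist}_p(z,w)$. *Rectangles.* For $L>0$ and $0\le\gamma_0\le\frac12$ let $R(\gamma_0)=Q(x,L)\times[t-L^p,t-\gamma_0L^p)$, where $Q(x,L)$ is the half-open cube with center $x$ and side length $L$; put $l_x(R(\gamma_0))=L$, $l_t(R(\gamma_0))=(1-\gamma_0)L^p$ and, for $\theta\in\mathbb R$, $R^\theta(\gamma_0)=R(\gamma_0)+(0,\theta\, l_t(R(\gamma_0)))$. The first dyadic layer $\mathcal D_1(R(\gamma_0))$ is obtained by dividing each spatial edge of $R(\gamma_0)$ into $2^d$ equal half-open intervals and the temporal edge into $k$ equal half-open intervals, with $k=\lceil 2^{dp}\rceil$ if $\gamma_0\le 1-\frac{2^{dp}+1}{2^{dp+1}}$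 and $k=\lfloor 2^{dp}\rfloor$ otherwise; its members are again rectangles $P(\alpha)$, of side length $2^{-d}L$ and with $1-\alpha=(1-\gamma_0)2^{dp}/k$. Iterating (with $\mathcal D_0(R(\gamma_0))=\{R(\gamma_0)\}$), let $\mathcal D(R(\gamma_0))=\bigcup_{i\ge0}\mathcal D_i(R(\gamma_0))$. *Weak porosity.* For a nonempty closed set $E\subseteq\mathbb R^{n+1}$ a set is $E$-free if it is disjoint from $E$, and $\mathcal M(R(\gamma_0))$ denotes an $E$-free member of $\mathcal D(R(\gamma_0))$ of largest side length ($\emptyset$ if there is none). For $c,\delta\in(0,1)$, $E$ is *$(c,\delta,\theta)$-parabolic weakly porous* if for every rectangle $R(\gamma_0)$, $0\le\gamma_0\le\frac12$, there are finitely many pairwise disjoint $E$-free $P_1,\dots,P_N\in\mathcal D(R(\gamma_0))$ with $|P_k|\ge\delta|\mathcal M(R^\theta(\gamma_0))|$ for all $k$ and $\sum_k|P_k|\ge c|R(\gamma_0)|$. For $\alpha,K>0$ and $c_0,\delta_0\in(0,1)$, $E$ is *$\alpha$-improving with data $(c_0,\delta_0,K)$* if it is $(c_0,\delta_0,\theta)$-parabolic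 weakly porous and for every $0<\delta\le\delta_0$ it is $(c,\delta,\theta)$-parabolic weakly porous for some $c\in(0,1)$ with $1-c\le K\delta^\alpha$. It is *$\alpha$-improving* if this holds for some $c_0,\delta_0\in(0,1)$ and $K>0$. *Muckenhoupt class.* For $0<\gamma<1$, a weight $w$ (nonnegative and locally integrable) belongs to $A_1^+(\gamma)$ with constant $C>0$ if for all $x\in\mathbb R^n$, $t\in\mathbb R$, $L>0$ the average of $w$ over $Q(x,L)\times(t-L^p,t-\gamma L^p)$ is at most $C\operatorname{ess\,inf} w$ over $Q(x,L)\times(t+\gamma L^p,t+L^p)$; it belongs to $A_1^+(\gamma)$ if this holds for some $C>0$. A negative power of $\mathrm{dist}_p(\cdot,E)$ is $+\infty$ on $E$. **Theorem.** Let $\theta>1$ and $0<\gamma<1$. For every nonempty closed $E\subseteq\mathbb R^{n+1}$ the following are equivalent: (i) $E$ is $(c,\delta,\theta)$-parabolic weakly porous for some $c,\delta\in(0,1)$; (ii) $E$ is $\alpha$-improving for some $\alpha>0$; (iii) $\mathrm{dist}_p(\cdot,E)^{-\beta(n+p)}\in A_1^+(\gamma)$ for some $\beta>0$. Moreover, the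 dependencies are quantitative, in the following sense. (a) For all $c,\delta\in(0,1)$ there are $\alpha,K>0$, depending only on $n,p,d,\theta,c,\delta$, such that every nonempty closed $(c,\delta,\theta)$-parabolic weakly porous set is $\alpha$-improving with data $(c,\delta,K)$. (b) For all $c_0,\delta_0\in(0,1)$, $\alpha,K>0$ and all $\beta$ with $0<\beta<\alpha$ and $\beta(n+p)<1$ there is $C>0$, depending only on $n,p,d,\theta,\gamma,c_0,\delta_0,\alpha,K,\beta$, such that $\mathrm{dist}_p(\cdot,E)^{-\beta(n+p)}\in A_1^+(\gamma)$ with constant $C$ for every nonempty closed $E$ that is $\alpha$-improving with data $(c_0,\delta_0,K)$. (c) For all $\beta,C>0$ there are $c_0,\delta_0\in(0,1)$ and $K>0$, depending only on $n,p,d,\theta,\gamma,\beta,C$, such that every nonempty closed $E$ for which $\mathrm{dist}_p(\cdot,E)^{-\beta(n+p)}\in A_1^+(\gamma)$ with constant $C$ is $\beta$-improving with data $(c_0,\delta_0,K)$. -/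

import Mathlib

open MeasureTheory Set
open scoped ENNReal

/-- Points `(x, t)` of `ℝⁿ⁺¹ = ℝⁿ × ℝ`; the norm on the spatial factor `Fin n → ℝ` is the maximum
norm, and `volume` is the Lebesgue measure of `ℝⁿ⁺¹`. -/
abbrev SpaceTime (n : ℕ) : Type := (Fin n → ℝ) × ℝ

/-- The parabolic distance `max {‖x - y‖_∞, |t - s|^{1/p}}` of two points. -/
noncomputable def parabolicDist {n : ℕ} (p : ℝ) (z w : SpaceTime n) : ℝ :=
  max ‖z.1 - w.1‖ (|z.2 - w.2| ^ (1 / p))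

/-- The parabolic distance of a point to a (nonempty) set. -/
noncomputable def parabolicInfDist {n : ℕ} (p : ℝ) (z : SpaceTime n) (E : Set (SpaceTime n)) : ℝ :=
  ⨅ e : E, parabolicDist p z e

/-- The distance weight `dist_p(z, E)^{-a}`, with the value `∞` where the distance is `0`. -/
noncomputable def parabolicDistWeight {n : ℕ} (p : ℝ) (E : Set (SpaceTime n)) (a : ℝ)
    (z : SpaceTime n) : ℝ≥0∞ :=
  ENNReal.ofReal (parabolicInfDist p z E) ^ (-a)

/-! ### Parabolic rectangles -/

/-- The data of a (truncated) parabolic rectangle `R(γ) = Q(x, L) × [t - L^p, t - γ L^p)`.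
It is recorded through the lower corner `x - (L/2, …, L/2)` of the half-open cube `Q(x, L)`, the
bottom time `t - L^p`, the side length `L`, and the truncation parameter `γ`. -/
@[ext]
structure ParabolicRect (n : ℕ) where
  /-- lower corner of the spatial cube -/
  corner : Fin n → ℝ
  /-- lower end of the time interval -/
  bottom : ℝ
  /-- spatial side length `L` -/
  side : ℝ
  /-- truncation parameter `γ` -/
  trunc : ℝ

namespace ParabolicRect

variable {n : ℕ}

/-- The rectangles admitted as parabolic rectangles: `L > 0` and `0 ≤ γ ≤ 1/2`. -/
def Valid (R : ParabolicRect n) : Prop :=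
  0 < R.side ∧ 0 ≤ R.trunc ∧ R.trunc ≤ 1 / 2

/-- The temporal side length `l_t(R(γ)) = (1 - γ) L^p`. -/
noncomputable def timeLength (p : ℝ) (R : ParabolicRect n) : ℝ :=
  (1 - R.trunc) * R.side ^ p

/-- The point set of a parabolic rectangle. -/
def toSet (p : ℝ) (R : ParabolicRect n) : Set (SpaceTime n) :=
  {z | (∀ i, z.1 i ∈ Ico (R.corner i) (R.corner i + R.side)) ∧
    z.2 ∈ Ico R.bottom (R.bottom + R.timeLength p)}

/-- The Lebesgue measure `|R(γ)|`. -/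
noncomputable def vol (p : ℝ) (R : ParabolicRect n) : ℝ :=
  volume.real (R.toSet p)

/-- The temporal translate `R^θ(γ) = R(γ) + (0, θ l_t(R(γ)))`. -/
noncomputable def shift (p θ : ℝ) (R : ParabolicRect n) : ParabolicRect n :=
  { R with bottom := R.bottom + θ * R.timeLength p }

/-! ### The parabolic dyadic lattice with division rate `d` -/

open Classical in
/-- The number of parts into which the time interval of a rectangle with truncation `γ` is cut. -/
noncomputable def timeDivisions (p : ℝ) (d : ℕ) (γ : ℝ) : ℕ :=
  if γ ≤ 1 - ((2 : ℝ) ^ (d * p) + 1) / (2 : ℝ) ^ (d * p + 1) then ⌈(2 : ℝ) ^ (d * p)⌉₊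
  else ⌊(2 : ℝ) ^ (d * p)⌋₊

/-- The dyadic child with spatial index `j` and temporal index `i`. Its truncation parameter `α` is
the one for which its temporal side length `(1 - α) (2^{-d} L)^p` is `l_t(R) / k`, where `k` is the
number of temporal divisions. -/
noncomputable def child (p : ℝ) (d : ℕ) (R : ParabolicRect n) (j : Fin n → ℕ) (i : ℕ) :
    ParabolicRect n where
  corner := fun l => R.corner l + j l * (R.side / 2 ^ d)
  bottom := R.bottom + i * (R.timeLength p / timeDivisions p d R.trunc)
  side := R.side / 2 ^ d
  trunc := 1 - (1 - R.trunc) * ((2 : ℝ) ^ (d * p) / timeDivisions p d R.trunc)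

/-- The first dyadic layer `𝒟₁(R)`: spatial edges are cut into `2^d` equal parts and the temporal
edge into `timeDivisions` equal parts. -/
def children (p : ℝ) (d : ℕ) (R : ParabolicRect n) : Set (ParabolicRect n) :=
  {P | ∃ (j : Fin n → ℕ) (i : ℕ), (∀ l, j l < 2 ^ d) ∧ i < timeDivisions p d R.trunc ∧
    P = R.child p d j i}

/-- The `m`-th dyadic layer `𝒟ₘ(R)`. -/
def dyadicLayer (p : ℝ) (d : ℕ) (R : ParabolicRect n) : ℕ → Set (ParabolicRect n)
  | 0 => {R}
  | m + 1 => ⋃ P ∈ dyadicLayer p d R m, P.children p d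

/-- The dyadic lattice `𝒟(R)`. -/
def dyadic (p : ℝ) (d : ℕ) (R : ParabolicRect n) : Set (ParabolicRect n) :=
  ⋃ m, R.dyadicLayer p d m

/-- The `E`-free dyadic subrectangles of `R`. -/
def freeDyadic (p : ℝ) (d : ℕ) (E : Set (SpaceTime n)) (R : ParabolicRect n) :
    Set (ParabolicRect n) :=
  {P | P ∈ R.dyadic p d ∧ Disjoint (P.toSet p) E}

/-- The collection `ℱ(R)` of the maximal `E`-free dyadic rectangles `P_z`, `z ∈ R \ E`. -/
def maximalFree (p : ℝ) (d : ℕ) (E : Set (SpaceTime n)) (R : ParabolicRect n) :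
    Set (ParabolicRect n) :=
  {P | P ∈ R.freeDyadic p d E ∧ ∃ z ∈ R.toSet p \ E, z ∈ P.toSet p ∧
    ∀ Q ∈ R.freeDyadic p d E, z ∈ Q.toSet p → Q.toSet p ⊆ P.toSet p}

/-- `M` is a largest element of `ℱ(R)`. -/
def IsMaximalHole (p : ℝ) (d : ℕ) (E : Set (SpaceTime n)) (R M : ParabolicRect n) : Prop :=
  M ∈ R.maximalFree p d E ∧ ∀ P ∈ R.maximalFree p d E, P.side ≤ M.side

open Classical in
/-- The maximal hole `ℳ(R)`: a largest `E`-free dyadic subrectangle of `R`, or `∅` if there is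
none. (All the largest ones have the same measure.) -/
noncomputable def maximalHole (p : ℝ) (d : ℕ) (E : Set (SpaceTime n)) (R : ParabolicRect n) :
    Set (SpaceTime n) :=
  if h : ∃ M, R.IsMaximalHole p d E M then h.choose.toSet p else ∅

end ParabolicRect

/-! ### Parabolic weak porosity and improvement -/

/-- `E` is `(c, δ, θ)`-parabolic weakly porous. -/
def IsWeaklyPorous {n : ℕ} (p : ℝ) (d : ℕ) (E : Set (SpaceTime n)) (c δ θ : ℝ) : Prop :=
  ∀ R : ParabolicRect n, R.Valid →
    ∃ S : Finset (ParabolicRect n),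
      (∀ P ∈ S, P ∈ R.dyadic p d ∧ Disjoint (P.toSet p) E ∧
        δ * volume.real ((R.shift p θ).maximalHole p d E) ≤ P.vol p) ∧
      (S : Set (ParabolicRect n)).PairwiseDisjoint (fun P => P.toSet p) ∧
      c * R.vol p ≤ ∑ P ∈ S, P.vol p

/-- The `(c₀, δ₀, θ)`-weakly porous set `E` is `α`-improving with constant `K`: for every
`0 < δ ≤ δ₀` it is `(c, δ, θ)`-weakly porous for some `0 < c < 1` with `1 - c ≤ K δ^α`. -/
def IsImprovingWith {n : ℕ} (p : ℝ) (d : ℕ) (E : Set (SpaceTime n)) (θ c₀ δ₀ α K : ℝ) : Prop :=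
  IsWeaklyPorous p d E c₀ δ₀ θ ∧
    ∀ δ : ℝ, 0 < δ → δ ≤ δ₀ →
      ∃ c ∈ Ioo (0 : ℝ) 1, IsWeaklyPorous p d E c δ θ ∧ 1 - c ≤ K * δ ^ α

/-- `E` is an `α`-improving parabolic weakly porous set (for the translation `θ`). -/
def IsImproving {n : ℕ} (p : ℝ) (d : ℕ) (E : Set (SpaceTime n)) (θ α : ℝ) : Prop :=
  ∃ c₀ ∈ Ioo (0 : ℝ) 1, ∃ δ₀ ∈ Ioo (0 : ℝ) 1, ∃ K > 0, IsImprovingWith p d E θ c₀ δ₀ α K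

/-! ### The parabolic Muckenhoupt class -/

/-- The half-open cube `Q(x, L)` with center `x` and side length `L`. -/
def halfOpenCube {n : ℕ} (x : Fin n → ℝ) (L : ℝ) : Set (Fin n → ℝ) :=
  {y | ∀ i, y i ∈ Ico (x i - L / 2) (x i + L / 2)}

/-- `R⁻(γ) = Q(x, L) × (t - L^p, t - γ L^p)`. -/
def lowerRect {n : ℕ} (p : ℝ) (x : Fin n → ℝ) (t L γ : ℝ) : Set (SpaceTime n) :=
  halfOpenCube x L ×ˢ Ioo (t - L ^ p) (t - γ * L ^ p)

/-- `R⁺(γ) = Q(x, L) × (t + γ L^p, t + L^p)`. -/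
def upperRect {n : ℕ} (p : ℝ) (x : Fin n → ℝ) (t L γ : ℝ) : Set (SpaceTime n) :=
  halfOpenCube x L ×ˢ Ioo (t + γ * L ^ p) (t + L ^ p)

/-- `w` is a weight (a nonnegative, locally integrable function, which may be infinite on a null
set) in the class `A₁⁺(γ)` with constant `C`. -/
def IsParabolicA1With {n : ℕ} (p γ : ℝ) (w : SpaceTime n → ℝ≥0∞) (C : ℝ) : Prop :=
  AEMeasurable w volume ∧ (∀ K : Set (SpaceTime n), IsCompact K → ∫⁻ z in K, w z < ∞) ∧
    ∀ (x : Fin n → ℝ) (t L : ℝ), 0 < L →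
      ⨍⁻ z in lowerRect p x t L γ, w z ∂volume ≤
        ENNReal.ofReal C * essInf w (volume.restrict (upperRect p x t L γ))

/-- The parabolic Muckenhoupt class `A₁⁺(γ)`. -/
def IsParabolicA1 {n : ℕ} (p γ : ℝ) (w : SpaceTime n → ℝ≥0∞) : Prop :=
  ∃ C > 0, IsParabolicA1With p γ w C

/-! All three conditions are read as statements about the single function u = dist_p(·, E): each
compares u on a box with one value u(y) at a later point y. Three properties of u carry the proof.
`HasLargeValues`: on a fixed proportion of the box, u ≥ κ u(y). `HasDecay`: the set {u < σ u(y)}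
fills at most a proportion A σ^s. `HasIntegralBound`: the integral of u^(-s) over the box is at most
A |box| u(y)^(-s). The exponents are related by s = α(n+p) because a rectangle of side l has measure
comparable to l^(n+p).

Time lag and position are adjusted by backward chains (`exists_backwardHarnack`). Cutting a time T
into k equal steps gives steps of scale ρ with ρ^p ~ T/k, so the spatial reach kρ ~ k^(1-1/p)
T^(1/p) is unbounded in k. This is where p > 1 matters: one short backward step yields control over
any prescribed geometry, as long as some time gap is left.

(a) A free rectangle of side l has u ≥ l/8 on its middle part, and a point y of R^θ forces a hole of
size comparable to min(u(y), l(R)); hence weak porosity gives `HasLargeValues`. A one-sided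
John–Nirenberg argument (`volume_le_of_forwardBox`, `HasLargeValues.exists_geometric_decay`)
upgrades this to `HasDecay`: a Vitali covering by boxes placed in the future of the points shows
that {u < κ'v} is controlled by the shell {κ'v ≤ u < v}, so sublevel sets shrink geometrically.
Decay returns to porosity in `HasDecay.exists_isWeaklyPorous`, by using all free rectangles of one
well-chosen layer.

(b) For an improving set, the rectangles of layer m₀+i that meet E have total measure decaying
geometrically in i, where m₀ is the layer of the hole of R^θ. On a free rectangle of side l the
power u^(-s), s < 1, has average at most a constant times l^(-s). Summation over layers converges
exactly because β < α and gives `HasIntegralBound`, which the chains turn into the A₁⁺ condition for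
every lag.

(c) The A₁⁺ condition gives `HasIntegralBound` for one lag, the chains move it to the lag θ, and
Chebyshev's inequality gives `HasDecay` with s = β(n+p), hence improvement with the exponent β
itself. -/

lemma exists_nat_slot {m : ℕ} {w v : ℝ} (hw : 0 < w) (hv : 0 ≤ v) (hvm : v < m * w) :
    ∃ j < m, j * w ≤ v ∧ v < (j + 1) * w := by
  refine ⟨⌊v / w⌋₊, ?_, ?_, ?_⟩
  · rw [Nat.floor_lt (by positivity), div_lt_iff₀ hw]; exact hvm
  · rw [← le_div_iff₀ hw]; exact Nat.floor_le (by positivity)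
  · rw [← div_lt_iff₀ hw]; exact Nat.lt_floor_add_one _

lemma nat_slot_unique {i j : ℕ} {w v : ℝ} (hw : 0 < w) (hi : i * w ≤ v) (hi' : v < (i + 1) * w)
    (hj : j * w ≤ v) (hj' : v < (j + 1) * w) : i = j := by
  have h1 : (i : ℝ) < j + 1 := lt_of_mul_lt_mul_right (hi.trans_lt hj') hw.le
  have h2 : (j : ℝ) < i + 1 := lt_of_mul_lt_mul_right (hj.trans_lt hi') hw.le
  have h3 : i < j + 1 := by exact_mod_cast h1
  have h4 : j < i + 1 := by exact_mod_cast h2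
  omega

/-! ### Parabolic boxes and the parabolic distance -/

/-- The box `Q(x, l) × [t, t + h)`. -/
def pbox {n : ℕ} (x : Fin n → ℝ) (l t h : ℝ) : Set (SpaceTime n) :=
  halfOpenCube x l ×ˢ Ico t (t + h)

lemma mem_pbox {n : ℕ} {x : Fin n → ℝ} {l t h : ℝ} {z : SpaceTime n} :
    z ∈ pbox x l t h ↔
      (∀ i, x i - l / 2 ≤ z.1 i ∧ z.1 i < x i + l / 2) ∧ t ≤ z.2 ∧ z.2 < t + h := Iff.rfl

lemma pbox_eq_pi {n : ℕ} (x : Fin n → ℝ) (l t h : ℝ) :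
    pbox x l t h = (Set.pi univ fun i => Ico (x i - l / 2) (x i + l / 2)) ×ˢ Ico t (t + h) := by
  ext z
  simp [pbox, halfOpenCube]

lemma measurableSet_pbox {n : ℕ} (x : Fin n → ℝ) (l t h : ℝ) : MeasurableSet (pbox x l t h) := by
  rw [pbox_eq_pi]
  exact (MeasurableSet.univ_pi fun i => measurableSet_Ico).prod measurableSet_Ico

lemma volume_pbox {n : ℕ} (x : Fin n → ℝ) {l : ℝ} (hl : 0 ≤ l) (t h : ℝ) :
    volume (pbox x l t h) = ENNReal.ofReal (l ^ n * h) := by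
  rw [pbox_eq_pi, Measure.volume_eq_prod, Measure.prod_prod, Real.volume_pi_Ico, Real.volume_Ico,
    ENNReal.ofReal_mul (by positivity), ENNReal.ofReal_pow hl]
  congr 1
  · have : ∀ i, x i + l / 2 - (x i - l / 2) = l := fun i => by ring
    simp [this]
  · congr 1; ring

lemma norm_sub_center_le {n : ℕ} {x : Fin n → ℝ} {l : ℝ} (hl : 0 ≤ l) {y : Fin n → ℝ}
    (hy : y ∈ halfOpenCube x l) : ‖y - x‖ ≤ l / 2 := by
  rw [pi_norm_le_iff_of_nonneg (by positivity)]
  intro i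
  have := hy i
  rw [Pi.sub_apply, Real.norm_eq_abs, abs_le]
  constructor <;> linarith [this.1, this.2]

lemma norm_sub_lt_of_mem {n : ℕ} {x : Fin n → ℝ} {l : ℝ} (hl : 0 < l) {y z : Fin n → ℝ}
    (hy : y ∈ halfOpenCube x l) (hz : z ∈ halfOpenCube x l) : ‖y - z‖ < l := by
  rw [pi_norm_lt_iff hl]
  intro i
  have h1 := hy i
  have h2 := hz i
  rw [Pi.sub_apply, Real.norm_eq_abs, abs_lt]
  constructor <;> linarith [h1.1, h1.2, h2.1, h2.2]

lemma abs_apply_sub_le_norm {n : ℕ} (x y : Fin n → ℝ) (i : Fin n) : |x i - y i| ≤ ‖x - y‖ := by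
  simpa using norm_le_pi_norm (x - y) i

lemma halfOpenCube_subset {n : ℕ} {x x' : Fin n → ℝ} {l l' : ℝ}
    (h : ‖x - x'‖ + l / 2 ≤ l' / 2) : halfOpenCube x l ⊆ halfOpenCube x' l' := by
  intro y hy i
  have h1 := hy i
  have h2 := abs_le.1 (abs_apply_sub_le_norm x x' i)
  constructor <;> linarith [h1.1, h1.2, h2.1, h2.2]

lemma pbox_subset {n : ℕ} {x x' : Fin n → ℝ} {l l' t t' h h' : ℝ}
    (hx : ‖x - x'‖ + l / 2 ≤ l' / 2) (ht : t' ≤ t) (hh : t + h ≤ t' + h') :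
    pbox x l t h ⊆ pbox x' l' t' h' :=
  Set.prod_mono (halfOpenCube_subset hx) (Ico_subset_Ico ht hh)

lemma self_mem_halfOpenCube {n : ℕ} (x : Fin n → ℝ) {l : ℝ} (hl : 0 < l) :
    x ∈ halfOpenCube x l := fun i => ⟨by linarith, by linarith⟩

/-! ### The parabolic distance: triangle inequality, continuity, free boxes. -/

section Dist

variable {n : ℕ} {p : ℝ} {E : Set (SpaceTime n)}

lemma parabolicDist_nonneg (p : ℝ) (z w : SpaceTime n) : 0 ≤ parabolicDist p z w :=
  le_max_of_le_left (norm_nonneg _)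

lemma parabolicDist_comm (p : ℝ) (z w : SpaceTime n) : parabolicDist p z w = parabolicDist p w z := by
  simp only [parabolicDist, norm_sub_rev z.1, abs_sub_comm z.2]

lemma parabolicDist_le (hp : 0 < p) {z w : SpaceTime n} {r : ℝ} (hr : 0 ≤ r)
    (h1 : ‖z.1 - w.1‖ ≤ r) (h2 : |z.2 - w.2| ≤ r ^ p) : parabolicDist p z w ≤ r := by
  refine max_le h1 ?_
  rw [one_div, Real.rpow_inv_le_iff_of_pos (abs_nonneg _) hr hp]
  exact h2

lemma parabolicDist_lt_iff (hp : 0 < p) {z w : SpaceTime n} {r : ℝ} (hr : 0 ≤ r) :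
    parabolicDist p z w < r ↔ ‖z.1 - w.1‖ < r ∧ |z.2 - w.2| < r ^ p := by
  rw [parabolicDist, max_lt_iff, one_div, Real.rpow_inv_lt_iff_of_pos (abs_nonneg _) hr hp]

/-- For the temporal part this is subadditivity of r ↦ r^(1/p), which needs 1/p ≤ 1. -/
lemma parabolicDist_triangle (hp : 1 < p) (z v w : SpaceTime n) :
    parabolicDist p z w ≤ parabolicDist p z v + parabolicDist p v w := by
  refine max_le ?_ ?_
  · calc ‖z.1 - w.1‖ ≤ ‖z.1 - v.1‖ + ‖v.1 - w.1‖ := norm_sub_le_norm_sub_add_norm_sub _ _ _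
      _ ≤ _ := add_le_add (le_max_left _ _) (le_max_left _ _)
  · calc |z.2 - w.2| ^ (1 / p) ≤ (|z.2 - v.2| + |v.2 - w.2|) ^ (1 / p) := by
          refine Real.rpow_le_rpow (abs_nonneg _) (abs_sub_le _ _ _) (by positivity)
      _ ≤ |z.2 - v.2| ^ (1 / p) + |v.2 - w.2| ^ (1 / p) :=
          Real.rpow_add_le_add_rpow (abs_nonneg _) (abs_nonneg _) (by positivity)
            (by rw [div_le_one (by linarith)]; exact hp.le)
      _ ≤ _ := add_le_add (le_max_right _ _) (le_max_right _ _)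

lemma parabolicInfDist_nonneg (p : ℝ) (z : SpaceTime n) (E : Set (SpaceTime n)) :
    0 ≤ parabolicInfDist p z E := Real.iInf_nonneg fun _ => parabolicDist_nonneg _ _ _

lemma parabolicInfDist_le {e : SpaceTime n} (he : e ∈ E) (z : SpaceTime n) :
    parabolicInfDist p z E ≤ parabolicDist p z e :=
  ciInf_le (f := fun e : E => parabolicDist p z e)
    ⟨0, by rintro _ ⟨e, rfl⟩; exact parabolicDist_nonneg _ _ _⟩ ⟨e, he⟩

lemma le_parabolicInfDist (hE : E.Nonempty) {z : SpaceTime n} {r : ℝ}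
    (h : ∀ e ∈ E, r ≤ parabolicDist p z e) : r ≤ parabolicInfDist p z E :=
  haveI := hE.to_subtype
  le_ciInf fun e => h e e.2

lemma parabolicInfDist_le_add (hp : 1 < p) (hE : E.Nonempty) (z w : SpaceTime n) :
    parabolicInfDist p z E ≤ parabolicInfDist p w E + parabolicDist p z w := by
  rw [← sub_le_iff_le_add]
  refine le_parabolicInfDist hE fun e he => ?_
  rw [sub_le_iff_le_add]
  linarith [parabolicInfDist_le (p := p) he z, parabolicDist_triangle hp z w e]

lemma continuous_parabolicInfDist (hp : 1 < p) (hE : E.Nonempty) :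
    Continuous fun z : SpaceTime n => parabolicInfDist p z E := by
  have hp0 : 0 < p := by linarith
  rw [continuous_iff_continuousAt]
  intro z
  have hc : Continuous fun w : SpaceTime n => parabolicDist p w z := by
    unfold parabolicDist
    refine Continuous.max (by fun_prop) (Continuous.rpow_const (by fun_prop) fun w => Or.inr ?_)
    positivity
  have h0 : parabolicDist p z z = 0 := by
    simp [parabolicDist, Real.zero_rpow (inv_ne_zero hp0.ne')]
  rw [ContinuousAt, tendsto_iff_dist_tendsto_zero]
  refine squeeze_zero (fun _ => dist_nonneg) (fun w => ?_) (h0 ▸ hc.tendsto z)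
  rw [Real.dist_eq, abs_le]
  have h1 := parabolicInfDist_le_add hp hE z w
  have h2 := parabolicInfDist_le_add hp hE w z
  rw [parabolicDist_comm p z w] at h1
  constructor <;> linarith

lemma measurable_parabolicDistWeight (hp : 1 < p) (hE : E.Nonempty) (a : ℝ) :
    Measurable (parabolicDistWeight p E a) :=
  (continuous_parabolicInfDist hp hE).measurable.ennreal_ofReal.pow_const _

lemma parabolicInfDist_pos (hp : 1 < p) (hE : E.Nonempty) (hc : IsClosed E) {z : SpaceTime n}
    (hz : z ∉ E) : 0 < parabolicInfDist p z E := by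
  have hp0 : 0 < p := by linarith
  obtain ⟨r, hr, hb⟩ := Metric.isOpen_iff.1 hc.isOpen_compl z hz
  set s := min r (r ^ (1 / p)) with hs
  have hs0 : 0 < s := lt_min hr (by positivity)
  refine hs0.trans_le (le_parabolicInfDist hE fun e he => ?_)
  by_contra! hlt
  refine hb ?_ he
  rw [parabolicDist_lt_iff hp0 hs0.le] at hlt
  rw [Metric.mem_ball, Prod.dist_eq, max_lt_iff, dist_comm, dist_eq_norm, dist_comm, Real.dist_eq]
  refine ⟨hlt.1.trans_le (min_le_left _ _), hlt.2.trans_le ?_⟩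
  calc s ^ p ≤ (r ^ (1 / p)) ^ p := Real.rpow_le_rpow hs0.le (min_le_right _ _) hp0.le
    _ = r := by rw [← Real.rpow_mul hr.le, one_div_mul_cancel hp0.ne', Real.rpow_one]

lemma parabolicInfDist_eq_zero (hp : 1 < p) {z : SpaceTime n} (hz : z ∈ E) :
    parabolicInfDist p z E = 0 := by
  refine le_antisymm ((parabolicInfDist_le hz z).trans_eq ?_) (parabolicInfDist_nonneg _ _ _)
  simp [parabolicDist, Real.zero_rpow (inv_ne_zero (by linarith : p ≠ 0))]

/-- A point whose distance to `E` is at least the side length lies in a free box. -/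
lemma disjoint_pbox_of_le (hp : 1 < p) {x : Fin n → ℝ} {l t h : ℝ} (hl : 0 < l) (hh : h ≤ l ^ p)
    {z : SpaceTime n} (hz : z ∈ pbox x l t h) (hle : l ≤ parabolicInfDist p z E) :
    Disjoint (pbox x l t h) E := by
  rw [Set.disjoint_left]
  intro w hw hwE
  have h1 := hle.trans (parabolicInfDist_le hwE z)
  refine absurd h1 (not_le.2 ?_)
  rw [parabolicDist_lt_iff (by linarith) hl.le]
  refine ⟨norm_sub_lt_of_mem hl hz.1 hw.1, ?_⟩
  rw [mem_pbox] at hz hw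
  rw [abs_lt]
  constructor <;> linarith [hz.2.1, hz.2.2, hw.2.1, hw.2.2]

/-- In a free box the distance to `E` is at least the distance to the boundary. -/
lemma le_parabolicInfDist_of_disjoint (hp : 1 < p) (hE : E.Nonempty) {x : Fin n → ℝ}
    {l t h r : ℝ} (hr : 0 ≤ r) (hd : Disjoint (pbox x l t h) E) {z : SpaceTime n}
    (h1 : ∀ i, |z.1 i - x i| ≤ l / 2 - r) (h2 : t + r ^ p ≤ z.2) (h3 : z.2 ≤ t + h - r ^ p) :
    r ≤ parabolicInfDist p z E := by
  refine le_parabolicInfDist hE fun e he => ?_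
  by_contra! hlt
  rw [parabolicDist_lt_iff (by linarith) hr] at hlt
  refine Set.disjoint_left.1 hd ?_ he
  rw [mem_pbox]
  have h4 := abs_lt.1 hlt.2
  refine ⟨fun i => ?_, by linarith, by linarith⟩
  have h5 := abs_le.1 (h1 i)
  have h6 := abs_lt.1 ((abs_apply_sub_le_norm z.1 e.1 i).trans_lt hlt.1)
  constructor <;> linarith

end Dist

/-! ### The dyadic lattice of a parabolic rectangle -/

namespace ParabolicRect

variable {n : ℕ} {p : ℝ} {d : ℕ} {R : ParabolicRect n} {E : Set (SpaceTime n)}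

lemma toSet_eq_pbox (p : ℝ) (R : ParabolicRect n) :
    R.toSet p = pbox (fun i => R.corner i + R.side / 2) R.side R.bottom (R.timeLength p) := by
  ext z
  rw [mem_pbox]
  simp only [toSet, mem_ofPred_eq, mem_Ico]
  refine and_congr_left' (forall_congr' fun i => ?_)
  rw [add_sub_cancel_right, add_assoc, add_halves]

lemma Valid.timeLength_pos (hR : R.Valid) : 0 < R.timeLength p := by
  have := hR.2.2
  exact mul_pos (by linarith) (Real.rpow_pos_of_pos hR.1 _)

lemma Valid.timeLength_le (hR : R.Valid) : R.timeLength p ≤ R.side ^ p :=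
  mul_le_of_le_one_left (Real.rpow_pos_of_pos hR.1 _).le (by linarith [hR.2.1])

lemma Valid.le_timeLength (hR : R.Valid) : R.side ^ p / 2 ≤ R.timeLength p := by
  have h1 := Real.rpow_pos_of_pos hR.1 p
  have h2 : 1 / 2 ≤ 1 - R.trunc := by linarith [hR.2.2]
  rw [timeLength]
  nlinarith

lemma measurableSet_toSet (p : ℝ) (R : ParabolicRect n) : MeasurableSet (R.toSet p) := by
  rw [toSet_eq_pbox]; exact measurableSet_pbox _ _ _ _

lemma Valid.volume_toSet (hR : R.Valid) :
    volume (R.toSet p) = ENNReal.ofReal (R.side ^ n * R.timeLength p) := by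
  rw [toSet_eq_pbox, volume_pbox _ hR.1.le]

lemma Valid.vol_eq (hR : R.Valid) : R.vol p = R.side ^ n * R.timeLength p := by
  have := hR.timeLength_pos (p := p)
  have := hR.1
  rw [vol, Measure.real, hR.volume_toSet, ENNReal.toReal_ofReal (by positivity)]

lemma Valid.vol_pos (hR : R.Valid) : 0 < R.vol p := by
  rw [hR.vol_eq]
  exact mul_pos (pow_pos hR.1 _) hR.timeLength_pos

lemma Valid.volume_eq_ofReal_vol (hR : R.Valid) : volume (R.toSet p) = ENNReal.ofReal (R.vol p) := by
  rw [hR.vol_eq, hR.volume_toSet]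

lemma Valid.toSet_nonempty (hR : R.Valid) : (R.toSet p).Nonempty :=
  ⟨(R.corner, R.bottom), fun _ => ⟨le_rfl, lt_add_of_pos_right _ hR.1⟩, le_rfl,
    lt_add_of_pos_right _ hR.timeLength_pos⟩

lemma Valid.shift (hR : R.Valid) (p θ : ℝ) : (R.shift p θ).Valid := hR

lemma timeDivisions_pos (h3 : 3 ≤ (2 : ℝ) ^ (d * p)) (γ : ℝ) : 0 < timeDivisions p d γ := by
  unfold timeDivisions
  split_ifs
  · exact Nat.ceil_pos.2 (by linarith)
  · exact Nat.floor_pos.2 (by linarith)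

lemma timeLength_child (h3 : 3 ≤ (2 : ℝ) ^ (d * p)) (hR : R.Valid) (j : Fin n → ℕ) (i : ℕ) :
    (R.child p d j i).timeLength p = R.timeLength p / timeDivisions p d R.trunc := by
  have hD : ((2 : ℝ) ^ d) ^ p = 2 ^ (d * p) := by
    rw [← Real.rpow_natCast, ← Real.rpow_mul (by norm_num)]
  have hk : (0 : ℝ) < timeDivisions p d R.trunc := by exact_mod_cast timeDivisions_pos h3 _
  simp only [child, timeLength]
  rw [Real.div_rpow hR.1.le (by positivity), hD]
  field_simp
  ring

/-- The switch between ceiling and floor keeps the truncation in [0, 1/2]. With D = 2^(dp) and k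
divisions, the requirement is k/2 ≤ (1-γ)D ≤ k. The threshold is (1-γ)D ≥ (D+1)/2: above it the
ceiling, being less than D+1, is admissible; below it (1-γ)D < (D+1)/2 ≤ D-1 < ⌊D⌋, where the middle
inequality is D ≥ 3. -/
lemma Valid.child (h3 : 3 ≤ (2 : ℝ) ^ (d * p)) (hR : R.Valid) (j : Fin n → ℕ) (i : ℕ) :
    (R.child p d j i).Valid := by
  obtain ⟨hs, h0, h1⟩ := hR
  have hk : (0 : ℝ) < timeDivisions p d R.trunc := by exact_mod_cast timeDivisions_pos h3 _
  refine ⟨div_pos hs (by positivity), ?_⟩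
  simp only [ParabolicRect.child]
  suffices h : 1 / 2 * (timeDivisions p d R.trunc : ℝ) ≤ (1 - R.trunc) * 2 ^ (d * p) ∧
      (1 - R.trunc) * 2 ^ (d * p) ≤ timeDivisions p d R.trunc by
    rw [mul_div_assoc']
    constructor
    · linarith [(div_le_one hk).2 h.2]
    · linarith [(le_div_iff₀ hk).2 h.1]
  have e : (2 : ℝ) ^ (d * p + 1) = 2 ^ (d * p) * 2 := by
    rw [Real.rpow_add (by norm_num), Real.rpow_one]
  set D := (2 : ℝ) ^ (d * p) with hD
  have hD0 : 0 < D := by linarith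
  have e2 : D * ((D + 1) / (D * 2)) = (D + 1) / 2 := by field_simp
  unfold timeDivisions
  rw [← hD, e]
  split_ifs with hc
  · have h4 := Nat.le_ceil D
    have h5 := Nat.ceil_lt_add_one hD0.le
    have h6 : D * ((D + 1) / (D * 2)) ≤ D * (1 - R.trunc) := by gcongr; linarith
    constructor <;> nlinarith
  · have h4 := Nat.floor_le hD0.le
    have h5 := Nat.lt_floor_add_one D
    have h6 : D * (1 - R.trunc) ≤ D * ((D + 1) / (D * 2)) := by gcongr; linarith
    constructor <;> nlinarith

lemma Valid.of_mem_children (h3 : 3 ≤ (2 : ℝ) ^ (d * p)) (hR : R.Valid) {P : ParabolicRect n}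
    (hP : P ∈ R.children p d) : P.Valid := by
  obtain ⟨j, i, -, -, rfl⟩ := hP
  exact hR.child h3 j i

lemma mem_child_iff (h3 : 3 ≤ (2 : ℝ) ^ (d * p)) (hR : R.Valid) {j : Fin n → ℕ} {i : ℕ}
    {z : SpaceTime n} : z ∈ (R.child p d j i).toSet p ↔
      (∀ l, j l * (R.side / 2 ^ d) ≤ z.1 l - R.corner l ∧
        z.1 l - R.corner l < (j l + 1) * (R.side / 2 ^ d)) ∧
      i * (R.timeLength p / timeDivisions p d R.trunc) ≤ z.2 - R.bottom ∧
      z.2 - R.bottom < (i + 1) * (R.timeLength p / timeDivisions p d R.trunc) := by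
  simp only [toSet, mem_ofPred_eq, mem_Ico, timeLength_child h3 hR]
  simp only [ParabolicRect.child]
  refine and_congr (forall_congr' fun l => and_congr ?_ ?_) (and_congr ?_ ?_) <;>
    constructor <;> intro h <;> linarith

lemma iUnion_children (h3 : 3 ≤ (2 : ℝ) ^ (d * p)) (hR : R.Valid) :
    ⋃ P ∈ R.children p d, P.toSet p = R.toSet p := by
  have hk : (0 : ℝ) < timeDivisions p d R.trunc := by exact_mod_cast timeDivisions_pos h3 _
  have hs : 0 < R.side / 2 ^ d := div_pos hR.1 (by positivity)
  have ht : 0 < R.timeLength p / timeDivisions p d R.trunc := div_pos hR.timeLength_pos hk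
  have es : ((2 ^ d : ℕ) : ℝ) * (R.side / 2 ^ d) = R.side := by
    push_cast; field_simp
  have et : (timeDivisions p d R.trunc : ℝ) * (R.timeLength p / timeDivisions p d R.trunc) =
      R.timeLength p := mul_div_cancel₀ _ hk.ne'
  ext z
  simp only [mem_iUnion, exists_prop]
  constructor
  · rintro ⟨_, ⟨j, i, hj, hi, rfl⟩, hz⟩
    rw [mem_child_iff h3 hR] at hz
    have hi' : (i : ℝ) + 1 ≤ timeDivisions p d R.trunc := by exact_mod_cast hi
    have a2 := mul_le_mul_of_nonneg_right hi' ht.le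
    have a3 : 0 ≤ i * (R.timeLength p / timeDivisions p d R.trunc) := by positivity
    refine ⟨fun l => ?_, ⟨by linarith [hz.2.1], by linarith [hz.2.2]⟩⟩
    have hj' : (j l : ℝ) + 1 ≤ (2 ^ d : ℕ) := by exact_mod_cast hj l
    have b2 := mul_le_mul_of_nonneg_right hj' hs.le
    have b3 : 0 ≤ j l * (R.side / 2 ^ d) := by positivity
    exact ⟨by linarith [(hz.1 l).1], by linarith [(hz.1 l).2]⟩
  · rintro ⟨hz1, hz2⟩
    have hj : ∀ l, ∃ j : ℕ, j < 2 ^ d ∧ (j : ℝ) * (R.side / 2 ^ d) ≤ z.1 l - R.corner l ∧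
        z.1 l - R.corner l < (j + 1) * (R.side / 2 ^ d) := fun l =>
      exists_nat_slot hs (by linarith [(hz1 l).1]) (by rw [es]; linarith [(hz1 l).2])
    choose j hj0 hj1 using hj
    obtain ⟨i, hi0, hi1⟩ := exists_nat_slot ht (v := z.2 - R.bottom) (by linarith [hz2.1])
      (by rw [et]; linarith [hz2.2])
    exact ⟨_, ⟨j, i, hj0, hi0, rfl⟩, (mem_child_iff h3 hR).2 ⟨hj1, hi1⟩⟩

lemma pairwiseDisjoint_children (h3 : 3 ≤ (2 : ℝ) ^ (d * p)) (hR : R.Valid) :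
    (R.children p d).PairwiseDisjoint (fun P => P.toSet p) := by
  rintro _ ⟨j, i, -, -, rfl⟩ _ ⟨j', i', -, -, rfl⟩ hne
  refine Set.disjoint_left.2 fun z hz hz' => hne ?_
  have hk : (0 : ℝ) < timeDivisions p d R.trunc := by exact_mod_cast timeDivisions_pos h3 _
  have hs : 0 < R.side / 2 ^ d := div_pos hR.1 (by positivity)
  have ht : 0 < R.timeLength p / timeDivisions p d R.trunc := div_pos hR.timeLength_pos hk
  rw [mem_child_iff h3 hR] at hz hz'
  have e1 : i = i' := nat_slot_unique ht hz.2.1 hz.2.2 hz'.2.1 hz'.2.2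
  have e2 : j = j' := funext fun l =>
    nat_slot_unique hs (hz.1 l).1 (hz.1 l).2 (hz'.1 l).1 (hz'.1 l).2
  rw [e1, e2]

lemma finite_children (p : ℝ) (d : ℕ) (R : ParabolicRect n) : (R.children p d).Finite := by
  have : R.children p d ⊆ (fun q : (Fin n → ℕ) × ℕ => R.child p d q.1 q.2) ''
      ((Set.pi univ fun _ => Iio (2 ^ d)) ×ˢ Iio (timeDivisions p d R.trunc)) := by
    rintro _ ⟨j, i, hj, hi, rfl⟩
    exact ⟨(j, i), ⟨fun l _ => hj l, hi⟩, rfl⟩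
  exact (((Set.Finite.pi fun _ => finite_Iio _).prod (finite_Iio _)).image _).subset this

lemma finite_dyadicLayer (p : ℝ) (d : ℕ) (R : ParabolicRect n) (m : ℕ) :
    (R.dyadicLayer p d m).Finite := by
  induction m with
  | zero => exact finite_singleton R
  | succ m ih => exact ih.biUnion fun P _ => finite_children p d P

lemma mem_dyadicLayer_succ {m : ℕ} {P : ParabolicRect n} :
    P ∈ R.dyadicLayer p d (m + 1) ↔ ∃ Q ∈ R.dyadicLayer p d m, P ∈ Q.children p d := by
  simp [dyadicLayer]

lemma Valid.of_mem_dyadicLayer (h3 : 3 ≤ (2 : ℝ) ^ (d * p)) (hR : R.Valid) {m : ℕ} :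
    ∀ {P : ParabolicRect n}, P ∈ R.dyadicLayer p d m → P.Valid := by
  induction m with
  | zero => intro P hP; rwa [mem_singleton_iff.1 hP]
  | succ m ih =>
    intro P hP
    obtain ⟨Q, hQ, hPQ⟩ := mem_dyadicLayer_succ.1 hP
    exact (ih hQ).of_mem_children h3 hPQ

lemma side_of_mem_dyadicLayer {m : ℕ} :
    ∀ {P : ParabolicRect n}, P ∈ R.dyadicLayer p d m → P.side = R.side / (2 ^ d) ^ m := by
  induction m with
  | zero => intro P hP; rw [mem_singleton_iff.1 hP]; simp
  | succ m ih =>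
    intro P hP
    obtain ⟨Q, hQ, ⟨j, i, -, -, rfl⟩⟩ := mem_dyadicLayer_succ.1 hP
    simp only [child]
    rw [ih hQ, pow_succ, div_div]

lemma iUnion_dyadicLayer (h3 : 3 ≤ (2 : ℝ) ^ (d * p)) (hR : R.Valid) (m : ℕ) :
    ⋃ P ∈ R.dyadicLayer p d m, P.toSet p = R.toSet p := by
  induction m with
  | zero => simp [dyadicLayer]
  | succ m ih =>
    rw [← ih]
    simp only [dyadicLayer, biUnion_iUnion]
    exact iUnion₂_congr fun P hP => iUnion_children h3 (hR.of_mem_dyadicLayer h3 hP)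

lemma exists_mem_dyadicLayer (h3 : 3 ≤ (2 : ℝ) ^ (d * p)) (hR : R.Valid) (m : ℕ)
    {z : SpaceTime n} (hz : z ∈ R.toSet p) : ∃ P ∈ R.dyadicLayer p d m, z ∈ P.toSet p := by
  rw [← iUnion_dyadicLayer h3 hR m] at hz
  simpa using hz

lemma toSet_subset_of_mem_dyadicLayer (h3 : 3 ≤ (2 : ℝ) ^ (d * p)) (hR : R.Valid) {m : ℕ}
    {P : ParabolicRect n} (hP : P ∈ R.dyadicLayer p d m) : P.toSet p ⊆ R.toSet p := by
  rw [← iUnion_dyadicLayer h3 hR m]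
  exact subset_biUnion_of_mem (u := fun P : ParabolicRect n => P.toSet p) hP

lemma toSet_subset_of_mem_children (h3 : 3 ≤ (2 : ℝ) ^ (d * p)) (hR : R.Valid)
    {P : ParabolicRect n} (hP : P ∈ R.children p d) : P.toSet p ⊆ R.toSet p := by
  rw [← iUnion_children h3 hR]
  exact subset_biUnion_of_mem (u := fun P : ParabolicRect n => P.toSet p) hP

lemma exists_subset_of_mem_dyadicLayer_add (h3 : 3 ≤ (2 : ℝ) ^ (d * p)) (hR : R.Valid) {m : ℕ}
    (k : ℕ) : ∀ {P : ParabolicRect n}, P ∈ R.dyadicLayer p d (m + k) →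
      ∃ Q ∈ R.dyadicLayer p d m, P.toSet p ⊆ Q.toSet p := by
  induction k with
  | zero => intro P hP; exact ⟨P, hP, Subset.rfl⟩
  | succ k ih =>
    intro P hP
    obtain ⟨P', hP', hPP'⟩ := mem_dyadicLayer_succ.1 hP
    obtain ⟨Q, hQ, hPQ⟩ := ih hP'
    exact ⟨Q, hQ,
      (toSet_subset_of_mem_children h3 (hR.of_mem_dyadicLayer h3 hP') hPP').trans hPQ⟩

lemma pairwiseDisjoint_dyadicLayer (h3 : 3 ≤ (2 : ℝ) ^ (d * p)) (hR : R.Valid) (m : ℕ) :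
    (R.dyadicLayer p d m).PairwiseDisjoint (fun P => P.toSet p) := by
  induction m with
  | zero => exact pairwiseDisjoint_singleton _ _
  | succ m ih =>
    intro P hP Q hQ hne
    obtain ⟨P', hP', hPP'⟩ := mem_dyadicLayer_succ.1 hP
    obtain ⟨Q', hQ', hQQ'⟩ := mem_dyadicLayer_succ.1 hQ
    have hPv := hR.of_mem_dyadicLayer h3 hP'
    have hQv := hR.of_mem_dyadicLayer h3 hQ'
    by_cases h : P' = Q'
    · subst h
      exact pairwiseDisjoint_children h3 hPv hPP' hQQ' hne
    · exact (ih hP' hQ' h).mono (toSet_subset_of_mem_children h3 hPv hPP')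
        (toSet_subset_of_mem_children h3 hQv hQQ')

/-- Two dyadic rectangles are nested or disjoint. -/
lemma subset_of_mem_of_mem (h3 : 3 ≤ (2 : ℝ) ^ (d * p)) (hR : R.Valid) {m k : ℕ} (hmk : m ≤ k)
    {P Q : ParabolicRect n} (hP : P ∈ R.dyadicLayer p d m) (hQ : Q ∈ R.dyadicLayer p d k)
    {z : SpaceTime n} (hzP : z ∈ P.toSet p) (hzQ : z ∈ Q.toSet p) : Q.toSet p ⊆ P.toSet p := by
  obtain ⟨j, rfl⟩ := Nat.exists_eq_add_of_le hmk
  obtain ⟨P', hP', hQP'⟩ := exists_subset_of_mem_dyadicLayer_add h3 hR j hQ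
  have : P = P' := (pairwiseDisjoint_dyadicLayer h3 hR m).elim hP hP'
    (Set.not_disjoint_iff.2 ⟨z, hzP, hQP' hzQ⟩)
  rwa [this]

lemma mem_freeDyadic_iff {P : ParabolicRect n} : P ∈ R.freeDyadic p d E ↔
    ∃ m, P ∈ R.dyadicLayer p d m ∧ Disjoint (P.toSet p) E := by
  simp [freeDyadic, dyadic]

lemma side_le_side (hR : R.Valid) {m k : ℕ} (hmk : m ≤ k) {P Q : ParabolicRect n}
    (hP : P ∈ R.dyadicLayer p d m) (hQ : Q ∈ R.dyadicLayer p d k) : Q.side ≤ P.side := by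
  rw [side_of_mem_dyadicLayer hP, side_of_mem_dyadicLayer hQ]
  have := hR.1
  gcongr
  exact one_le_pow₀ (by norm_num)

/-- The side length depends only on the layer, so any free rectangle of the coarsest layer
containing one is largest. By nestedness it is also maximal for inclusion at each of its points. -/
lemma exists_largest_free (h3 : 3 ≤ (2 : ℝ) ^ (d * p)) (hR : R.Valid) {P₀ : ParabolicRect n}
    (hP₀ : P₀ ∈ R.freeDyadic p d E) :
    ∃ M ∈ R.maximalFree p d E, ∀ P ∈ R.freeDyadic p d E, P.side ≤ M.side := by
  classical
  obtain ⟨m₀, hm₀, hd₀⟩ := mem_freeDyadic_iff.1 hP₀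
  have hex : ∃ m, ∃ P ∈ R.dyadicLayer p d m, Disjoint (P.toSet p) E := ⟨m₀, P₀, hm₀, hd₀⟩
  obtain ⟨M, hM, hME⟩ := Nat.find_spec hex
  obtain ⟨z, hz⟩ := (hR.of_mem_dyadicLayer h3 hM).toSet_nonempty (p := p)
  refine ⟨M, ⟨mem_freeDyadic_iff.2 ⟨_, hM, hME⟩, z,
    ⟨toSet_subset_of_mem_dyadicLayer h3 hR hM hz, Set.disjoint_left.1 hME hz⟩, hz, ?_⟩, ?_⟩
  · intro Q hQ hzQ
    obtain ⟨k, hk, hQE⟩ := mem_freeDyadic_iff.1 hQ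
    exact subset_of_mem_of_mem h3 hR (Nat.find_min' hex ⟨Q, hk, hQE⟩) hM hk hz hzQ
  · intro Q hQ
    obtain ⟨k, hk, hQE⟩ := mem_freeDyadic_iff.1 hQ
    exact side_le_side hR (Nat.find_min' hex ⟨Q, hk, hQE⟩) hM hk

/-- The maximal hole is a free dyadic rectangle of largest side length. -/
lemma exists_maximalHole_eq (h3 : 3 ≤ (2 : ℝ) ^ (d * p)) (hR : R.Valid) {P₀ : ParabolicRect n}
    (hP₀ : P₀ ∈ R.freeDyadic p d E) :
    ∃ M ∈ R.freeDyadic p d E, R.maximalHole p d E = M.toSet p ∧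
      ∀ P ∈ R.freeDyadic p d E, P.side ≤ M.side := by
  obtain ⟨M₁, hM₁, hle⟩ := exists_largest_free h3 hR hP₀
  have hex : ∃ M, R.IsMaximalHole p d E M := ⟨M₁, hM₁, fun P hP => hle P hP.1⟩
  have hs := hex.choose_spec
  refine ⟨hex.choose, hs.1.1, ?_, fun P hP => (hle P hP).trans (hs.2 M₁ hM₁)⟩
  rw [maximalHole, dif_pos hex]

lemma volume_biUnion_finset {S : Finset (ParabolicRect n)}
    (hv : ∀ P ∈ S, P.Valid)
    (hd : (S : Set (ParabolicRect n)).PairwiseDisjoint (fun P => P.toSet p)) :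
    volume (⋃ P ∈ S, P.toSet p) = ENNReal.ofReal (∑ P ∈ S, P.vol p) := by
  rw [measure_biUnion_finset hd fun P _ => measurableSet_toSet p P,
    ENNReal.ofReal_sum_of_nonneg fun P hP => (hv P hP).vol_pos.le]
  exact Finset.sum_congr rfl fun P hP => (hv P hP).volume_eq_ofReal_vol

end ParabolicRect

/-! ### Backward chains of boxes -/

section Chain

variable {n : ℕ}

/-- A value of `u` in a box is controlled by a value in the box lying `a * ρ ^ p` earlier and moved
by at most `ε * ρ` in space. -/
def HasBackwardStep (p : ℝ) (u : SpaceTime n → ℝ) (a b ε κ : ℝ) : Prop :=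
  ∀ (x x' : Fin n → ℝ) (t ρ : ℝ), 0 < ρ → ‖x - x'‖ ≤ ε * ρ →
    ∀ y ∈ pbox x ρ (t + a * ρ ^ p) (b * ρ ^ p), ∃ z ∈ pbox x' ρ t (b * ρ ^ p), κ * u y ≤ u z

/-- A backward Harnack inequality: a value `u y` is controlled by a value in any prescribed box of
scale `η * r` that lies earlier than `y`, at parabolic distance comparable to `r`. -/
def HasBackwardHarnack (p : ℝ) (u : SpaceTime n → ℝ) (τ τ' D η κ : ℝ) : Prop :=
  ∀ (x : Fin n → ℝ) (t r : ℝ) (y : SpaceTime n), 0 < r → τ * r ^ p ≤ y.2 - t →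
    y.2 - t ≤ τ' * r ^ p → ‖y.1 - x‖ ≤ D * r →
    ∃ z ∈ pbox x (η * r) t (η * r ^ p), κ * u y ≤ u z

lemma HasBackwardStep.iterate {p a b ε κ : ℝ} {u : SpaceTime n → ℝ} (hκ : 0 ≤ κ)
    (h : HasBackwardStep p u a b ε κ) (k : ℕ) :
    ∀ (x x' : Fin n → ℝ) (t ρ : ℝ), 0 < ρ → ‖x - x'‖ ≤ k * ε * ρ →
      ∀ y ∈ pbox x ρ (t + k * a * ρ ^ p) (b * ρ ^ p),
        ∃ z ∈ pbox x' ρ t (b * ρ ^ p), κ ^ k * u y ≤ u z := by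
  induction k with
  | zero =>
    intro x x' t ρ hρ hx y hy
    have hxx : x = x' := by simpa [sub_eq_zero] using hx
    subst hxx
    exact ⟨y, by simpa using hy, by simp⟩
  | succ k ih =>
    intro x x' t ρ hρ hx y hy
    have hk : (0 : ℝ) < (k : ℝ) + 1 := by positivity
    push_cast at hx hy
    set x'' := x' + (1 / ((k : ℝ) + 1)) • (x - x') with hx''
    have e1 : x'' - x' = (1 / ((k : ℝ) + 1)) • (x - x') := by rw [hx'']; abel
    have e2 : x - x'' = (k / ((k : ℝ) + 1)) • (x - x') := by
      have : x - x'' = (1 : ℝ) • (x - x') - (1 / ((k : ℝ) + 1)) • (x - x') := by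
        rw [hx'', one_smul]; abel
      rw [this, ← sub_smul]
      congr 1
      field_simp
      ring
    obtain ⟨z, hz, hzu⟩ := ih x x'' (t + a * ρ ^ p) ρ hρ (by
      rw [e2, norm_smul, Real.norm_of_nonneg (by positivity), div_mul_eq_mul_div, div_le_iff₀ hk]
      calc (k : ℝ) * ‖x - x'‖ ≤ k * ((k + 1) * ε * ρ) := by gcongr
        _ = _ := by ring) y (by
        rwa [show t + a * ρ ^ p + k * a * ρ ^ p = t + (k + 1) * a * ρ ^ p by ring])
    obtain ⟨z', hz', hzu'⟩ := h x'' x' t ρ hρ (by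
      rw [e1, norm_smul, Real.norm_of_nonneg (by positivity), one_div, inv_mul_le_iff₀ hk]
      linarith) z hz
    refine ⟨z', hz', le_trans ?_ hzu'⟩
    rw [pow_succ', mul_assoc]
    exact mul_le_mul_of_nonneg_left hzu hκ

/-! ### From one backward step to a Harnack inequality. -/

lemma exists_nat_rpow_ge {q : ℝ} (hq : 0 < q) (A B C : ℝ) :
    ∃ k : ℕ, 1 ≤ k ∧ A ≤ k ∧ B ≤ k ∧ C ≤ (k : ℝ) ^ q := by
  have h1 := tendsto_natCast_atTop_atTop (R := ℝ)
  have h2 := (tendsto_rpow_atTop hq).comp h1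
  exact ((Filter.eventually_ge_atTop 1).and <| (h1.eventually_ge_atTop A).and <|
    (h1.eventually_ge_atTop B).and <| h2.eventually_ge_atTop C).exists

/-- A chain of k equal steps, with k depending only on the parameters. The three lower bounds on k
make the step scale at most η r, the final box short enough in time, and the spatial reach k ε ρ at
least D r; the last one reads k^(p-1) ≥ const and is met because p > 1. -/
lemma exists_backwardHarnack {p a b ε κ τ τ' D η : ℝ} (hp : 1 < p) (ha : 0 < a)
    (hε : 0 < ε) (hκ : 0 < κ) (hb : 0 < b) (hτ : 0 < τ) (hD : 0 ≤ D) (hη : 0 < η) :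
    ∃ κ' > 0, ∀ u : SpaceTime n → ℝ, HasBackwardStep p u a b ε κ →
      HasBackwardHarnack p u τ τ' D η κ' := by
  have hp0 : 0 < p := by linarith
  obtain ⟨k, hk1, hkA, hkB, hkC⟩ := exists_nat_rpow_ge (q := p - 1) (by linarith)
    (τ' / (a * η ^ p)) (b * τ' / (a * η)) (D ^ p * a / (ε ^ p * τ))
  have hk : (0 : ℝ) < k := by exact_mod_cast hk1
  refine ⟨κ ^ k, by positivity, fun u hu x t r y hr h1 h2 h3 => ?_⟩
  have hrp : 0 < r ^ p := by positivity
  set T := y.2 - t with hT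
  have hT0 : 0 < T := lt_of_lt_of_le (by positivity) h1
  set ρ := (T / (k * a)) ^ (1 / p) with hρ
  have hρ0 : 0 < ρ := by positivity
  have hρp : ρ ^ p = T / (k * a) := by
    rw [hρ, ← Real.rpow_mul (by positivity), one_div_mul_cancel hp0.ne', Real.rpow_one]
  have hρη : ρ ≤ η * r := by
    rw [← Real.rpow_le_rpow_iff hρ0.le (by positivity) hp0, hρp, Real.mul_rpow hη.le hr.le,
      div_le_iff₀ (by positivity)]
    rw [div_le_iff₀ (by positivity)] at hkA
    calc T ≤ τ' * r ^ p := h2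
      _ ≤ (k * (a * η ^ p)) * r ^ p := by gcongr
      _ = _ := by ring
  have hbρ : b * ρ ^ p ≤ η * r ^ p := by
    rw [hρp, mul_div_assoc', div_le_iff₀ (by positivity)]
    rw [div_le_iff₀ (by positivity)] at hkB
    calc b * T ≤ b * (τ' * r ^ p) := by gcongr
      _ = (b * τ') * r ^ p := by ring
      _ ≤ (k * (a * η)) * r ^ p := by gcongr
      _ = _ := by ring
  have hDρ : ‖y.1 - x‖ ≤ k * ε * ρ := by
    refine h3.trans ?_
    rw [← Real.rpow_le_rpow_iff (by positivity) (by positivity) hp0, Real.mul_rpow hD hr.le,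
      Real.mul_rpow (by positivity) hρ0.le, Real.mul_rpow hk.le hε.le, hρp]
    rw [div_le_iff₀ (by positivity), Real.rpow_sub_one hk.ne'] at hkC
    calc D ^ p * r ^ p ≤ ((k : ℝ) ^ p / k * (ε ^ p * τ) / a) * r ^ p := by
          gcongr
          rw [le_div_iff₀ ha]
          exact hkC
      _ = (k : ℝ) ^ p * ε ^ p * (τ * r ^ p / (k * a)) := by field_simp
      _ ≤ _ := by gcongr
  obtain ⟨z, hz, hzu⟩ := hu.iterate hκ.le k y.1 x t ρ hρ0 hDρ y (by
    have e : t + k * a * ρ ^ p = y.2 := by rw [hρp, mul_div_cancel₀ _ (by positivity)]; linarith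
    rw [e]
    exact ⟨self_mem_halfOpenCube _ hρ0, le_refl _, lt_add_of_pos_right _ (by positivity)⟩)
  refine ⟨z, pbox_subset ?_ le_rfl (by linarith) hz, hzu⟩
  simpa using (by linarith : ρ / 2 ≤ η * r / 2)

/-! ### Integral bounds for negative powers -/

/-- The integral of `u ^ (-s)` over a box is controlled by the values of `u` in the box lying
`a * l ^ p` later. -/
def HasIntegralBound (p : ℝ) (u : SpaceTime n → ℝ) (a b s A : ℝ) : Prop :=
  ∀ (x : Fin n → ℝ) (l t : ℝ), 0 < l → ∀ y ∈ pbox x l (t + a * l ^ p) (b * l ^ p),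
    ∫⁻ z in pbox x l t (b * l ^ p), ENNReal.ofReal (u z) ^ (-s) ≤
      ENNReal.ofReal (A * (l ^ n * l ^ p)) * ENNReal.ofReal (u y) ^ (-s)

lemma ofReal_mul_rpow_neg {κ v s : ℝ} (hκ : 0 < κ) (hv : 0 ≤ v) (hs : 0 < s) :
    ENNReal.ofReal (κ * v) ^ (-s) = ENNReal.ofReal (κ ^ (-s)) * ENNReal.ofReal v ^ (-s) := by
  rw [ENNReal.ofReal_mul hκ.le]
  rcases hv.eq_or_lt with rfl | hv
  · rw [ENNReal.ofReal_zero, mul_zero, ENNReal.zero_rpow_of_neg (by linarith), ENNReal.mul_top]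
    rw [Ne, ENNReal.ofReal_eq_zero, not_le]
    positivity
  · rw [ENNReal.mul_rpow_of_ne_top ENNReal.ofReal_ne_top ENNReal.ofReal_ne_top,
      ENNReal.ofReal_rpow_of_pos hκ]

lemma rpow_neg_le_rpow_neg {v w : ℝ≥0∞} {s : ℝ} (hs : 0 ≤ s) (h : v ≤ w) : w ^ (-s) ≤ v ^ (-s) := by
  rw [ENNReal.rpow_neg, ENNReal.rpow_neg, ENNReal.inv_le_inv]
  exact ENNReal.rpow_le_rpow h hs

/-- If u were below κ u(y) on the whole target box, then u^(-s) would exceed κ^(-s) u(y)^(-s) there,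
and the integral over the box of doubled side would violate the bound. Doubling the side makes room
for the displacement ρ/4; κ is defined by κ^(-s) = M, where M is just above the ratio A 2^n / b at
which the contradiction starts. -/
lemma HasIntegralBound.hasBackwardStep {p a b s A : ℝ} (hb : 0 < b) (hs : 0 < s)
    (hA : 0 < A) :
    ∃ κ > 0, ∀ u : SpaceTime n → ℝ, (∀ z, 0 ≤ u z) → HasIntegralBound p u a b s A →
      HasBackwardStep p u (a * 2 ^ p) (b * 2 ^ p) (1 / 4) κ := by
  set M := A * 2 ^ n / b + 1 with hM
  have hM0 : 0 < M := by positivity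
  refine ⟨M ^ (-s⁻¹), by positivity, fun u hu0 hu x x' t ρ hρ hxx y hy => ?_⟩
  set κ := M ^ (-s⁻¹) with hκ
  have hκ0 : 0 < κ := by positivity
  have hκs : κ ^ (-s) = M := by
    rw [hκ, ← Real.rpow_mul hM0.le, neg_mul_neg, inv_mul_cancel₀ hs.ne', Real.rpow_one]
  by_contra! hcon
  have e : (2 * ρ) ^ p = 2 ^ p * ρ ^ p := Real.mul_rpow (by norm_num) hρ.le
  have hyb : y ∈ pbox x' (2 * ρ) (t + a * (2 * ρ) ^ p) (b * (2 * ρ) ^ p) := by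
    refine pbox_subset (by linarith) ?_ ?_ hy <;> rw [e] <;> apply le_of_eq <;> ring
  have hint := hu x' (2 * ρ) t (by positivity) y hyb
  have hsub : pbox x' ρ t (b * 2 ^ p * ρ ^ p) ⊆ pbox x' (2 * ρ) t (b * (2 * ρ) ^ p) :=
    pbox_subset (by simpa using by linarith) le_rfl (by rw [e, mul_assoc])
  have huy : 0 < u y := by
    have h1 := hcon (x', t) ⟨self_mem_halfOpenCube _ hρ, le_refl _,
      lt_add_of_pos_right _ (by positivity)⟩
    exact pos_of_mul_pos_right ((hu0 _).trans_lt h1) hκ0.le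
  have h2 : ENNReal.ofReal (κ * u y) ^ (-s) * volume (pbox x' ρ t (b * 2 ^ p * ρ ^ p)) ≤
      ∫⁻ z in pbox x' (2 * ρ) t (b * (2 * ρ) ^ p), ENNReal.ofReal (u z) ^ (-s) := by
    refine le_trans ?_ (lintegral_mono_set hsub)
    rw [← setLIntegral_const]
    exact setLIntegral_mono' (measurableSet_pbox _ _ _ _) fun z hz =>
      rpow_neg_le_rpow_neg hs.le (ENNReal.ofReal_le_ofReal (hcon z hz).le)
  have h3 := h2.trans hint
  rw [ofReal_mul_rpow_neg hκ0 huy.le hs, volume_pbox _ hρ.le, hκs, mul_right_comm,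
    ← ENNReal.ofReal_mul hM0.le] at h3
  have h4 : ENNReal.ofReal (u y) ^ (-s) ≠ 0 := by
    rw [ENNReal.ofReal_rpow_of_pos huy, Ne, ENNReal.ofReal_eq_zero, not_le]; positivity
  have h5 : ENNReal.ofReal (u y) ^ (-s) ≠ ⊤ := by
    rw [ENNReal.ofReal_rpow_of_pos huy]; exact ENNReal.ofReal_ne_top
  rw [ENNReal.mul_le_mul_iff_left h4 h5, ENNReal.ofReal_le_ofReal_iff (by positivity), e] at h3
  have hMb : M * b = A * 2 ^ n + b := by rw [hM]; field_simp
  have h6 : M * (ρ ^ n * (b * 2 ^ p * ρ ^ p)) = (M * b) * (ρ ^ n * (2 ^ p * ρ ^ p)) := by ring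
  have h7 : A * ((2 * ρ) ^ n * (2 ^ p * ρ ^ p)) = (A * 2 ^ n) * (ρ ^ n * (2 ^ p * ρ ^ p)) := by
    rw [mul_pow]; ring
  rw [h6, h7, mul_le_mul_iff_left₀ (by positivity), hMb] at h3
  linarith

/-- A box is covered by finitely many small boxes with prescribed aspect ratio. -/
lemma pbox_subset_iUnion (x : Fin n → ℝ) {L t H : ℝ} {M K : ℕ} (hL : 0 < L) (hM : 0 < M)
    {h : ℝ} (hh : 0 < h) (hK : H ≤ K * h) :
    pbox x L t H ⊆ ⋃ q : (Fin n → Fin M) × Fin K,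
      pbox (fun i => x i - L / 2 + (q.1 i + 1 / 2) * (L / M)) (L / M) (t + q.2 * h) h := by
  have hM0 : (0 : ℝ) < M := by exact_mod_cast hM
  have hl : 0 < L / M := by positivity
  intro z hz
  rw [mem_pbox] at hz
  have hs : ∀ i, ∃ j < M, j * (L / M) ≤ z.1 i - (x i - L / 2) ∧
      z.1 i - (x i - L / 2) < (j + 1) * (L / M) := fun i =>
    exists_nat_slot hl (by linarith [(hz.1 i).1]) (by
      rw [mul_div_cancel₀ _ hM0.ne']; linarith [(hz.1 i).2])
  choose j hj0 hj1 hj2 using hs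
  obtain ⟨k, hk0, hk1, hk2⟩ := exists_nat_slot hh (v := z.2 - t) (by linarith) (by linarith)
  rw [mem_iUnion]
  refine ⟨(fun i => ⟨j i, hj0 i⟩, ⟨k, hk0⟩), mem_pbox.2 ⟨fun i => ⟨?_, ?_⟩, ?_, ?_⟩⟩
  · have := hj1 i
    simp only; linarith
  · have := hj2 i
    simp only; linarith
  · simp only; linarith
  · simp only; linarith

/-- A local integral bound and a Harnack inequality yield integral bounds over boxes of arbitrary
shape and position. -/
lemma HasIntegralBound.exists_global {p a b s A σ τ τ' D : ℝ} (hp : 1 < p) (ha : 0 < a)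
    (hb : 0 < b) (hs : 0 < s) (hA : 0 < A) (hσ : 0 < σ) (hτ : 0 < τ) (hD : 0 ≤ D) :
    ∃ A' > 0, ∀ u : SpaceTime n → ℝ, (∀ z, 0 ≤ u z) → HasIntegralBound p u a b s A →
      ∀ (x : Fin n → ℝ) (t L : ℝ) (y : SpaceTime n), 0 < L → τ * L ^ p ≤ y.2 - t →
        y.2 - t ≤ τ' * L ^ p → ‖y.1 - x‖ ≤ D * L →
        ∫⁻ z in pbox x L (t - σ * L ^ p) (σ * L ^ p), ENNReal.ofReal (u z) ^ (-s) ≤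
          ENNReal.ofReal (A' * (L ^ n * L ^ p)) * ENNReal.ofReal (u y) ^ (-s) := by
  have hp0 : 0 < p := by linarith
  obtain ⟨κ₀, hκ₀, hstep⟩ := HasIntegralBound.hasBackwardStep (n := n) (p := p) (a := a) hb hs hA
  -- M is so large that the lag of a small box, a (L/M)^p, uses at most half of the available gap τ
  -- L^p; the Harnack chain crosses the remaining half.
  obtain ⟨M, hM1, -, -, hM⟩ := exists_nat_rpow_ge hp0 0 0 (2 * a / τ)
  have hM0 : (0 : ℝ) < M := by exact_mod_cast hM1
  have hMp : 0 < (M : ℝ) ^ p := by positivity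
  set η := min (1 / (M : ℝ)) (b / (M : ℝ) ^ p) with hη
  have hη0 : 0 < η := lt_min (by positivity) (by positivity)
  obtain ⟨κ, hκ, hhar⟩ := exists_backwardHarnack (n := n) (τ := τ / 2) (τ' := τ' + σ) (D := D + 1)
    (η := η) hp (a := a * 2 ^ p) (b := b * 2 ^ p) (ε := 1 / 4)
    (by positivity) (by norm_num) hκ₀ (by positivity) (by positivity) (by positivity) hη0
  set K := ⌈σ * (M : ℝ) ^ p / b⌉₊ with hK
  set N := Fintype.card ((Fin n → Fin M) × Fin K) with hN
  refine ⟨(N + 1) * (A * κ ^ (-s)), by positivity, fun u hu0 hu x t L y hL h1 h2 h3 => ?_⟩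
  have hLp : 0 < L ^ p := by positivity
  have eL : (L / M) ^ p = L ^ p / (M : ℝ) ^ p := Real.div_rpow hL.le hM0.le p
  have hl : 0 < L / M := by positivity
  have hLM : L / M ≤ L := div_le_self hL.le (by exact_mod_cast hM1)
  have hlp : (L / M) ^ p ≤ L ^ p := Real.rpow_le_rpow hl.le hLM hp0.le
  have hln : (L / M) ^ n ≤ L ^ n := pow_le_pow_left₀ hl.le hLM n
  have hcov := pbox_subset_iUnion x (t := t - σ * L ^ p) (H := σ * L ^ p) (M := M) (K := K) hL
    (by omega) (h := b * (L / M) ^ p) (by positivity) (by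
      have := Nat.le_ceil (σ * (M : ℝ) ^ p / b)
      rw [eL]
      calc σ * L ^ p = (σ * (M : ℝ) ^ p / b) * (b * (L ^ p / (M : ℝ) ^ p)) := by field_simp
        _ ≤ _ := by gcongr)
  refine (lintegral_mono_set hcov).trans ((lintegral_iUnion_le _ _).trans ?_)
  rw [tsum_fintype]
  have hterm : ∀ q : (Fin n → Fin M) × Fin K,
      ∫⁻ z in pbox (fun i => x i - L / 2 + (q.1 i + 1 / 2) * (L / M)) (L / M)
        (t - σ * L ^ p + q.2 * (b * (L / M) ^ p)) (b * (L / M) ^ p), ENNReal.ofReal (u z) ^ (-s) ≤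
      ENNReal.ofReal (A * κ ^ (-s) * (L ^ n * L ^ p)) * ENNReal.ofReal (u y) ^ (-s) := by
    intro q
    set x' : Fin n → ℝ := fun i => x i - L / 2 + (q.1 i + 1 / 2) * (L / M) with hx'
    set t' := t - σ * L ^ p + q.2 * (b * (L / M) ^ p) with ht'
    have hxx' : ‖x - x'‖ ≤ L := by
      rw [pi_norm_le_iff_of_nonneg hL.le]
      intro i
      have hq1 : ((q.1 i : ℕ) : ℝ) + 1 ≤ M := by exact_mod_cast (q.1 i).2
      have hq2 : ((q.1 i : ℕ) : ℝ) * (L / M) + L / M ≤ L := by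
        calc ((q.1 i : ℕ) : ℝ) * (L / M) + L / M = ((q.1 i : ℕ) + 1) * (L / M) := by ring
          _ ≤ M * (L / M) := by gcongr
          _ = L := mul_div_cancel₀ _ hM0.ne'
      have hq3 : 0 ≤ ((q.1 i : ℕ) : ℝ) * (L / M) := by positivity
      simp only [Pi.sub_apply, hx', Real.norm_eq_abs, abs_le]
      constructor <;> linarith
    have ht1 : t' ≤ t := by
      have hq : ((q.2 : ℕ) : ℝ) ≤ σ * (M : ℝ) ^ p / b :=
        (Nat.lt_ceil.1 q.2.2).le
      have : q.2 * (b * (L / M) ^ p) ≤ σ * L ^ p := by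
        rw [eL]
        calc q.2 * (b * (L ^ p / (M : ℝ) ^ p))
            ≤ (σ * (M : ℝ) ^ p / b) * (b * (L ^ p / (M : ℝ) ^ p)) := by gcongr
          _ = _ := by field_simp
      linarith
    have ht2 : t - σ * L ^ p ≤ t' := by
      have : 0 ≤ q.2 * (b * (L / M) ^ p) := by positivity
      linarith
    have haL : a * (L / M) ^ p ≤ τ / 2 * L ^ p := by
      rw [eL, mul_div_assoc', div_le_iff₀ hMp]
      rw [div_le_iff₀ hτ] at hM
      calc a * L ^ p = (2 * a) / 2 * L ^ p := by ring
        _ ≤ ((M : ℝ) ^ p * τ) / 2 * L ^ p := by gcongr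
        _ = _ := by ring
    -- The local bound for the small box needs a value in the box just after it; the chain from y
    -- supplies such a point z with u(z) ≥ κ u(y).
    obtain ⟨z, hz, hzu⟩ := hhar u (hstep u hu0 hu) x' (t' + a * (L / M) ^ p) L y hL
      (by linarith)
      (by
        have : 0 < a * (L / M) ^ p := by positivity
        linarith)
      (by
        calc ‖y.1 - x'‖ ≤ ‖y.1 - x‖ + ‖x - x'‖ := norm_sub_le_norm_sub_add_norm_sub _ _ _
          _ ≤ _ := by linarith)
    have hz' : z ∈ pbox x' (L / M) (t' + a * (L / M) ^ p) (b * (L / M) ^ p) := by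
      refine pbox_subset ?_ le_rfl ?_ hz
      · have : η * L ≤ 1 / M * L := by gcongr; exact min_le_left _ _
        rw [sub_self, norm_zero]
        linarith [show 1 / M * L = L / M by ring]
      · have : η * L ^ p ≤ b / (M : ℝ) ^ p * L ^ p := by gcongr; exact min_le_right _ _
        rw [eL]
        linarith [show b / (M : ℝ) ^ p * L ^ p = b * (L ^ p / (M : ℝ) ^ p) by ring]
    refine (hu x' (L / M) t' hl z hz').trans ?_
    calc ENNReal.ofReal (A * ((L / M) ^ n * (L / M) ^ p)) * ENNReal.ofReal (u z) ^ (-s)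
        ≤ ENNReal.ofReal (A * (L ^ n * L ^ p)) * ENNReal.ofReal (κ * u y) ^ (-s) := by
          gcongr ENNReal.ofReal (A * (?_ * ?_)) * ?_
          exact rpow_neg_le_rpow_neg hs.le (ENNReal.ofReal_le_ofReal hzu)
      _ = _ := by
          rw [ofReal_mul_rpow_neg hκ (hu0 y) hs, ← mul_assoc, ← ENNReal.ofReal_mul (by positivity)]
          congr 2
          ring
  refine (Finset.sum_le_sum fun q _ => hterm q).trans ?_
  rw [Finset.sum_const, nsmul_eq_mul, Finset.card_univ, ← hN, ← mul_assoc]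
  gcongr
  rw [← ENNReal.ofReal_natCast, ← ENNReal.ofReal_mul (by positivity)]
  apply ENNReal.ofReal_le_ofReal
  rw [← mul_assoc]
  gcongr
  linarith

end Chain

/-! ### Weak porosity in terms of the distance function -/

section Porosity

variable {n : ℕ} {p : ℝ} {d : ℕ} {E : Set (SpaceTime n)}

/-- A fixed proportion of every box consists of points where `u` is at least a constant times any
of its values in the box shifted forward by `θ`. -/
def HasLargeValues (p : ℝ) (u : SpaceTime n → ℝ) (θ κ c : ℝ) : Prop :=
  ∀ (x : Fin n → ℝ) (l t h : ℝ), 0 < l → l ^ p / 2 ≤ h → h ≤ l ^ p →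
    ∀ y ∈ pbox x l (t + θ * h) h,
      ENNReal.ofReal c * volume (pbox x l t h) ≤ volume {z ∈ pbox x l t h | κ * u y ≤ u z}

/-- The proportion of a box where `u` is smaller than `σ` times one of its values in the box shifted
forward by `θ` decays like `σ ^ s`. -/
def HasDecay (p : ℝ) (u : SpaceTime n → ℝ) (θ s A : ℝ) : Prop :=
  ∀ (x : Fin n → ℝ) (l t h : ℝ), 0 < l → l ^ p / 2 ≤ h → h ≤ l ^ p →
    ∀ y ∈ pbox x l (t + θ * h) h, ∀ σ > 0,
      volume {z ∈ pbox x l t h | u z < σ * u y} ≤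
        ENNReal.ofReal (A * σ ^ s) * volume (pbox x l t h)

/-- The parabolic rectangle with given center, side length, bottom and temporal length. -/
noncomputable def ParabolicRect.ofBox (p : ℝ) (x : Fin n → ℝ) (l t h : ℝ) : ParabolicRect n where
  corner := fun i => x i - l / 2
  bottom := t
  side := l
  trunc := 1 - h / l ^ p

namespace ParabolicRect

lemma timeLength_ofBox (x : Fin n → ℝ) {l : ℝ} (t h : ℝ) (hl : 0 < l) :
    (ofBox p x l t h).timeLength p = h := by
  have := Real.rpow_pos_of_pos hl p
  simp only [ofBox, timeLength, sub_sub_cancel]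
  field_simp

lemma toSet_ofBox (x : Fin n → ℝ) {l : ℝ} (t h : ℝ) (hl : 0 < l) :
    (ofBox p x l t h).toSet p = pbox x l t h := by
  rw [toSet_eq_pbox, timeLength_ofBox x t h hl]
  simp [ofBox]

lemma toSet_shift_ofBox (x : Fin n → ℝ) {l : ℝ} (t h θ : ℝ) (hl : 0 < l) :
    ((ofBox p x l t h).shift p θ).toSet p = pbox x l (t + θ * h) h := by
  rw [shift, timeLength_ofBox x t h hl, ← toSet_ofBox x (t + θ * h) h hl]
  rfl

lemma valid_ofBox (x : Fin n → ℝ) {l t h : ℝ} (hl : 0 < l) (h1 : l ^ p / 2 ≤ h)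
    (h2 : h ≤ l ^ p) : (ofBox p x l t h).Valid := by
  have hlp := Real.rpow_pos_of_pos hl p
  refine ⟨hl, ?_, ?_⟩
  · simp only [ofBox]
    linarith [(div_le_one hlp).2 h2]
  · simp only [ofBox]
    linarith [(le_div_iff₀ hlp).2 (show 1 / 2 * l ^ p ≤ h by linarith)]

lemma toSet_eq_pbox_of_valid {R : ParabolicRect n} (p : ℝ) :
    ∃ x : Fin n → ℝ, R.toSet p = pbox x R.side R.bottom (R.timeLength p) ∧
      ∀ θ, (R.shift p θ).toSet p = pbox x R.side (R.bottom + θ * R.timeLength p) (R.timeLength p) :=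
  ⟨_, toSet_eq_pbox p R, fun θ => toSet_eq_pbox p (R.shift p θ)⟩

/-- The middle part of a rectangle. -/
def middle (p : ℝ) (R : ParabolicRect n) : Set (SpaceTime n) :=
  pbox (fun i => R.corner i + R.side / 2) (R.side / 2) (R.bottom + R.timeLength p / 4)
    (R.timeLength p / 2)

lemma Valid.middle_subset {R : ParabolicRect n} (hR : R.Valid) : R.middle p ⊆ R.toSet p := by
  have h1 := hR.1
  have h2 := hR.timeLength_pos (p := p)
  rw [toSet_eq_pbox]
  exact pbox_subset (by simpa using by linarith) (by linarith) (by linarith)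

lemma Valid.volume_middle {R : ParabolicRect n} (hR : R.Valid) :
    volume (R.middle p) = ENNReal.ofReal (1 / 2 ^ (n + 1) * R.vol p) := by
  rw [middle, volume_pbox _ (by linarith [hR.1]), hR.vol_eq]
  congr 1
  rw [div_pow, pow_succ]
  field_simp

/-- The middle part is at distance side/4 from the spatial faces and a quarter of the temporal
length from the top and bottom. Since that temporal length is at least side^p / 2 and (1/8)^p ≤ 1/8,
radius side/8 still fits. -/
lemma Valid.le_parabolicInfDist_of_mem_middle (hp : 1 < p) (hE : E.Nonempty) {R : ParabolicRect n}
    (hR : R.Valid) (hd : Disjoint (R.toSet p) E) {z : SpaceTime n} (hz : z ∈ R.middle p) :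
    R.side / 8 ≤ parabolicInfDist p z E := by
  have h1 := hR.1
  have h2 := hR.le_timeLength (p := p)
  rw [toSet_eq_pbox] at hd
  rw [middle, mem_pbox] at hz
  have h3 : (R.side / 8) ^ p ≤ R.timeLength p / 4 := by
    have h4 : (1 / 8 : ℝ) ^ p ≤ 1 / 8 := by
      simpa using Real.rpow_le_rpow_of_exponent_ge (by norm_num : (0 : ℝ) < 1 / 8) (by norm_num) hp.le
    rw [show R.side / 8 = (1 / 8) * R.side by ring, Real.mul_rpow (by norm_num) h1.le]
    have := Real.rpow_pos_of_pos h1 p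
    nlinarith
  refine le_parabolicInfDist_of_disjoint hp hE (by positivity) hd (fun i => ?_) ?_ ?_
  · have := hz.1 i
    rw [abs_le]
    constructor <;> linarith [this.1, this.2]
  · linarith [hz.2.1]
  · linarith [hz.2.2]

lemma ne_zero_of_three_le (h3 : 3 ≤ (2 : ℝ) ^ (d * p)) : d ≠ 0 := by
  rintro rfl
  norm_num at h3

lemma exists_side_lt (hd : d ≠ 0) (s : ℝ) {ε : ℝ} (hε : 0 < ε) :
    ∃ m : ℕ, s / (2 ^ d) ^ m < ε := by
  have h1 : (1 : ℝ) < 2 ^ d := one_lt_pow₀ (by norm_num) hd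
  obtain ⟨m, hm⟩ := pow_unbounded_of_one_lt (s / ε) h1
  refine ⟨m, ?_⟩
  rw [div_lt_iff₀ hε] at hm
  rw [div_lt_iff₀ (by positivity)]
  linarith

/-- Stop at the first layer whose side is at most the distance of y to E: the rectangle of that
layer containing y cannot reach E, and its parent had side larger than the distance. -/
lemma exists_free_of_pos (hp : 1 < p) (h3 : 3 ≤ (2 : ℝ) ^ (d * p)) {R : ParabolicRect n}
    (hR : R.Valid) {y : SpaceTime n} (hy : y ∈ R.toSet p) (hu : 0 < parabolicInfDist p y E) :
    ∃ P ∈ R.freeDyadic p d E, min (parabolicInfDist p y E) R.side / 2 ^ d ≤ P.side := by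
  classical
  have hex : ∃ m : ℕ, R.side / (2 ^ d) ^ m ≤ parabolicInfDist p y E :=
    (exists_side_lt (ne_zero_of_three_le h3) _ hu).imp fun _ => le_of_lt
  set m := Nat.find hex with hm
  have hspec := Nat.find_spec hex
  rw [← hm] at hspec
  obtain ⟨P, hP, hyP⟩ := exists_mem_dyadicLayer h3 hR m hy
  have hPv := hR.of_mem_dyadicLayer h3 hP
  have hPs := side_of_mem_dyadicLayer hP
  have hd1 : (1 : ℝ) ≤ 2 ^ d := one_le_pow₀ (by norm_num)
  refine ⟨P, mem_freeDyadic_iff.2 ⟨m, hP, ?_⟩, ?_⟩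
  · rw [toSet_eq_pbox] at hyP ⊢
    exact disjoint_pbox_of_le hp hPv.1 hPv.timeLength_le hyP (by rw [hPs]; exact hspec)
  · rw [hPs]
    rcases Nat.eq_zero_or_pos m with h0 | h0
    · rw [h0, pow_zero, div_one]
      exact (div_le_self (le_min hu.le hR.1.le) hd1).trans (min_le_right _ _)
    · have hlt := Nat.find_min hex (show m - 1 < Nat.find hex by omega)
      obtain ⟨k, hk⟩ : ∃ k, m = k + 1 := ⟨m - 1, by omega⟩
      rw [hk] at hlt ⊢
      rw [pow_succ, ← div_div]
      gcongr
      exact (min_le_left _ _).trans (not_le.1 hlt).le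

/-- A point at positive distance from `E` forces a maximal hole of comparable size. -/
lemma exists_hole_of_pos (hp : 1 < p) (h3 : 3 ≤ (2 : ℝ) ^ (d * p)) {R : ParabolicRect n}
    (hR : R.Valid) {y : SpaceTime n} (hy : y ∈ R.toSet p) (hu : 0 < parabolicInfDist p y E) :
    ∃ M m, M ∈ R.dyadicLayer p d m ∧ Disjoint (M.toSet p) E ∧
      volume.real (R.maximalHole p d E) = M.vol p ∧
      min (parabolicInfDist p y E) R.side / 2 ^ d ≤ M.side := by
  obtain ⟨P, hP, hle⟩ := exists_free_of_pos hp h3 hR hy hu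
  obtain ⟨M, hM, hMe, hmax⟩ := exists_maximalHole_eq h3 hR hP
  obtain ⟨m, hm, hME⟩ := mem_freeDyadic_iff.1 hM
  exact ⟨M, m, hm, hME, by rw [hMe, vol], hle.trans (hmax P hP)⟩

lemma exists_hole_of_lt (hp : 1 < p) (h3 : 3 ≤ (2 : ℝ) ^ (d * p)) {R : ParabolicRect n}
    (hR : R.Valid) {y : SpaceTime n} (hy : y ∈ R.toSet p) (hu : 0 < parabolicInfDist p y E)
    {b : ℝ} (hb : 1 ≤ b) (hlt : parabolicInfDist p y E < b * R.side) :
    ∃ M m, M ∈ R.dyadicLayer p d m ∧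
      volume.real (R.maximalHole p d E) = M.vol p ∧
      parabolicInfDist p y E / (2 ^ d * b) ≤ M.side := by
  obtain ⟨M, m, hM, -, hMvol, hMs⟩ := exists_hole_of_pos hp h3 hR hy hu
  refine ⟨M, m, hM, hMvol, le_trans ?_ hMs⟩
  rw [div_mul_eq_div_div_swap]
  gcongr
  refine le_min (div_le_self hu.le hb) ?_
  rw [div_le_iff₀ (by positivity)]
  linarith

end ParabolicRect

/-- If y is far from E compared with the box, then z and y are within (θ+1) l ≤ u(y)/2 of each other
and the triangle inequality suffices. This disposes of the case in which the hole of the shifted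
rectangle is limited by the rectangle and not by u(y). -/
lemma half_le_of_mem_pbox (hp : 1 < p) (hE : E.Nonempty) {θ : ℝ} (hθ : 0 < θ) {x : Fin n → ℝ}
    {l t h : ℝ} (hl : 0 < l) (hh0 : 0 < h) (hh : h ≤ l ^ p) {y z : SpaceTime n}
    (hy : y ∈ pbox x l (t + θ * h) h) (hz : z ∈ pbox x l t h)
    (hu : 2 * (θ + 1) * l ≤ parabolicInfDist p y E) :
    1 / 2 * parabolicInfDist p y E ≤ parabolicInfDist p z E := by
  have hd : parabolicDist p y z ≤ (θ + 1) * l := by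
    refine parabolicDist_le (by linarith) (by positivity) ?_ ?_
    · exact (norm_sub_lt_of_mem hl hy.1 hz.1).le.trans (le_mul_of_one_le_left hl.le (by linarith))
    · rw [mem_pbox] at hy hz
      have h1 : θ + 1 ≤ (θ + 1) ^ p := by
        simpa using Real.rpow_le_rpow_of_exponent_le (by linarith : (1 : ℝ) ≤ θ + 1) hp.le
      have h2 : (θ + 1) * h ≤ ((θ + 1) * l) ^ p := by
        rw [Real.mul_rpow (by linarith) hl.le]
        gcongr
      have h4 : 0 < θ * h := by positivity
      rw [abs_le]
      constructor <;> nlinarith [hy.2.1, hy.2.2, hz.2.1, hz.2.2]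
  linarith [parabolicInfDist_le_add hp hE y z]

/-! ### Weak porosity to large values, and decay back to weak porosity. -/

lemma IsWeaklyPorous.mono {c c' δ δ' θ : ℝ} (hc : c' ≤ c) (hδ : δ' ≤ δ)
    (h : IsWeaklyPorous p d E c δ θ) : IsWeaklyPorous p d E c' δ' θ := by
  intro R hR
  obtain ⟨S, h1, h2, h3⟩ := h R hR
  refine ⟨S, fun P hP => ⟨(h1 P hP).1, (h1 P hP).2.1, le_trans ?_ (h1 P hP).2.2⟩, h2, le_trans ?_ h3⟩
  · gcongr
  · have := hR.vol_pos (p := p)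
    gcongr

/-- The decay and integral bounds say nothing at points y of E, so the possibility that E contains a
whole rectangle has to be excluded separately. -/
lemma IsWeaklyPorous.not_subset {c δ θ : ℝ} (hc : 0 < c) (h3 : 3 ≤ (2 : ℝ) ^ (d * p))
    (h : IsWeaklyPorous p d E c δ θ) {R : ParabolicRect n} (hR : R.Valid) : ¬ R.toSet p ⊆ E := by
  intro hsub
  obtain ⟨S, h1, -, h4⟩ := h R hR
  have hne : S.Nonempty := by
    rw [Finset.nonempty_iff_ne_empty]
    rintro rfl
    simp only [Finset.sum_empty] at h4
    have := mul_pos hc (hR.vol_pos (p := p))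
    linarith
  obtain ⟨P, hP⟩ := hne
  obtain ⟨m, hm, hPE⟩ := ParabolicRect.mem_freeDyadic_iff.1
    (show P ∈ R.freeDyadic p d E from ⟨(h1 P hP).1, (h1 P hP).2.1⟩)
  obtain ⟨z, hz⟩ := (hR.of_mem_dyadicLayer h3 hm).toSet_nonempty (p := p)
  exact Set.disjoint_left.1 hPE hz
    (hsub (ParabolicRect.toSet_subset_of_mem_dyadicLayer h3 hR hm hz))

lemma pow_mul_rpow_rpow_inv (hp : 0 < p) {a : ℝ} (ha : 0 < a) :
    (a ^ (1 / (n + p))) ^ n * (a ^ (1 / (n + p))) ^ p = a := by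
  rw [← Real.rpow_natCast, ← Real.rpow_add (by positivity), ← Real.rpow_mul ha.le,
    one_div_mul_cancel (by positivity), Real.rpow_one]

/-- An admissible free rectangle P has |P| ≥ δ|M|, hence side at least a fixed fraction of the side
of the hole M, hence at least a fixed fraction of u(y). The middle parts, a proportion 2^(-(n+1)) of
each P, are therefore good, which costs exactly this factor in c. -/
lemma IsWeaklyPorous.exists_hasLargeValues (hp : 1 < p) (h3 : 3 ≤ (2 : ℝ) ^ (d * p)) {c δ θ : ℝ}
    (hc : 0 < c) (hc1 : c < 1) (hδ : 0 < δ) (hθ : 1 < θ) :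
    ∃ κ > 0, ∃ c' > 0, c' ≤ 1 ∧ ∀ E : Set (SpaceTime n), E.Nonempty →
      IsWeaklyPorous p d E c δ θ →
        HasLargeValues p (fun z => parabolicInfDist p z E) θ κ c' := by
  have hp0 : 0 < p := by linarith
  -- The n+p-th root turns the volume ratio δ into a ratio of sides; the factor 2 absorbs that a
  -- temporal length lies only between side^p / 2 and side^p.
  set q := (δ / 2) ^ (1 / (n + p)) with hq
  have hq0 : 0 < q := by positivity
  have hqe : q ^ n * q ^ p = δ / 2 := pow_mul_rpow_rpow_inv hp0 (by positivity)
  have h2 : (1 : ℝ) ≤ 2 ^ (n + 1) := one_le_pow₀ (by norm_num)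
  have hc' : c / 2 ^ (n + 1) ≤ 1 := (div_le_self hc.le h2).trans hc1.le
  refine ⟨min (1 / 2) (q / (8 * (2 ^ d * (2 * (θ + 1))))), lt_min (by norm_num) (by positivity),
    c / 2 ^ (n + 1), by positivity, hc', fun E hE hwp x l t h hl hh1 hh2 y hy => ?_⟩
  set κ := min (1 / 2) (q / (8 * (2 ^ d * (2 * (θ + 1))))) with hκ
  have hlp := Real.rpow_pos_of_pos hl p
  have hh0 : 0 < h := by linarith
  have hall : (∀ z ∈ pbox x l t h, κ * parabolicInfDist p y E ≤ parabolicInfDist p z E) →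
      ENNReal.ofReal (c / 2 ^ (n + 1)) * volume (pbox x l t h) ≤
        volume {z ∈ pbox x l t h | κ * parabolicInfDist p y E ≤ parabolicInfDist p z E} := by
    intro hz
    rw [Set.sep_eq_self_iff_mem_true.2 hz]
    exact mul_le_of_le_one_left zero_le (ENNReal.ofReal_le_one.2 hc')
  rcases (parabolicInfDist_nonneg p y E).eq_or_lt with h0 | hpos
  · refine hall fun z _ => ?_
    rw [← h0, mul_zero]
    exact parabolicInfDist_nonneg _ _ _
  by_cases hfar : 2 * (θ + 1) * l ≤ parabolicInfDist p y E
  · refine hall fun z hz => le_trans ?_ (half_le_of_mem_pbox hp hE (by linarith) hl hh0 hh2 hy hz hfar)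
    gcongr
    exact min_le_left _ _
  push Not at hfar
  set R := ParabolicRect.ofBox p x l t h with hR
  have hRv : R.Valid := ParabolicRect.valid_ofBox x hl hh1 hh2
  have hRset : R.toSet p = pbox x l t h := ParabolicRect.toSet_ofBox x t h hl
  have hys : y ∈ (R.shift p θ).toSet p := by rwa [hR, ParabolicRect.toSet_shift_ofBox x t h θ hl]
  obtain ⟨M, m, hM, hMvol, hMu⟩ := ParabolicRect.exists_hole_of_lt hp h3 (hRv.shift p θ) hys hpos
    (by linarith : 1 ≤ 2 * (θ + 1)) hfar
  have hMv := (hRv.shift p θ).of_mem_dyadicLayer h3 hM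
  obtain ⟨S, hS1, hS2, hS3⟩ := hwp R hRv
  have hSv : ∀ P ∈ S, P.Valid ∧ P.toSet p ⊆ R.toSet p ∧ Disjoint (P.toSet p) E := by
    intro P hP
    obtain ⟨k, hk, hkE⟩ := ParabolicRect.mem_freeDyadic_iff.1
      (show P ∈ R.freeDyadic p d E from ⟨(hS1 P hP).1, (hS1 P hP).2.1⟩)
    exact ⟨hRv.of_mem_dyadicLayer h3 hk, ParabolicRect.toSet_subset_of_mem_dyadicLayer h3 hRv hk, hkE⟩
  have hSs : ∀ P ∈ S, κ * parabolicInfDist p y E ≤ P.side / 8 := by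
    intro P hP
    have hPv := (hSv P hP).1
    have hvol := (hS1 P hP).2.2
    rw [hMvol, hMv.vol_eq, hPv.vol_eq] at hvol
    have hPs : q * M.side ≤ P.side := by
      by_contra! hlt
      have e1 : P.side ^ n * P.timeLength p ≤ P.side ^ n * P.side ^ p := by
        have := hPv.1
        gcongr
        exact hPv.timeLength_le
      have e2 : P.side ^ n * P.side ^ p < (q * M.side) ^ n * (q * M.side) ^ p :=
        mul_lt_mul_of_le_of_lt_of_pos_of_nonneg (pow_le_pow_left₀ hPv.1.le hlt.le n)
          (Real.rpow_lt_rpow hPv.1.le hlt hp0) (pow_pos hPv.1 n)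
          (Real.rpow_nonneg (hPv.1.trans hlt).le _)
      have e3 : (q * M.side) ^ n * (q * M.side) ^ p = δ / 2 * (M.side ^ n * M.side ^ p) := by
        rw [mul_pow, Real.mul_rpow hq0.le hMv.1.le, ← hqe]; ring
      have e4 : M.side ^ n * (M.side ^ p / 2) ≤ M.side ^ n * M.timeLength p := by
        have := hMv.1
        gcongr
        exact hMv.le_timeLength
      have e5 := mul_le_mul_of_nonneg_left e4 hδ.le
      have e6 : δ * (M.side ^ n * (M.side ^ p / 2)) = δ / 2 * (M.side ^ n * M.side ^ p) := by ring
      linarith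
    calc κ * parabolicInfDist p y E
        ≤ q / (8 * (2 ^ d * (2 * (θ + 1)))) * parabolicInfDist p y E := by
          gcongr
          exact min_le_right _ _
      _ = q * (parabolicInfDist p y E / (2 ^ d * (2 * (θ + 1)))) / 8 := by field_simp
      _ ≤ q * M.side / 8 := by gcongr
      _ ≤ P.side / 8 := by gcongr
  have hsub : ⋃ P ∈ S, P.middle p ⊆
      {z ∈ pbox x l t h | κ * parabolicInfDist p y E ≤ parabolicInfDist p z E} := by
    refine iUnion₂_subset fun P hP z hz => ⟨?_, ?_⟩
    · rw [← hRset]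
      exact (hSv P hP).2.1 ((hSv P hP).1.middle_subset hz)
    · exact (hSs P hP).trans
        ((hSv P hP).1.le_parabolicInfDist_of_mem_middle hp hE (hSv P hP).2.2 hz)
  refine le_trans ?_ (measure_mono hsub)
  rw [measure_biUnion_finset (fun P hP Q hQ hPQ => (hS2 hP hQ hPQ).mono
      (hSv P hP).1.middle_subset (hSv Q hQ).1.middle_subset)
    (fun P _ => measurableSet_pbox _ _ _ _),
    Finset.sum_congr rfl (fun P hP => (hSv P hP).1.volume_middle),
    ← ENNReal.ofReal_sum_of_nonneg (fun P hP => mul_nonneg (by positivity) (hSv P hP).1.vol_pos.le),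
    ← Finset.mul_sum, ← hRset, hRv.volume_eq_ofReal_vol, ← ENNReal.ofReal_mul (by positivity)]
  apply ENNReal.ofReal_le_ofReal
  rw [div_eq_mul_one_div, mul_comm c, mul_assoc]
  gcongr

/-- All free rectangles of one layer are used, the last one of side at least q times that of the
hole M of R^θ. Every point of a remaining rectangle of that layer is closer to E than the side,
which is less than a constant times q u(y) for a point y in the middle of M. Decay bounds their
total proportion by a constant times q^s, and q^(n+p) = 2δ makes this a multiple of δ^α. -/
lemma HasDecay.exists_isWeaklyPorous (hp : 1 < p) (h3 : 3 ≤ (2 : ℝ) ^ (d * p)) {α A θ : ℝ}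
    (hA : 0 < A) :
    ∃ A' > 0, ∀ E : Set (SpaceTime n), E.Nonempty → IsClosed E →
      HasDecay p (fun z => parabolicInfDist p z E) θ (α * (n + p)) A →
      (∀ R : ParabolicRect n, R.Valid → ¬ R.toSet p ⊆ E) →
      ∀ δ : ℝ, 0 < δ → δ ≤ 1 / 2 → ∀ c : ℝ, 1 - c ≥ A' * δ ^ α → IsWeaklyPorous p d E c δ θ := by
  classical
  have hp0 : 0 < p := by linarith
  have hN : (0 : ℝ) < n + p := by positivity
  set s := α * (n + p) with hs
  refine ⟨A * ((8 * 2 ^ d) ^ s * 2 ^ α), by positivity,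
    fun E hE hEc hdec hnot δ hδ hδ1 c hc R hR => ?_⟩
  set q := (2 * δ) ^ (1 / (n + p)) with hq
  have hq0 : 0 < q := by positivity
  have hqe : q ^ n * q ^ p = 2 * δ := pow_mul_rpow_rpow_inv hp0 (by positivity)
  have hq1 : q ≤ 1 := Real.rpow_le_one (by positivity) (by linarith) (by positivity)
  have hqs : q ^ s = 2 ^ α * δ ^ α := by
    rw [hq, ← Real.rpow_mul (by positivity), hs, one_div, inv_mul_eq_div,
      mul_div_cancel_right₀ _ hN.ne', Real.mul_rpow (by norm_num) hδ.le]
  have hRs := hR.shift p θ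
  obtain ⟨y₀, hy₀, hy₀E⟩ := Set.not_subset.1 (hnot _ hRs)
  obtain ⟨M, m₀, hM, hME, hMvol, -⟩ :=
    ParabolicRect.exists_hole_of_pos (E := E) hp h3 hRs hy₀ (parabolicInfDist_pos hp hE hEc hy₀E)
  have hMv := hRs.of_mem_dyadicLayer h3 hM
  have hM0 := hMv.1
  have hMR : M.side ≤ R.side := by
    have h4 : R.shift p θ ∈ (R.shift p θ).dyadicLayer p d 0 := mem_singleton _
    have h5 := ParabolicRect.side_le_side hRs (Nat.zero_le m₀) h4 hM
    exact h5
  obtain ⟨y, hy⟩ : (M.middle p).Nonempty := by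
    refine ⟨(fun i => M.corner i + M.side / 2, M.bottom + M.timeLength p / 4),
      self_mem_halfOpenCube _ (by linarith), le_rfl, lt_add_of_pos_right _ ?_⟩
    have := hMv.timeLength_pos (p := p)
    positivity
  have hyu := hMv.le_parabolicInfDist_of_mem_middle hp hE hME hy
  have hyR := ParabolicRect.toSet_subset_of_mem_dyadicLayer h3 hRs hM (hMv.middle_subset hy)
  have hex : ∃ m : ℕ, R.side / (2 ^ d) ^ m < q * M.side :=
    ParabolicRect.exists_side_lt (ParabolicRect.ne_zero_of_three_le h3) _ (by positivity)
  -- Since δ ≤ 1/2 gives q ≤ 1, layer 0 is not yet below the threshold; k is the last layer that is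
  -- not.
  obtain ⟨k, hk⟩ : ∃ k, Nat.find hex = k + 1 := by
    refine Nat.exists_eq_succ_of_ne_zero fun h0 => ?_
    have h4 := Nat.find_spec hex
    rw [h0, pow_zero, div_one] at h4
    have : q * M.side ≤ M.side := mul_le_of_le_one_left hM0.le hq1
    linarith
  have hlow : q * M.side ≤ R.side / (2 ^ d) ^ k := not_lt.1 (Nat.find_min hex (by omega))
  have hup : R.side / (2 ^ d) ^ k < 8 * 2 ^ d * q * parabolicInfDist p y E := by
    have h4 := Nat.find_spec hex
    rw [hk, pow_succ, ← div_div, div_lt_iff₀ (by positivity)] at h4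
    calc R.side / (2 ^ d) ^ k < q * M.side * 2 ^ d := h4
      _ = 8 * 2 ^ d * q * (M.side / 8) := by ring
      _ ≤ _ := by gcongr
  set S := (ParabolicRect.finite_dyadicLayer p d R k).toFinset.filter
    (fun P => Disjoint (P.toSet p) E) with hS
  have hSmem : ∀ P, P ∈ S ↔ P ∈ R.dyadicLayer p d k ∧ Disjoint (P.toSet p) E := by
    intro P; simp [hS]
  have hSd : (S : Set (ParabolicRect n)).PairwiseDisjoint (fun P => P.toSet p) :=
    (ParabolicRect.pairwiseDisjoint_dyadicLayer h3 hR k).subset fun P hP =>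
      ((hSmem P).1 hP).1
  refine ⟨S, fun P hP => ?_, hSd, ?_⟩
  · obtain ⟨hPk, hPE⟩ := (hSmem P).1 hP
    have hPv := hR.of_mem_dyadicLayer h3 hPk
    refine ⟨mem_iUnion.2 ⟨k, hPk⟩, hPE, ?_⟩
    rw [hMvol, hPv.vol_eq, hMv.vol_eq]
    rw [← ParabolicRect.side_of_mem_dyadicLayer hPk] at hlow
    have hP0 := hPv.1
    have e1 : P.side ^ n * (P.side ^ p / 2) ≤ P.side ^ n * P.timeLength p := by
      gcongr
      exact hPv.le_timeLength
    have e2 : (q * M.side) ^ n * (q * M.side) ^ p ≤ P.side ^ n * P.side ^ p := by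
      gcongr
    have e3 : (q * M.side) ^ n * (q * M.side) ^ p = 2 * δ * (M.side ^ n * M.side ^ p) := by
      rw [mul_pow, Real.mul_rpow hq0.le hMv.1.le, ← hqe]; ring
    have e4 : M.side ^ n * M.timeLength p ≤ M.side ^ n * M.side ^ p := by
      gcongr
      exact hMv.timeLength_le
    have e5 := mul_le_mul_of_nonneg_left e4 hδ.le
    linarith
  · obtain ⟨x, hx, hxs⟩ := ParabolicRect.toSet_eq_pbox_of_valid (R := R) p
    rw [hxs] at hyR
    have hbad := hdec x R.side R.bottom (R.timeLength p) hR.1 hR.le_timeLength hR.timeLength_le y hyR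
      (8 * 2 ^ d * q) (by positivity)
    rw [← hx] at hbad
    have hcover : R.toSet p ⊆ (⋃ P ∈ S, P.toSet p) ∪ {z ∈ R.toSet p |
        parabolicInfDist p z E < 8 * 2 ^ d * q * parabolicInfDist p y E} := by
      intro z hz
      obtain ⟨P, hP, hzP⟩ := ParabolicRect.exists_mem_dyadicLayer h3 hR k hz
      have hPv := hR.of_mem_dyadicLayer h3 hP
      by_cases hPS : P ∈ S
      · exact Or.inl (mem_iUnion₂.2 ⟨P, hPS, hzP⟩)
      · refine Or.inr ⟨hz, lt_of_not_ge fun hge => hPS ((hSmem P).2 ⟨hP, ?_⟩)⟩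
        rw [ParabolicRect.toSet_eq_pbox] at hzP ⊢
        refine disjoint_pbox_of_le hp hPv.1 hPv.timeLength_le hzP ?_
        rw [ParabolicRect.side_of_mem_dyadicLayer hP]
        exact hup.le.trans hge
    have hmeas := (measure_mono hcover).trans ((measure_union_le _ _).trans (add_le_add_right hbad _))
    have hRvol := hR.vol_pos (p := p)
    have hsum : 0 ≤ ∑ P ∈ S, P.vol p := Finset.sum_nonneg fun P hP =>
      (hR.of_mem_dyadicLayer h3 ((hSmem P).1 hP).1).vol_pos.le
    rw [ParabolicRect.volume_biUnion_finset
      (fun P hP => hR.of_mem_dyadicLayer h3 ((hSmem P).1 hP).1) hSd, hR.volume_eq_ofReal_vol,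
      ← ENNReal.ofReal_mul (by positivity), ← ENNReal.ofReal_add hsum (by positivity),
      ENNReal.ofReal_le_ofReal_iff (by positivity), Real.mul_rpow (by positivity) hq0.le, hqs] at hmeas
    have e1 : A * ((8 * 2 ^ d) ^ s * (2 ^ α * δ ^ α)) = A * ((8 * 2 ^ d) ^ s * 2 ^ α) * δ ^ α := by
      ring
    rw [e1] at hmeas
    nlinarith [mul_le_mul_of_nonneg_right hc hRvol.le]

end Porosity

/-! ### Self-improvement of weak porosity -/

section SelfImprovement

variable {n : ℕ} {p θ κ c : ℝ}

/-- Enlarge the target box slightly so that its cube also contains the displaced one. The good set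
fills a proportion c of the enlarged box, while the added rim has proportion below c for small ε; so
the good set meets the original box. -/
lemma HasLargeValues.exists_hasBackwardStep (hp : 1 < p) (hc : 0 < c) :
    ∃ ε > 0, ∀ u : SpaceTime n → ℝ, HasLargeValues p u θ κ c → HasBackwardStep p u θ 1 ε κ := by
  have hp0 : 0 < p := by linarith
  have hlim1 : Filter.Tendsto (fun ε : ℝ => (1 + 2 * ε) ^ p) (nhdsWithin 0 (Ioi 0)) (nhds 1) := by
    have : ContinuousAt (fun ε : ℝ => (1 + 2 * ε) ^ p) 0 :=
      ContinuousAt.rpow_const (by fun_prop) (Or.inr hp0.le)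
    simpa using this.tendsto.mono_left nhdsWithin_le_nhds
  have hlim2 : Filter.Tendsto (fun ε : ℝ => (1 - c) * (1 + 2 * ε) ^ n) (nhdsWithin 0 (Ioi 0))
      (nhds (1 - c)) := by
    have : ContinuousAt (fun ε : ℝ => (1 - c) * (1 + 2 * ε) ^ n) 0 := by fun_prop
    simpa using this.tendsto.mono_left nhdsWithin_le_nhds
  -- The first condition keeps the height ρ^p at least half of l^p, so that the enlarged box is
  -- admissible; the second makes the rim smaller than the good set.
  obtain ⟨ε, h1, h2, hε⟩ := ((hlim1.eventually_lt_const (by norm_num : (1 : ℝ) < 2)).and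
    ((hlim2.eventually_lt_const (by linarith : 1 - c < 1)).and self_mem_nhdsWithin)).exists
  refine ⟨ε, hε, fun u hu x x' t ρ hρ hxx y hy => ?_⟩
  have hρp := Real.rpow_pos_of_pos hρ p
  rw [one_mul] at hy ⊢
  set l := (1 + 2 * ε) * ρ with hl
  have hl0 : 0 < l := by positivity
  have hlp : l ^ p = (1 + 2 * ε) ^ p * ρ ^ p := Real.mul_rpow (by positivity) hρ.le
  have hρl : ρ ≤ l := le_mul_of_one_le_left hρ.le (by linarith)
  have hval := hu x' l t (ρ ^ p) hl0 (by rw [hlp]; nlinarith)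
    (Real.rpow_le_rpow hρ.le hρl hp0.le) y
    (pbox_subset (by rw [hl]; linarith) le_rfl le_rfl hy)
  by_contra! hcon
  have hsub : {z ∈ pbox x' l t (ρ ^ p) | κ * u y ≤ u z} ⊆
      pbox x' l t (ρ ^ p) \ pbox x' ρ t (ρ ^ p) := fun z hz =>
    ⟨hz.1, fun hz' => absurd hz.2 (not_le.2 (hcon z hz'))⟩
  have hle := hval.trans (measure_mono hsub)
  rw [measure_sdiff (pbox_subset (by simpa using by linarith) le_rfl le_rfl)
    (measurableSet_pbox _ _ _ _).nullMeasurableSet (by rw [volume_pbox _ hρ.le]; simp),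
    volume_pbox _ hl0.le, volume_pbox _ hρ.le, ← ENNReal.ofReal_mul hc.le,
    ← ENNReal.ofReal_sub _ (by positivity), ENNReal.ofReal_le_ofReal_iff', hl, mul_pow] at hle
  have hρn : 0 < ρ ^ n * ρ ^ p := by positivity
  rcases hle with hle | hle
  · nlinarith
  · have : 0 < c * ((1 + 2 * ε) ^ n * ρ ^ n * ρ ^ p) := by positivity
    linarith

/-- A box of scale `r` in the future of `z`. -/
def forwardBox (p θ : ℝ) (z : SpaceTime n) (r : ℝ) : Set (SpaceTime n) :=
  pbox z.1 r (z.2 + (θ + 2) * r ^ p) (r ^ p)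

/-- A value found in the forward box of scale 2r is carried back by the chain to the θ-shift of the
forward box of scale r, where the large-value property applies. -/
lemma exists_forwardBox_bound (hp : 1 < p) (hθ : 1 < θ) (hκ : 0 < κ) (hc : 0 < c) :
    ∃ κ' > 0, κ' < 1 ∧ ∀ u : SpaceTime n → ℝ, HasLargeValues p u θ κ c →
      ∀ (z : SpaceTime n) (r : ℝ), 0 < r → ∀ v, 0 ≤ v → (∃ y ∈ forwardBox p θ z (2 * r), v ≤ u y) →
        ENNReal.ofReal c * volume (forwardBox p θ z r) ≤
          volume {w ∈ forwardBox p θ z r | κ' * v ≤ u w} := by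
  obtain ⟨ε, hε, hstep⟩ := HasLargeValues.exists_hasBackwardStep (n := n) (θ := θ) (κ := κ) hp hc
  -- The offset θ+2 of a forward box leaves this gap: (θ+2)(2r)^p - (2θ+2) r^p ≥ 2 r^p, because 2^p
  -- ≥ 2.
  obtain ⟨κ₁, hκ₁, hhar⟩ := exists_backwardHarnack (n := n) (a := θ) (b := 1) (τ := 2)
    (τ' := (θ + 3) * 2 ^ p) (D := 1) (η := 1) hp (by linarith) hε hκ one_pos two_pos zero_le_one
    one_pos
  refine ⟨min (κ * κ₁) (1 / 2), lt_min (by positivity) (by norm_num),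
    (min_le_right _ _).trans_lt (by norm_num), fun u hu z r hr v hv ⟨y, hy, hvy⟩ => ?_⟩
  have hrp := Real.rpow_pos_of_pos hr p
  have h2p : (2 : ℝ) ≤ 2 ^ p := by
    simpa using Real.rpow_le_rpow_of_exponent_le (by norm_num : (1 : ℝ) ≤ 2) hp.le
  have e : (2 * r) ^ p = 2 ^ p * r ^ p := Real.mul_rpow (by norm_num) hr.le
  have hy1 := norm_sub_center_le (by positivity) hy.1
  have hy2 := (mem_pbox.1 hy).2
  rw [e] at hy2
  have h2r : 2 * r ^ p ≤ 2 ^ p * r ^ p := by gcongr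
  have hθr := mul_le_mul_of_nonneg_left h2r (by linarith : 0 ≤ θ + 2)
  have hθr' : 0 < θ * r ^ p := by positivity
  obtain ⟨z', hz', hzu⟩ := hhar u (hstep u hu) z.1 (z.2 + (θ + 2) * r ^ p + θ * r ^ p) r y hr
    (by nlinarith) (by nlinarith) (by linarith)
  rw [one_mul, one_mul] at hz'
  refine (hu z.1 r _ (r ^ p) hr (by linarith) le_rfl z' hz').trans (measure_mono fun w hw =>
    ⟨hw.1, le_trans ?_ hw.2⟩)
  calc min (κ * κ₁) (1 / 2) * v ≤ κ * κ₁ * v := by gcongr; exact min_le_left _ _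
    _ = κ * (κ₁ * v) := by ring
    _ ≤ κ * u z' := by
      gcongr
      exact (mul_le_mul_of_nonneg_left hvy hκ₁.le).trans hzu

lemma volume_forwardBox (z : SpaceTime n) {r : ℝ} (hr : 0 ≤ r) :
    volume (forwardBox p θ z r) = ENNReal.ofReal (r ^ n * r ^ p) := volume_pbox _ hr _ _

/-- Forward boxes of shrinking scale converge to their base point, where u < v by assumption. This
makes the stopping time in the covering argument finite. -/
lemma exists_forwardBox_subset (hp : 0 < p) (hθ : 0 < θ) {u : SpaceTime n → ℝ} (hu : Continuous u)
    {z : SpaceTime n} {v : ℝ} (hz : u z < v) (ρ : ℝ) (hρ : 0 < ρ) :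
    ∃ i : ℕ, forwardBox p θ z (ρ / 2 ^ i) ⊆ {w | u w < v} := by
  obtain ⟨ε, hε, hball⟩ := Metric.isOpen_iff.1 (isOpen_lt hu continuous_const) z hz
  have h0 : Filter.Tendsto (fun i : ℕ => ρ / 2 ^ i) Filter.atTop (nhds 0) := by
    have := (tendsto_pow_atTop_nhds_zero_of_lt_one (by norm_num : (0 : ℝ) ≤ 1 / 2)
      (by norm_num)).const_mul ρ
    simpa [div_eq_mul_inv] using this
  have h1 : Filter.Tendsto (fun i : ℕ => (θ + 3) * (ρ / 2 ^ i) ^ p) Filter.atTop (nhds 0) := by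
    have := (h0.rpow_const (p := p) (Or.inr hp.le)).const_mul (θ + 3)
    simpa [Real.zero_rpow hp.ne'] using this
  obtain ⟨i, hi1, hi2⟩ := ((h0.eventually_lt_const hε).and (h1.eventually_lt_const hε)).exists
  refine ⟨i, fun w hw => hball ?_⟩
  have hr : 0 < ρ / 2 ^ i := by positivity
  have hrp := Real.rpow_pos_of_pos hr p
  have hθr : 0 < θ * (ρ / 2 ^ i) ^ p := by positivity
  have hw1 := norm_sub_center_le hr.le hw.1
  have hw2 := (mem_pbox.1 hw).2
  rw [Metric.mem_ball, Prod.dist_eq, max_lt_iff, dist_eq_norm, Real.dist_eq, abs_lt]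
  refine ⟨by linarith, ?_, ?_⟩ <;> linarith

/-- The covering step of the self-improvement. -/
lemma volume_le_of_forwardBox {κ' : ℝ} (hp : 1 < p) (hθ : 1 < θ) (hc : 0 < c)
    {u : SpaceTime n → ℝ} (hu : Continuous u)
    (hkey : ∀ (z : SpaceTime n) (r : ℝ), 0 < r → ∀ v, 0 ≤ v →
      (∃ y ∈ forwardBox p θ z (2 * r), v ≤ u y) →
        ENNReal.ofReal c * volume (forwardBox p θ z r) ≤
          volume {w ∈ forwardBox p θ z r | κ' * v ≤ u w})
    {Z B : Set (SpaceTime n)} {v ρ : ℝ} (hv : 0 ≤ v) (hρ : 0 < ρ)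
    (hZB : ∀ z ∈ Z, ∀ r, 0 < r → r ≤ ρ → forwardBox p θ z r ⊆ B)
    (hZ : ∀ z ∈ Z, u z < v) (hZρ : ∀ z ∈ Z, ∃ y ∈ forwardBox p θ z ρ, v ≤ u y) :
    volume Z ≤ ENNReal.ofReal (4 ^ n * (2 * (θ + 3) * 2 ^ p) / c) *
      volume {w ∈ B | κ' * v ≤ u w ∧ u w < v} := by
  classical
  have hp0 : 0 < p := by linarith
  have hsel : ∀ z ∈ Z, ∃ r, 0 < r ∧ r ≤ ρ ∧ forwardBox p θ z r ⊆ {w | u w < v} ∧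
      ∃ y ∈ forwardBox p θ z (2 * r), v ≤ u y := by
    intro z hz
    -- Stopping time: halve the scale until the forward box lies in {u < v}. It is not reached at
    -- scale ρ, and the last box before it still contains a value at least v, which is what the
    -- proportion estimate needs.
    have hex := exists_forwardBox_subset hp0 (by linarith : 0 < θ) hu (hZ z hz) ρ hρ
    have hspec := Nat.find_spec hex
    obtain ⟨k, hk⟩ : ∃ k, Nat.find hex = k + 1 := by
      refine Nat.exists_eq_succ_of_ne_zero fun h0 => ?_
      rw [h0, pow_zero, div_one] at hspec
      obtain ⟨y, hy, hvy⟩ := hZρ z hz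
      exact absurd (hspec hy) (not_lt.2 hvy)
    have hmin := Nat.find_min hex (show k < Nat.find hex by omega)
    rw [hk] at hspec
    obtain ⟨y, hy, hvy⟩ := Set.not_subset.1 hmin
    refine ⟨ρ / 2 ^ (k + 1), by positivity, div_le_self hρ.le (one_le_pow₀ (by norm_num)), hspec,
      y, ?_, not_lt.1 hvy⟩
    rwa [show 2 * (ρ / 2 ^ (k + 1)) = ρ / 2 ^ k by rw [pow_succ]; field_simp]
  choose! r hr0 hrρ hrsub hry using hsel
  obtain ⟨V, hVZ, hVd, hVcov⟩ := Vitali.exists_disjoint_subfamily_covering_enlargement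
    (fun z => forwardBox p θ z (r z)) Z r 2 (by norm_num) (fun z hz => (hr0 z hz).le) ρ hrρ
    (fun z hz => by
      refine ⟨(z.1, z.2 + (θ + 2) * r z ^ p), self_mem_halfOpenCube _ (hr0 z hz), le_rfl, ?_⟩
      exact lt_add_of_pos_right _ (Real.rpow_pos_of_pos (hr0 z hz) p))
  have hmeas : ∀ z, MeasurableSet (forwardBox p θ z (r z)) := fun z => measurableSet_pbox _ _ _ _
  have hVc : V.Countable := by
    have h1 := Measure.countable_meas_pos_of_disjoint_iUnion (μ := (volume : Measure (SpaceTime n)))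
      (As := fun z : V => forwardBox p θ z.1 (r z.1)) (fun z => hmeas z.1)
      (fun a b hab => hVd a.2 b.2 (fun h => hab (Subtype.ext h)))
    have h2 : {z : V | 0 < volume (forwardBox p θ z.1 (r z.1))} = univ := by
      refine eq_univ_of_forall fun z => ?_
      have hz := hr0 z.1 (hVZ z.2)
      rw [mem_ofPred_eq, volume_forwardBox _ hz.le, ENNReal.ofReal_pos]
      positivity
    rw [h2] at h1
    exact Set.countable_coe_iff.1 (Set.countable_univ_iff.1 h1)
  set C₀ : ℝ := 4 ^ n * (2 * (θ + 3) * 2 ^ p) with hC₀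
  have hC₀0 : 0 < C₀ := by positivity
  -- The enlargement is centered at the base point b, since it must cover the base points a whose
  -- forward boxes meet that of b with r a ≤ 2 r b. Its measure is C₀ times that of the forward box.
  set enl : SpaceTime n → Set (SpaceTime n) := fun b =>
    pbox b.1 (4 * r b) (b.2 - (θ + 3) * 2 ^ p * r b ^ p) (2 * ((θ + 3) * 2 ^ p * r b ^ p)) with henl
  have hcov : Z ⊆ ⋃ b ∈ V, enl b := by
    intro a ha
    obtain ⟨b, hb, ⟨w, hwa, hwb⟩, hab⟩ := hVcov a ha
    have ha0 := hr0 a ha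
    have hb0 := hr0 b (hVZ hb)
    refine mem_iUnion₂.2 ⟨b, hb, mem_pbox.2 ⟨fun i => ?_, ?_⟩⟩
    · have h1 := hwa.1 i
      have h2 := hwb.1 i
      constructor <;> linarith [h1.1, h1.2, h2.1, h2.2]
    · have h1 := (mem_pbox.1 hwa).2
      have h2 := (mem_pbox.1 hwb).2
      have hrap := Real.rpow_pos_of_pos ha0 p
      have hrbp := Real.rpow_pos_of_pos hb0 p
      have hab' : r a ^ p ≤ 2 ^ p * r b ^ p := by
        rw [← Real.mul_rpow (by norm_num) hb0.le]
        exact Real.rpow_le_rpow ha0.le hab hp0.le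
      have h2p : (1 : ℝ) ≤ 2 ^ p := Real.one_le_rpow (by norm_num) hp0.le
      have h3 : (θ + 3) * r a ^ p ≤ (θ + 3) * (2 ^ p * r b ^ p) := by gcongr
      have h4 : (θ + 3) * r b ^ p ≤ (θ + 3) * (2 ^ p * r b ^ p) := by
        gcongr
        exact le_mul_of_one_le_left hrbp.le h2p
      have h5 : 0 < θ * r a ^ p := by positivity
      have h6 : 0 < θ * r b ^ p := by positivity
      constructor <;> nlinarith
  have hFc : ∀ b ∈ V, volume (enl b) ≤ ENNReal.ofReal (C₀ / c) *
      volume {w ∈ forwardBox p θ b (r b) | κ' * v ≤ u w} := by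
    intro b hb
    have hb0 := hr0 b (hVZ hb)
    have h1 := hkey b (r b) hb0 v hv (hry b (hVZ hb))
    calc volume (enl b) = ENNReal.ofReal (C₀ / c) *
          (ENNReal.ofReal c * volume (forwardBox p θ b (r b))) := by
          rw [henl, volume_pbox _ (by positivity), volume_forwardBox _ hb0.le,
            ← ENNReal.ofReal_mul hc.le, ← ENNReal.ofReal_mul (by positivity), hC₀, mul_pow]
          congr 1
          field_simp
      _ ≤ _ := by gcongr
  have hGm : MeasurableSet {w | κ' * v ≤ u w} := measurableSet_le measurable_const hu.measurable
  calc volume Z ≤ volume (⋃ b ∈ V, enl b) := measure_mono hcov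
    _ ≤ ∑' b : V, volume (enl b) := measure_biUnion_le _ hVc _
    _ ≤ ∑' b : V, ENNReal.ofReal (C₀ / c) *
          volume {w ∈ forwardBox p θ b.1 (r b.1) | κ' * v ≤ u w} :=
        ENNReal.tsum_le_tsum fun b => hFc b.1 b.2
    _ = ENNReal.ofReal (C₀ / c) *
          volume (⋃ b ∈ V, {w ∈ forwardBox p θ b (r b) | κ' * v ≤ u w}) := by
        rw [ENNReal.tsum_mul_left]
        congr 1
        exact (measure_biUnion hVc
          (fun a ha b hb hab => (hVd ha hb hab).mono (sep_subset _ _) (sep_subset _ _))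
          (fun b _ => (hmeas b).inter hGm)).symm
    _ ≤ _ := by
        gcongr
        refine iUnion₂_subset fun b hb w hw => ⟨?_, hw.2, hrsub b (hVZ hb) hw.1⟩
        exact hZB b (hVZ hb) (r b) (hr0 b (hVZ hb)) (hrρ b (hVZ hb)) hw.1

/-- Hole filling: add C a to both sides of a ≤ C X. No subtraction occurs, so infinite values are
allowed. -/
lemma le_mul_of_le_mul_of_add_le {a X b : ℝ≥0∞} {C : ℝ} (hC : 0 < C)
    (h1 : a ≤ ENNReal.ofReal C * X) (h2 : a + X ≤ b) : a ≤ ENNReal.ofReal (C / (C + 1)) * b := by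
  have h3 : ENNReal.ofReal (C + 1) * a ≤ ENNReal.ofReal C * b := by
    calc ENNReal.ofReal (C + 1) * a = ENNReal.ofReal C * a + a := by
          rw [ENNReal.ofReal_add hC.le zero_le_one, add_mul, ENNReal.ofReal_one, one_mul]
      _ ≤ ENNReal.ofReal C * a + ENNReal.ofReal C * X := by gcongr
      _ = ENNReal.ofReal C * (a + X) := by rw [mul_add]
      _ ≤ _ := by gcongr
  calc a = ENNReal.ofReal (1 / (C + 1)) * (ENNReal.ofReal (C + 1) * a) := by
        rw [← mul_assoc, ← ENNReal.ofReal_mul (by positivity), one_div_mul_cancel (by positivity),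
          ENNReal.ofReal_one, one_mul]
    _ ≤ ENNReal.ofReal (1 / (C + 1)) * (ENNReal.ofReal C * b) := by gcongr
    _ = _ := by
        rw [← mul_assoc, ← ENNReal.ofReal_mul (by positivity)]
        congr 2
        ring

/-- Geometric decay of the set of small values, a one-sided John–Nirenberg inequality. -/
lemma HasLargeValues.exists_geometric_decay (hp : 1 < p) (hθ : 1 < θ) (hκ : 0 < κ) (hc : 0 < c) :
    ∃ κ₀ > 0, ∃ κ' > 0, κ' < 1 ∧ ∃ q > 0, q < 1 ∧ ∃ C ≥ 1, ∀ u : SpaceTime n → ℝ, Continuous u →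
      (∀ z, 0 ≤ u z) → HasLargeValues p u θ κ c →
      ∀ (x : Fin n → ℝ) (l t h : ℝ), 0 < l → l ^ p / 2 ≤ h → h ≤ l ^ p →
        ∀ y ∈ pbox x l (t + θ * h) h, ∀ j : ℕ,
          volume {z ∈ pbox x l t h | u z < κ' ^ j * (κ₀ * u y)} ≤
            ENNReal.ofReal (C * q ^ j) * volume (pbox x l t h) := by
  have hp0 : 0 < p := by linarith
  obtain ⟨κ', hκ', hκ'1, hkey⟩ := exists_forwardBox_bound (n := n) hp hθ hκ hc
  obtain ⟨ε, hε, hstep⟩ := HasLargeValues.exists_hasBackwardStep (n := n) (θ := θ) (κ := κ) hp hc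
  -- After enlarging the box and moving forward by its own forward boxes, at most (3θ+8) σ l^p of
  -- time is used. This choice spends (θ-1)/4 · l^p of the gap (θ-1) h ≥ (θ-1)/2 · l^p before y; the
  -- other quarter remains for the chain.
  set σ := (θ - 1) / (4 * (3 * θ + 8)) with hσ
  have hσ0 : 0 < σ := div_pos (by linarith) (by linarith)
  have hσ1 : σ ≤ 1 := by rw [hσ, div_le_one (by linarith)]; linarith
  have hσe : (3 * θ + 8) * σ = (θ - 1) / 4 := by rw [hσ]; field_simp
  have hpow : ∀ e : ℝ, 0 < e → e ≤ 1 → e ^ p ≤ e := fun e h0 h1 => by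
    simpa using Real.rpow_le_rpow_of_exponent_ge h0 h1 hp.le
  obtain ⟨κ₀, hκ₀, hhar⟩ := exists_backwardHarnack (n := n) (a := θ) (b := 1) (τ := (θ - 1) / 4)
    (τ' := θ + 1) (D := 2) (η := σ ^ p) hp (by linarith) hε hκ one_pos (by linarith)
    (by norm_num) (by positivity)
  set C₁ := 4 ^ n * (2 * (θ + 3) * 2 ^ p) / c with hC₁
  have hC₁0 : 0 < C₁ := by positivity
  refine ⟨κ₀, hκ₀, κ', hκ', hκ'1, C₁ / (C₁ + 1), by positivity, by rw [div_lt_one] <;> linarith,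
    3 ^ n * (1 + 4 * (θ + 3)),
    one_le_mul_of_one_le_of_one_le (one_le_pow₀ (by norm_num)) (by linarith),
    fun u hu hu0 hlv x l t h hl hh1 hh2 y hy j => ?_⟩
  have hlp := Real.rpow_pos_of_pos hl p
  have hh0 : 0 < h := by linarith
  -- The boxes grow in space and forward in time only, as forward boxes never look back. Passing
  -- from e/2 to e leaves room for forward boxes of scale at most e l, so the iteration shrinks B by
  -- halving e.
  set B : ℝ → Set (SpaceTime n) := fun e =>
    pbox x (l + 2 * e * l) t (h + 2 * (θ + 3) * e * l ^ p) with hB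
  have hBmono : ∀ e e', 0 ≤ e → e ≤ e' → B e ⊆ B e' := fun e e' h0 hee => by
    refine pbox_subset ?_ le_rfl ?_
    · rw [sub_self, norm_zero]
      have := mul_le_mul_of_nonneg_right hee hl.le
      linarith
    · have : 2 * (θ + 3) * e * l ^ p ≤ 2 * (θ + 3) * e' * l ^ p := by gcongr
      linarith
  have hFB : ∀ e, 0 < e → e ≤ 1 → ∀ z ∈ B (e / 2), ∀ r, 0 < r → r ≤ e * l →
      forwardBox p θ z r ⊆ B e := by
    intro e he0 he1 z hz r hr hre
    have hrp := Real.rpow_pos_of_pos hr p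
    have hrp' : r ^ p ≤ e * l ^ p :=
      (Real.rpow_le_rpow hr.le hre hp0.le).trans (by
        rw [Real.mul_rpow he0.le hl.le]
        gcongr
        exact hpow e he0 he1)
    have hz1 := norm_sub_center_le (by positivity) hz.1
    have hz2 := (mem_pbox.1 hz).2
    have hθr : (θ + 3) * r ^ p ≤ (θ + 3) * (e * l ^ p) := by gcongr
    have hθr' : 0 < θ * r ^ p := by positivity
    refine pbox_subset ?_ ?_ ?_ <;> nlinarith
  have hbase : ∀ z ∈ B σ, ∃ y' ∈ forwardBox p θ z (σ * l), κ₀ * u y ≤ u y' := by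
    intro z hz
    have hz1 := norm_sub_center_le (by positivity) hz.1
    have hz2 := (mem_pbox.1 hz).2
    have hy1 := norm_sub_center_le hl.le hy.1
    have hy2 := (mem_pbox.1 hy).2
    have e1 : (σ * l) ^ p = σ ^ p * l ^ p := Real.mul_rpow hσ0.le hl.le
    have e2 : σ ^ p ≤ σ := hpow σ hσ0 hσ1
    have e3 : σ ^ p * l ^ p ≤ σ * l ^ p := by gcongr
    have e4 : (3 * θ + 8) * σ * l ^ p = (θ - 1) / 4 * l ^ p := by rw [hσe]
    have e5 : (θ + 2) * (σ ^ p * l ^ p) ≤ (θ + 2) * (σ * l ^ p) := by gcongr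
    have e6 : (θ - 1) * (l ^ p / 2) ≤ (θ - 1) * h := mul_le_mul_of_nonneg_left hh1 (by linarith)
    have e7 : 0 < (θ + 2) * (σ ^ p * l ^ p) := by positivity
    have e8 : (θ + 1) * h ≤ (θ + 1) * l ^ p := by gcongr
    obtain ⟨w, hw, hwu⟩ := hhar u (hstep u hlv) z.1 (z.2 + (θ + 2) * (σ * l) ^ p) l y hl
      (by rw [e1]; nlinarith) (by rw [e1]; nlinarith)
      (by
        have h5 : ‖y.1 - z.1‖ ≤ ‖y.1 - x‖ + ‖z.1 - x‖ := by
          rw [norm_sub_rev z.1]; exact norm_sub_le_norm_sub_add_norm_sub _ _ _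
        have h6 : σ * l ≤ l := mul_le_of_le_one_left hl.le hσ1
        linarith)
    refine ⟨w, pbox_subset ?_ le_rfl (by rw [e1]) hw, hwu⟩
    have : σ ^ p * l ≤ σ * l := by gcongr
    rw [sub_self, norm_zero]
    linarith
  -- The smaller scale at step j must still see the level v = κ'^j κ₀ u(y). Each halving of the
  -- scale costs one factor κ', matching the decrease of the level.
  have hall : ∀ j : ℕ, ∀ z ∈ B σ, ∃ y' ∈ forwardBox p θ z (σ * l / 2 ^ j),
      κ' ^ j * (κ₀ * u y) ≤ u y' := by
    intro j
    induction j with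
    | zero => simpa using hbase
    | succ j ih =>
      intro z hz
      have hr : 0 < σ * l / 2 ^ (j + 1) := by positivity
      have hvn : 0 ≤ κ' ^ j * (κ₀ * u y) := by have := hu0 y; positivity
      have h5 := hkey u hlv z _ hr _ hvn (by
        rw [show 2 * (σ * l / 2 ^ (j + 1)) = σ * l / 2 ^ j by rw [pow_succ]; field_simp]
        exact ih z hz)
      have h6 : 0 < volume {w ∈ forwardBox p θ z (σ * l / 2 ^ (j + 1)) |
          κ' * (κ' ^ j * (κ₀ * u y)) ≤ u w} := by
        refine lt_of_lt_of_le ?_ h5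
        rw [volume_forwardBox _ hr.le, ← ENNReal.ofReal_mul hc.le, ENNReal.ofReal_pos]
        positivity
      obtain ⟨w, hw⟩ := nonempty_of_measure_ne_zero h6.ne'
      exact ⟨w, hw.1, by rw [pow_succ', mul_assoc]; exact hw.2⟩
  set b : ℕ → ℝ≥0∞ := fun j => volume {z ∈ B (σ / 2 ^ j) | u z < κ' ^ j * (κ₀ * u y)} with hb
  have hbstep : ∀ j, b (j + 1) ≤ ENNReal.ofReal (C₁ / (C₁ + 1)) * b j := by
    intro j
    have hvn : 0 ≤ κ' ^ j * (κ₀ * u y) := by have := hu0 y; positivity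
    have hj1 : σ / 2 ^ j ≤ σ := div_le_self hσ0.le (one_le_pow₀ (by norm_num))
    have hj0 : 0 < σ / 2 ^ j := by positivity
    have hj2 : σ / 2 ^ (j + 1) = σ / 2 ^ j / 2 := by rw [pow_succ, ← div_div]
    have hlev : κ' ^ (j + 1) * (κ₀ * u y) = κ' * (κ' ^ j * (κ₀ * u y)) := by ring
    have hlev' : κ' * (κ' ^ j * (κ₀ * u y)) ≤ κ' ^ j * (κ₀ * u y) :=
      mul_le_of_le_one_left hvn hκ'1.le
    have hvit := volume_le_of_forwardBox hp hθ hc hu (hkey u hlv)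
      (Z := {z ∈ B (σ / 2 ^ (j + 1)) | u z < κ' ^ j * (κ₀ * u y)}) (B := B (σ / 2 ^ j))
      (ρ := σ * l / 2 ^ j) hvn (by positivity)
      (fun z hz r hr hrρ => hFB _ hj0 (hj1.trans hσ1) z (by rw [← hj2]; exact hz.1) r hr
        (by rwa [div_mul_eq_mul_div]))
      (fun z hz => hz.2)
      (fun z hz => hall j z (hBmono _ _ (by positivity)
        (by rw [hj2]; linarith) hz.1))
    -- The covering bound controls the new sublevel set by the shell between the two levels; both
    -- are disjoint subsets of the old one, so hole filling gives the factor C₁/(C₁+1) < 1.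
    refine le_mul_of_le_mul_of_add_le hC₁0 ((measure_mono ?_).trans hvit) ?_
    · intro z hz
      refine ⟨hz.1, hz.2.trans_le ?_⟩
      rw [hlev]; exact hlev'
    · rw [← measure_union₀]
      · refine measure_mono ?_
        rintro z (hz | hz)
        · refine ⟨hBmono _ _ (by positivity) (by rw [hj2]; linarith) hz.1, hz.2.trans_le ?_⟩
          rw [hlev]; exact hlev'
        · exact ⟨hz.1, hz.2.2⟩
      · refine MeasurableSet.nullMeasurableSet ?_
        exact (measurableSet_pbox _ _ _ _).inter
          ((measurableSet_le measurable_const hu.measurable).inter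
            (measurableSet_lt hu.measurable measurable_const))
      · refine Disjoint.aedisjoint (Set.disjoint_left.2 fun z hz hz' => ?_)
        have h5 := hz.2
        rw [hlev] at h5
        exact absurd hz'.2.1 (not_le.2 h5)
  have hb0 : b 0 ≤ ENNReal.ofReal (3 ^ n * (1 + 4 * (θ + 3))) * volume (pbox x l t h) := by
    refine (measure_mono (sep_subset _ _)).trans ?_
    rw [pow_zero, div_one, hB, volume_pbox _ (by positivity), volume_pbox _ hl.le,
      ← ENNReal.ofReal_mul (by positivity)]
    apply ENNReal.ofReal_le_ofReal
    have h5 : σ * l ≤ l := mul_le_of_le_one_left hl.le hσ1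
    have h6 : σ * l ^ p ≤ 2 * h := (mul_le_of_le_one_left hlp.le hσ1).trans (by linarith)
    calc (l + 2 * σ * l) ^ n * (h + 2 * (θ + 3) * σ * l ^ p)
        ≤ (3 * l) ^ n * (h + 2 * (θ + 3) * (2 * h)) := by
          gcongr ?_ ^ n * ?_
          · linarith
          · have : (θ + 3) * (σ * l ^ p) ≤ (θ + 3) * (2 * h) := by gcongr
            nlinarith
      _ = _ := by rw [mul_pow]; ring
  have hbj : b j ≤ ENNReal.ofReal (3 ^ n * (1 + 4 * (θ + 3)) * (C₁ / (C₁ + 1)) ^ j) *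
      volume (pbox x l t h) := by
    induction j with
    | zero => simpa using hb0
    | succ j ih =>
      refine (hbstep j).trans ((mul_le_mul_right ih _).trans_eq ?_)
      rw [← mul_assoc, ← ENNReal.ofReal_mul (by positivity)]
      congr 2
      ring
  have hRB : pbox x l t h ⊆ B (σ / 2 ^ j) := by
    refine pbox_subset ?_ le_rfl ?_
    · rw [sub_self, norm_zero]
      have : 0 ≤ σ / 2 ^ j * l := by positivity
      linarith
    · have : 0 ≤ 2 * (θ + 3) * (σ / 2 ^ j) * l ^ p := by positivity
      linarith
  exact (measure_mono fun z (hz : z ∈ pbox x l t h ∧ _) =>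
    (⟨hRB hz.1, hz.2⟩ : z ∈ B (σ / 2 ^ j) ∧ _)).trans hbj

/-- Geometric decay at the levels κ'^j is power decay: s is defined by κ'^s = q, and σ/κ₀ is placed
between consecutive powers of κ'. For σ ≥ κ₀ the bound is trivial. -/
lemma HasLargeValues.exists_hasDecay (hp : 1 < p) (hθ : 1 < θ) (hκ : 0 < κ) (hc : 0 < c) :
    ∃ s > 0, ∃ A > 0, ∀ u : SpaceTime n → ℝ, Continuous u → (∀ z, 0 ≤ u z) →
      HasLargeValues p u θ κ c → HasDecay p u θ s A := by
  obtain ⟨κ₀, hκ₀, κ', hκ', hκ'1, q, hq, hq1, C, hC, hgeo⟩ :=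
    HasLargeValues.exists_geometric_decay (n := n) hp hθ hκ hc
  set s := Real.logb κ' q with hs
  have hs0 : 0 < s := Real.logb_pos_of_base_lt_one hκ' hκ'1 hq hq1
  have hsq : κ' ^ s = q := Real.rpow_logb hκ' hκ'1.ne hq
  refine ⟨s, hs0, C / q * κ₀ ^ (-s), by positivity,
    fun u hu hu0 hlv x l t h hl hh1 hh2 y hy σ hσ => ?_⟩
  have hpos : 0 < κ₀ ^ (-s) := by positivity
  have hresc : κ₀ ^ (-s) * σ ^ s = (σ / κ₀) ^ s := by
    rw [Real.div_rpow hσ.le hκ₀.le, Real.rpow_neg hκ₀.le]; ring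
  have hCq : 1 ≤ C / q := by rw [one_le_div hq]; linarith
  by_cases hbig : κ₀ ≤ σ
  · refine (measure_mono (sep_subset _ _)).trans ?_
    refine le_mul_of_one_le_left zero_le (ENNReal.one_le_ofReal.2 ?_)
    rw [mul_assoc, hresc]
    exact one_le_mul_of_one_le_of_one_le hCq
      (Real.one_le_rpow ((one_le_div hκ₀).2 hbig) hs0.le)
  · push Not at hbig
    obtain ⟨j, hj1, hj2⟩ := exists_nat_pow_near_of_lt_one (x := σ / κ₀) (y := κ') (by positivity)
      ((div_le_one hκ₀).2 hbig.le) hκ' hκ'1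
    have hsub : {z ∈ pbox x l t h | u z < σ * u y} ⊆
        {z ∈ pbox x l t h | u z < κ' ^ j * (κ₀ * u y)} := fun z hz => by
      refine ⟨hz.1, hz.2.trans_le ?_⟩
      rw [div_le_iff₀ hκ₀] at hj2
      rw [← mul_assoc]
      exact mul_le_mul_of_nonneg_right hj2 (hu0 y)
    refine (measure_mono hsub).trans ((hgeo u hu hu0 hlv x l t h hl hh1 hh2 y hy j).trans ?_)
    have h5 : q ^ (j + 1) ≤ (σ / κ₀) ^ s := by
      calc q ^ (j + 1) = (κ' ^ (j + 1)) ^ s := by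
            rw [← hsq, ← Real.rpow_natCast, ← Real.rpow_natCast, ← Real.rpow_mul hκ'.le,
              ← Real.rpow_mul hκ'.le, mul_comm]
        _ ≤ _ := Real.rpow_le_rpow (by positivity) hj1.le hs0.le
    have h6 : C * q ^ j ≤ C / q * κ₀ ^ (-s) * σ ^ s := by
      calc C * q ^ j = C / q * q ^ (j + 1) := by rw [pow_succ]; field_simp
        _ ≤ C / q * (σ / κ₀) ^ s := by gcongr
        _ = _ := by rw [mul_assoc, hresc]
    exact mul_le_mul_left (ENNReal.ofReal_le_ofReal h6) _

end SelfImprovement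

/-! ### Integrals of negative powers of the distance -/

section Integral

variable {n : ℕ} {p : ℝ} {d : ℕ} {E : Set (SpaceTime n)}

/-- On the shell where u is about r/2^k the integrand is about r^(-s) 2^(sk) and the measure is at
most C 2^(-k)|X|; the series has ratio 2^(s-1) < 1. -/
lemma exists_lintegral_le_of_sublevel {s C : ℝ} (hs : 0 < s) (hs1 : s < 1) (hC : 0 < C) :
    ∃ A > 0, ∀ (u : SpaceTime n → ℝ) (X : Set (SpaceTime n)) (r : ℝ), Measurable u →
      MeasurableSet X → 0 < r → (∀ z ∈ X, 0 < u z) →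
      (∀ k : ℕ, volume {z ∈ X | u z ≤ r / 2 ^ k} ≤ ENNReal.ofReal (C / 2 ^ k) * volume X) →
      ∫⁻ z in X, ENNReal.ofReal (u z) ^ (-s) ≤ ENNReal.ofReal (A * r ^ (-s)) * volume X := by
  set ϱ : ℝ := 2 ^ s / 2 with hϱ
  have hϱ0 : 0 < ϱ := by positivity
  have hϱ1 : ϱ < 1 := by
    rw [hϱ, div_lt_one two_pos]
    simpa using Real.rpow_lt_rpow_of_exponent_lt (by norm_num : (1 : ℝ) < 2) hs1
  refine ⟨1 + 2 ^ s * C * (1 - ϱ)⁻¹, ?_, fun u X r hu hX hr hpos hvol => ?_⟩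
  · have : 0 < (1 - ϱ)⁻¹ := inv_pos.2 (by linarith)
    positivity
  set S : ℕ → Set (SpaceTime n) := fun k => {z ∈ X | r / 2 ^ (k + 1) ≤ u z ∧ u z ≤ r / 2 ^ k} with hS
  have hSm : ∀ k, MeasurableSet (S k) := fun k =>
    hX.inter ((measurableSet_le measurable_const hu).inter (measurableSet_le hu measurable_const))
  have hcov : X ⊆ {z ∈ X | r ≤ u z} ∪ ⋃ k, S k := by
    intro z hz
    rcases le_or_gt r (u z) with h | h
    · exact Or.inl ⟨hz, h⟩
    · obtain ⟨k, hk1, hk2⟩ := exists_nat_pow_near_of_lt_one (x := u z / r) (y := (1 / 2 : ℝ))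
        (div_pos (hpos z hz) hr) ((div_le_one hr).2 h.le) (by norm_num) (by norm_num)
      refine Or.inr (mem_iUnion.2 ⟨k, hz, ?_, ?_⟩)
      · rw [lt_div_iff₀ hr, one_div, inv_pow] at hk1
        rw [div_eq_inv_mul]
        exact hk1.le
      · rw [div_le_iff₀ hr, one_div, inv_pow] at hk2
        rwa [div_eq_inv_mul]
  have hbound : ∀ (T : Set (SpaceTime n)) (v : ℝ), MeasurableSet T → 0 < v → (∀ z ∈ T, v ≤ u z) →
      ∫⁻ z in T, ENNReal.ofReal (u z) ^ (-s) ≤ ENNReal.ofReal (v ^ (-s)) * volume T := by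
    intro T v hT hv hle
    rw [← setLIntegral_const, ← ENNReal.ofReal_rpow_of_pos hv]
    exact setLIntegral_mono' hT fun z hz =>
      rpow_neg_le_rpow_neg hs.le (ENNReal.ofReal_le_ofReal (hle z hz))
  have hterm : ∀ k, ∫⁻ z in S k, ENNReal.ofReal (u z) ^ (-s) ≤
      ENNReal.ofReal (2 ^ s * C * r ^ (-s)) * volume X * ENNReal.ofReal ϱ ^ k := by
    intro k
    have hrk : (r / 2 ^ (k + 1)) ^ (-s) = r ^ (-s) * (2 ^ s * (2 ^ s) ^ k) := by
      rw [Real.div_rpow hr.le (by positivity), Real.rpow_neg (by positivity : (0 : ℝ) ≤ 2 ^ (k + 1)),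
        div_inv_eq_mul, ← Real.rpow_natCast, ← Real.rpow_mul (by norm_num), mul_comm _ s,
        Real.rpow_mul (by norm_num), Real.rpow_natCast, pow_succ']
    calc ∫⁻ z in S k, ENNReal.ofReal (u z) ^ (-s)
        ≤ ENNReal.ofReal ((r / 2 ^ (k + 1)) ^ (-s)) * volume (S k) :=
          hbound _ _ (hSm k) (by positivity) fun z hz => hz.2.1
      _ ≤ ENNReal.ofReal ((r / 2 ^ (k + 1)) ^ (-s)) * (ENNReal.ofReal (C / 2 ^ k) * volume X) := by
          gcongr
          exact (measure_mono (by rintro z ⟨h1, h2⟩; exact ⟨h1, h2.2⟩)).trans (hvol k)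
      _ = _ := by
          rw [← ENNReal.ofReal_pow hϱ0.le, mul_right_comm, ← ENNReal.ofReal_mul (by positivity),
            ← mul_assoc, ← ENNReal.ofReal_mul (by positivity), hrk, hϱ, div_pow]
          congr 2
          ring
  calc ∫⁻ z in X, ENNReal.ofReal (u z) ^ (-s)
      ≤ ∫⁻ z in {z ∈ X | r ≤ u z} ∪ ⋃ k, S k, ENNReal.ofReal (u z) ^ (-s) := lintegral_mono_set hcov
    _ ≤ (∫⁻ z in {z ∈ X | r ≤ u z}, ENNReal.ofReal (u z) ^ (-s)) +
          ∫⁻ z in ⋃ k, S k, ENNReal.ofReal (u z) ^ (-s) := lintegral_union_le _ _ _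
    _ ≤ ENNReal.ofReal (r ^ (-s)) * volume X +
          ∑' k, ENNReal.ofReal (2 ^ s * C * r ^ (-s)) * volume X * ENNReal.ofReal ϱ ^ k := by
        refine add_le_add ?_ ((lintegral_iUnion_le _ _).trans (ENNReal.tsum_le_tsum hterm))
        refine (hbound _ r (hX.inter (measurableSet_le measurable_const hu)) hr
          fun z hz => hz.2).trans ?_
        gcongr
        exact sep_subset _ _
    _ = _ := by
        rw [ENNReal.tsum_mul_left, ENNReal.tsum_geometric, ← ENNReal.ofReal_one,
          ← ENNReal.ofReal_sub _ hϱ0.le, ← ENNReal.ofReal_inv_of_pos (by linarith), mul_right_comm,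
          ← add_mul, ← ENNReal.ofReal_mul (by positivity), ← ENNReal.ofReal_add (by positivity)]
        · congr 2
          ring
        · have : 0 < (1 - ϱ)⁻¹ := inv_pos.2 (by linarith)
          positivity

namespace ParabolicRect

/-- Points this close to E lie in a collar along the boundary of the free rectangle. The spatial
faces contribute 2nε by Bernoulli's inequality; top and bottom contribute 4ε, since (ε·side)^p ≤
ε·side^p and side^p is at most twice the temporal length. -/
lemma Valid.volume_sublevel_le (hp : 1 < p) (hE : E.Nonempty) {R : ParabolicRect n}
    (hR : R.Valid) (hd : Disjoint (R.toSet p) E) {ε : ℝ} (hε : 0 < ε) :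
    volume {z ∈ R.toSet p | parabolicInfDist p z E < ε * R.side} ≤
      ENNReal.ofReal ((2 * n + 4) * ε) * volume (R.toSet p) := by
  have hs := hR.1
  have hT0 := hR.timeLength_pos (p := p)
  rcases le_or_gt ε (1 / 4) with h4 | h4
  swap
  · refine (measure_mono (sep_subset _ _)).trans (le_mul_of_one_le_left zero_le ?_)
    rw [ENNReal.one_le_ofReal]
    have : 0 ≤ 2 * n * ε := by positivity
    linarith
  set T := R.timeLength p with hT
  set x : Fin n → ℝ := fun i => R.corner i + R.side / 2 with hx
  have hεp : (ε * R.side) ^ p ≤ 2 * ε * T := by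
    rw [Real.mul_rpow hε.le hs.le]
    have h1 : ε ^ p ≤ ε := by
      simpa using Real.rpow_le_rpow_of_exponent_ge hε (by linarith) hp.le
    have h2 := hR.le_timeLength (p := p)
    have h5 := Real.rpow_pos_of_pos hs p
    calc ε ^ p * R.side ^ p ≤ ε * (2 * T) := by gcongr; linarith
      _ = _ := by ring
  have hεp0 : 0 < (ε * R.side) ^ p := by positivity
  set I := pbox x ((1 - 2 * ε) * R.side) (R.bottom + (ε * R.side) ^ p)
    (T - 2 * (ε * R.side) ^ p) with hI
  have hsub : {z ∈ R.toSet p | parabolicInfDist p z E < ε * R.side} ⊆ R.toSet p \ I := by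
    refine fun z hz => ⟨hz.1, fun hzI => absurd hz.2 (not_lt.2 ?_)⟩
    rw [toSet_eq_pbox] at hd
    rw [hI, mem_pbox] at hzI
    refine le_parabolicInfDist_of_disjoint hp hE (by positivity) hd (fun i => ?_) ?_ ?_
    · have := hzI.1 i
      simp only [hx] at this
      rw [abs_le]
      constructor <;> linarith [this.1, this.2]
    · linarith [hzI.2.1]
    · linarith [hzI.2.2]
  have hIR : I ⊆ R.toSet p := by
    rw [toSet_eq_pbox]
    refine pbox_subset ?_ (by linarith) (by linarith)
    rw [sub_self, norm_zero]
    have := mul_pos hε hs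
    linarith
  refine (measure_mono hsub).trans ?_
  have hIvol : volume I = ENNReal.ofReal (((1 - 2 * ε) * R.side) ^ n * (T - 2 * (ε * R.side) ^ p)) :=
    volume_pbox _ (mul_nonneg (by linarith) hs.le) _ _
  have hI0 : 0 ≤ ((1 - 2 * ε) * R.side) ^ n * (T - 2 * (ε * R.side) ^ p) := by
    refine mul_nonneg (pow_nonneg (mul_nonneg (by linarith) hs.le) _) ?_
    have : ε * T ≤ 1 / 4 * T := by gcongr
    linarith
  rw [measure_sdiff hIR (measurableSet_pbox _ _ _ _).nullMeasurableSet (by rw [hIvol]; simp), hIvol,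
    hR.volume_toSet, ← ENNReal.ofReal_sub _ hI0, ← ENNReal.ofReal_mul (by positivity)]
  apply ENNReal.ofReal_le_ofReal
  have hbern : 1 - 2 * ε * n ≤ (1 - 2 * ε) ^ n := by
    have := one_add_mul_le_pow (show (-2 : ℝ) ≤ -(2 * ε) by linarith) n
    rw [← sub_eq_add_neg] at this
    linarith
  have h6 : (1 - (2 * n + 4) * ε) * T ≤ (1 - 2 * ε) ^ n * (T - 2 * (ε * R.side) ^ p) := by
    have h7 : (1 - 4 * ε) * T ≤ T - 2 * (ε * R.side) ^ p := by linarith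
    have h8 : 0 ≤ (1 - 2 * ε) ^ n := pow_nonneg (by linarith) _
    have h9 : (1 - 2 * ε * n) * (1 - 4 * ε) ≤ (1 - 2 * ε) ^ n * (1 - 4 * ε) := by
      gcongr
      linarith
    have h10 : 0 ≤ 2 * ε * n * (4 * ε) := by positivity
    calc (1 - (2 * n + 4) * ε) * T ≤ ((1 - 2 * ε) ^ n * (1 - 4 * ε)) * T := by
          gcongr
          linarith
      _ = (1 - 2 * ε) ^ n * ((1 - 4 * ε) * T) := by ring
      _ ≤ _ := by gcongr
  have h11 := mul_le_mul_of_nonneg_left h6 (pow_nonneg hs.le n)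
  rw [mul_pow]
  linarith

/-- The collar estimate is linear in ε, so every exponent s < 1 is integrable. This is the source of
the condition β(n+p) < 1. -/
lemma exists_lintegral_free_le (n : ℕ) (hp : 1 < p) {s : ℝ} (hs : 0 < s) (hs1 : s < 1) :
    ∃ A > 0, ∀ E : Set (SpaceTime n), E.Nonempty → IsClosed E → ∀ R : ParabolicRect n, R.Valid →
      Disjoint (R.toSet p) E →
      ∫⁻ z in R.toSet p, ENNReal.ofReal (parabolicInfDist p z E) ^ (-s) ≤
        ENNReal.ofReal (A * R.side ^ (-s)) * volume (R.toSet p) := by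
  obtain ⟨A, hA, h⟩ := exists_lintegral_le_of_sublevel (n := n) hs hs1
    (C := (2 * n + 4) * 2) (by positivity)
  refine ⟨A, hA, fun E hE hc R hR hd => ?_⟩
  refine h _ _ _ (continuous_parabolicInfDist hp hE).measurable (measurableSet_toSet p R) hR.1
    (fun z hz => parabolicInfDist_pos hp hE hc (Set.disjoint_left.1 hd hz)) fun k => ?_
  have h1 := hR.volume_sublevel_le hp hE hd (ε := 2 / 2 ^ k) (by positivity)
  have hsub : {z ∈ R.toSet p | parabolicInfDist p z E ≤ R.side / 2 ^ k} ⊆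
      {z ∈ R.toSet p | parabolicInfDist p z E < 2 / 2 ^ k * R.side} := by
    rintro z ⟨hz, hle⟩
    refine ⟨hz, hle.trans_lt ?_⟩
    have h2 : 0 < R.side / 2 ^ k := div_pos hR.1 (by positivity)
    have h3 : 2 / 2 ^ k * R.side = 2 * (R.side / 2 ^ k) := by ring
    linarith
  refine (measure_mono hsub).trans (h1.trans_eq ?_)
  congr 2
  ring

/-- The union of the dyadic rectangles of level `m` that meet `E`. -/
def nonfree (p : ℝ) (d : ℕ) (E : Set (SpaceTime n)) (R : ParabolicRect n) (m : ℕ) :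
    Set (SpaceTime n) :=
  ⋃ P ∈ {P ∈ R.dyadicLayer p d m | ¬ Disjoint (P.toSet p) E}, P.toSet p

/-- Measures within one layer differ by at most a factor 2 in the temporal length, while one more
layer divides side^p by at least 3; hence measure determines which of two rectangles is in the finer
layer. -/
lemma vol_lt_vol (hp : 1 < p) (h3 : 3 ≤ (2 : ℝ) ^ (d * p)) {R : ParabolicRect n} (hR : R.Valid)
    {m k : ℕ} (hmk : m < k) {P Q : ParabolicRect n} (hQ : Q ∈ R.dyadicLayer p d m)
    (hP : P ∈ R.dyadicLayer p d k) : P.vol p < Q.vol p := by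
  have hPv := hR.of_mem_dyadicLayer h3 hP
  have hQv := hR.of_mem_dyadicLayer h3 hQ
  have hD : ((2 : ℝ) ^ d) ^ p = 2 ^ (d * p) := by
    rw [← Real.rpow_natCast, ← Real.rpow_mul (by norm_num)]
  have hd1 : (1 : ℝ) ≤ 2 ^ d := one_le_pow₀ (by norm_num)
  have hside : P.side ≤ Q.side / 2 ^ d := by
    rw [side_of_mem_dyadicLayer hP, side_of_mem_dyadicLayer hQ, div_div, ← pow_succ]
    have := hR.1
    gcongr
    · omega
  have hside' : P.side ≤ Q.side := hside.trans (div_le_self hQv.1.le hd1)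
  have hQp := Real.rpow_pos_of_pos hQv.1 p
  have h1 : P.timeLength p < Q.timeLength p := by
    calc P.timeLength p ≤ P.side ^ p := hPv.timeLength_le
      _ ≤ (Q.side / 2 ^ d) ^ p := Real.rpow_le_rpow hPv.1.le hside (by linarith)
      _ = Q.side ^ p / 2 ^ (d * p) := by rw [Real.div_rpow hQv.1.le (by positivity), hD]
      _ ≤ Q.side ^ p / 3 := by gcongr
      _ < Q.side ^ p / 2 := by linarith
      _ ≤ _ := hQv.le_timeLength
  rw [hPv.vol_eq, hQv.vol_eq]
  exact mul_lt_mul_of_le_of_lt_of_pos_of_nonneg (pow_le_pow_left₀ hPv.1.le hside' n) h1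
    (pow_pos hPv.1 n) hQv.timeLength_pos.le

lemma nonfree_subset (h3 : 3 ≤ (2 : ℝ) ^ (d * p)) {R : ParabolicRect n} (hR : R.Valid) (m : ℕ) :
    R.nonfree p d E m ⊆ R.toSet p :=
  iUnion₂_subset fun _ hP => toSet_subset_of_mem_dyadicLayer h3 hR hP.1

lemma inter_subset_nonfree (h3 : 3 ≤ (2 : ℝ) ^ (d * p)) {R : ParabolicRect n} (hR : R.Valid)
    (m : ℕ) : R.toSet p ∩ E ⊆ R.nonfree p d E m := by
  rintro z ⟨hz, hzE⟩
  obtain ⟨P, hP, hzP⟩ := exists_mem_dyadicLayer h3 hR m hz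
  exact mem_iUnion₂.2 ⟨P, ⟨hP, Set.not_disjoint_iff.2 ⟨z, hzP, hzE⟩⟩, hzP⟩

/-- Rectangles with |P| ≥ δ|hole| ≥ |Q| cannot lie in a layer finer than that of Q. Being free and
of a coarser or equal layer, they avoid every rectangle of layer m that meets E, so the latter fit
in the complement. -/
lemma volume_nonfree_le (hp : 1 < p) (h3 : 3 ≤ (2 : ℝ) ^ (d * p)) {c δ θ : ℝ}
    (hwp : IsWeaklyPorous p d E c δ θ) {R : ParabolicRect n} (hR : R.Valid) {m : ℕ}
    {Q : ParabolicRect n} (hQ : Q ∈ R.dyadicLayer p d m)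
    (hδ : Q.vol p ≤ δ * volume.real ((R.shift p θ).maximalHole p d E)) :
    volume (R.nonfree p d E m) ≤ ENNReal.ofReal (1 - c) * volume (R.toSet p) := by
  obtain ⟨S, hS1, hS2, hS3⟩ := hwp R hR
  have hSv : ∀ P ∈ S, ∃ k ≤ m, P ∈ R.dyadicLayer p d k := by
    intro P hP
    obtain ⟨k, hk⟩ := mem_iUnion.1 (hS1 P hP).1
    refine ⟨k, not_lt.1 fun hmk => ?_, hk⟩
    have := vol_lt_vol hp h3 hR hmk hQ hk
    linarith [(hS1 P hP).2.2]
  have hvalid : ∀ P ∈ S, P.Valid := fun P hP =>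
    let ⟨_, _, hk⟩ := hSv P hP
    hR.of_mem_dyadicLayer h3 hk
  have hdisj : Disjoint (R.nonfree p d E m) (⋃ P ∈ S, P.toSet p) := by
    rw [Set.disjoint_left]
    intro z hz hz'
    obtain ⟨Q', hQ', hzQ⟩ := mem_iUnion₂.1 hz
    obtain ⟨P, hP, hzP⟩ := mem_iUnion₂.1 hz'
    obtain ⟨k, hkm, hk⟩ := hSv P hP
    exact hQ'.2 ((hS1 P hP).2.1.mono_left (subset_of_mem_of_mem h3 hR hkm hk hQ'.1 hzP hzQ))
  have hSR : ⋃ P ∈ S, P.toSet p ⊆ R.toSet p := iUnion₂_subset fun P hP =>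
    let ⟨_, _, hk⟩ := hSv P hP
    toSet_subset_of_mem_dyadicLayer h3 hR hk
  have hSm : MeasurableSet (⋃ P ∈ S, P.toSet p) :=
    S.measurableSet_biUnion fun P _ => measurableSet_toSet p P
  have hRvol := hR.vol_pos (p := p)
  have hsum0 : 0 ≤ ∑ P ∈ S, P.vol p := Finset.sum_nonneg fun P hP => (hvalid P hP).vol_pos.le
  calc volume (R.nonfree p d E m) ≤ volume (R.toSet p \ ⋃ P ∈ S, P.toSet p) :=
        measure_mono fun z hz => ⟨nonfree_subset h3 hR m hz, Set.disjoint_left.1 hdisj hz⟩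
    _ = ENNReal.ofReal (R.vol p - ∑ P ∈ S, P.vol p) := by
        rw [measure_sdiff hSR hSm.nullMeasurableSet
          (by rw [volume_biUnion_finset hvalid hS2]; simp), volume_biUnion_finset hvalid hS2,
          hR.volume_eq_ofReal_vol, ← ENNReal.ofReal_sub _ hsum0]
    _ ≤ ENNReal.ofReal ((1 - c) * R.vol p) := ENNReal.ofReal_le_ofReal (by linarith)
    _ = _ := by rw [hR.volume_eq_ofReal_vol, ENNReal.ofReal_mul' hRvol.le]

lemma nonempty_dyadicLayer (h3 : 3 ≤ (2 : ℝ) ^ (d * p)) {R : ParabolicRect n} (hR : R.Valid)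
    (m : ℕ) : (R.dyadicLayer p d m).Nonempty := by
  obtain ⟨z, hz⟩ := hR.toSet_nonempty (p := p)
  obtain ⟨P, hP, -⟩ := exists_mem_dyadicLayer h3 hR m hz
  exact ⟨P, hP⟩

/-- For an improving set the measure of the dyadic rectangles meeting `E` decays geometrically once
their size is below that of the maximal hole of the shifted rectangle. -/
lemma volume_nonfree_le_geometric (hp : 1 < p) (h3 : 3 ≤ (2 : ℝ) ^ (d * p)) {c₀ δ₀ α K θ : ℝ}
    (hδ₀ : 0 < δ₀) (hα : 0 < α)
    (himp : IsImprovingWith p d E θ c₀ δ₀ α K) {R : ParabolicRect n} (hR : R.Valid)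
    {M : ParabolicRect n} {m₀ : ℕ} (hM : M ∈ (R.shift p θ).dyadicLayer p d m₀)
    (hMvol : volume.real ((R.shift p θ).maximalHole p d E) = M.vol p) (i : ℕ) :
    volume (R.nonfree p d E (m₀ + i)) ≤
      ENNReal.ofReal (max K (δ₀ ^ (-α)) * 2 ^ α * (((2 : ℝ) ^ d) ^ (-(α * (n + p)))) ^ i) *
        volume (R.toSet p) := by
  have hp0 : 0 < p := by linarith
  obtain ⟨Q, hQ⟩ := nonempty_dyadicLayer (p := p) (d := d) h3 hR (m₀ + i)
  have hQv := hR.of_mem_dyadicLayer h3 hQ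
  have hMv := (hR.shift p θ).of_mem_dyadicLayer h3 hM
  have hQ0 := hQv.vol_pos (p := p)
  have hM0 := hMv.vol_pos (p := p)
  set D : ℝ := 2 ^ d with hD
  have hD0 : 0 < D := by positivity
  set K' := max K (δ₀ ^ (-α)) with hK'
  have hK'0 : 0 < K' := lt_max_of_lt_right (by positivity)
  -- The porosity parameter at which admissible rectangles have at least the measure of a rectangle
  -- of layer m₀ + i.
  set δ := Q.vol p / M.vol p with hδ
  have hδ0 : 0 < δ := div_pos hQ0 hM0
  have hside : Q.side = M.side / D ^ i := by
    rw [side_of_mem_dyadicLayer hQ, side_of_mem_dyadicLayer hM, pow_add, ← div_div]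
    rfl
  have hδle : δ ≤ 2 * ((D ^ i) ^ (-(n + p))) := by
    rw [hδ, div_le_iff₀ hM0, hQv.vol_eq, hMv.vol_eq]
    have hMs := hMv.1
    have e1 : Q.side ^ n * Q.timeLength p ≤ (M.side / D ^ i) ^ n * (M.side / D ^ i) ^ p := by
      rw [← hside]
      have := hQv.1
      gcongr
      exact hQv.timeLength_le
    have e2 : (M.side / D ^ i) ^ n * (M.side / D ^ i) ^ p =
        (D ^ i) ^ (-(n + p)) * (M.side ^ n * M.side ^ p) := by
      rw [div_pow, Real.div_rpow hMs.le (by positivity), Real.rpow_neg (by positivity),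
        Real.rpow_add (by positivity), Real.rpow_natCast]
      field_simp
    have e3 : M.side ^ n * (M.side ^ p / 2) ≤ M.side ^ n * M.timeLength p := by
      gcongr
      exact hMv.le_timeLength
    have e4 : 0 < (D ^ i) ^ (-(n + p)) := by positivity
    have e5 := mul_le_mul_of_nonneg_left e3 e4.le
    linarith
  have hδα : δ ^ α ≤ 2 ^ α * (D ^ (-(α * (n + p)))) ^ i := by
    calc δ ^ α ≤ (2 * ((D ^ i) ^ (-(n + p)))) ^ α := Real.rpow_le_rpow hδ0.le hδle hα.le
      _ = _ := by
        rw [Real.mul_rpow (by norm_num) (by positivity), ← Real.rpow_mul (by positivity),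
          ← Real.rpow_natCast, ← Real.rpow_mul hD0.le, ← Real.rpow_natCast, ← Real.rpow_mul hD0.le]
        congr 2
        ring
  have hmain : volume (R.nonfree p d E (m₀ + i)) ≤
      ENNReal.ofReal (K' * δ ^ α) * volume (R.toSet p) := by
    rcases le_or_gt δ δ₀ with hle | hgt
    · obtain ⟨c, hc, hwp, hcK⟩ := himp.2 δ hδ0 hle
      refine (volume_nonfree_le hp h3 hwp hR hQ ?_).trans ?_
      · rw [hMvol, hδ, div_mul_cancel₀ _ hM0.ne']
      · gcongr
        exact hcK.trans (mul_le_mul_of_nonneg_right (le_max_left _ _) (by positivity))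
    -- For δ > δ₀ there is no information beyond the trivial bound; the term δ₀^(-α) in the maximum
    -- makes the constant at least 1.
    · refine (measure_mono (nonfree_subset h3 hR _)).trans (le_mul_of_one_le_left zero_le ?_)
      rw [ENNReal.one_le_ofReal]
      calc (1 : ℝ) = δ₀ ^ (-α) * δ₀ ^ α := by
            rw [← Real.rpow_add hδ₀, neg_add_cancel, Real.rpow_zero]
        _ ≤ K' * δ ^ α := by
          gcongr
          exact le_max_right _ _
  refine hmain.trans ?_
  refine mul_le_mul_left (ENNReal.ofReal_le_ofReal ?_) _
  rw [mul_assoc]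
  gcongr

end ParabolicRect

end Integral

/-! ### Improving sets and the parabolic Muckenhoupt class -/

section Muckenhoupt

variable {n : ℕ} {p : ℝ} {d : ℕ} {E : Set (SpaceTime n)}

lemma ofReal_mul_top_rpow_neg {A v s : ℝ} (hA : 0 < A) (hs : 0 < s) (hv : v = 0) (B : ℝ≥0∞) :
    B ≤ ENNReal.ofReal A * ENNReal.ofReal v ^ (-s) := by
  rw [hv, ENNReal.ofReal_zero, ENNReal.zero_rpow_of_neg (by linarith),
    ENNReal.mul_top (by rwa [Ne, ENNReal.ofReal_eq_zero, not_le])]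
  exact le_top

namespace ParabolicRect

lemma lintegral_biUnion_free_le (h3 : 3 ≤ (2 : ℝ) ^ (d * p)) {s A : ℝ}
    (hA : ∀ P : ParabolicRect n, P.Valid → Disjoint (P.toSet p) E →
      ∫⁻ z in P.toSet p, ENNReal.ofReal (parabolicInfDist p z E) ^ (-s) ≤
        ENNReal.ofReal (A * P.side ^ (-s)) * volume (P.toSet p))
    {R : ParabolicRect n} (hR : R.Valid) {m : ℕ} {T : Set (ParabolicRect n)}
    (hT : ∀ P ∈ T, P ∈ R.dyadicLayer p d m ∧ Disjoint (P.toSet p) E) :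
    ∫⁻ z in ⋃ P ∈ T, P.toSet p, ENNReal.ofReal (parabolicInfDist p z E) ^ (-s) ≤
      ENNReal.ofReal (A * (R.side / (2 ^ d) ^ m) ^ (-s)) * volume (⋃ P ∈ T, P.toSet p) := by
  have hTc : T.Countable := ((finite_dyadicLayer p d R m).subset fun P hP => (hT P hP).1).countable
  have hTd : T.PairwiseDisjoint fun P => P.toSet p :=
    (pairwiseDisjoint_dyadicLayer h3 hR m).subset fun P hP => (hT P hP).1
  rw [lintegral_biUnion hTc (fun P _ => measurableSet_toSet p P) hTd,
    measure_biUnion hTc hTd (fun P _ => measurableSet_toSet p P), ← ENNReal.tsum_mul_left]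
  refine ENNReal.tsum_le_tsum fun P => ?_
  have hP := hT P.1 P.2
  rw [← side_of_mem_dyadicLayer hP.1]
  exact hA P.1 (hR.of_mem_dyadicLayer h3 hP.1) hP.2

/-- A point outside E is assigned to the first layer from m on in which its rectangle is free. If
that layer is m + i + 1, its ancestor in layer m + i meets E, so the piece has the small measure of
the non-free part of that layer. -/
lemma subset_free_union_nonfree (hp : 1 < p) (h3 : 3 ≤ (2 : ℝ) ^ (d * p)) (hE : E.Nonempty)
    (hc : IsClosed E) {R : ParabolicRect n} (hR : R.Valid) (m : ℕ) :
    R.toSet p ⊆ (R.toSet p ∩ E) ∪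
      ((⋃ P ∈ {P | P ∈ R.dyadicLayer p d m ∧ Disjoint (P.toSet p) E}, P.toSet p) ∪
      ⋃ i : ℕ, ⋃ P ∈ {P | (P ∈ R.dyadicLayer p d (m + i + 1) ∧ Disjoint (P.toSet p) E) ∧
        P.toSet p ⊆ R.nonfree p d E (m + i)}, P.toSet p) := by
  classical
  intro z hz
  by_cases hzE : z ∈ E
  · exact Or.inl ⟨hz, hzE⟩
  refine Or.inr ?_
  have hpos := parabolicInfDist_pos hp hE hc hzE
  have hex : ∃ j, ∃ P ∈ R.dyadicLayer p d (m + j), z ∈ P.toSet p ∧ Disjoint (P.toSet p) E := by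
    obtain ⟨k, hk⟩ := exists_side_lt (ne_zero_of_three_le h3) R.side hpos
    obtain ⟨P, hP, hzP⟩ := exists_mem_dyadicLayer h3 hR (m + k) hz
    have hPv := hR.of_mem_dyadicLayer h3 hP
    refine ⟨k, P, hP, hzP, ?_⟩
    rw [toSet_eq_pbox] at hzP ⊢
    refine disjoint_pbox_of_le hp hPv.1 hPv.timeLength_le hzP (le_trans ?_ hk.le)
    rw [side_of_mem_dyadicLayer hP]
    have := hR.1
    gcongr
    · exact one_le_pow₀ (by norm_num)
    · omega
  obtain ⟨P, hP, hzP, hPE⟩ := Nat.find_spec hex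
  rcases h0 : Nat.find hex with _ | i
  · rw [h0] at hP
    exact Or.inl (mem_iUnion₂.2 ⟨P, ⟨hP, hPE⟩, hzP⟩)
  · rw [h0] at hP
    obtain ⟨Q, hQ, hzQ⟩ := exists_mem_dyadicLayer h3 hR (m + i) hz
    have hQE : ¬ Disjoint (Q.toSet p) E := fun h =>
      Nat.find_min hex (show i < Nat.find hex by omega) ⟨Q, hQ, hzQ, h⟩
    refine Or.inr (mem_iUnion.2 ⟨i, mem_iUnion₂.2 ⟨P, ⟨⟨hP, hPE⟩, ?_⟩, hzP⟩⟩)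
    exact (subset_of_mem_of_mem h3 hR (by omega) hQ hP hzQ hzP).trans
      (subset_biUnion_of_mem (u := fun P : ParabolicRect n => P.toSet p)
        (show Q ∈ {P ∈ R.dyadicLayer p d (m + i) | ¬ Disjoint (P.toSet p) E} from ⟨hQ, hQE⟩))

/-- The integral of a negative power of the distance over a rectangle, in terms of the maximal hole
of the shifted rectangle. -/
lemma lintegral_le_of_improving (hp : 1 < p) (h3 : 3 ≤ (2 : ℝ) ^ (d * p)) (hE : E.Nonempty)
    (hc : IsClosed E) {c₀ δ₀ α K θ β A : ℝ} (hδ₀ : 0 < δ₀) (hα : 0 < α) (hβα : β < α)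
    (hA0 : 0 < A)
    (hA : ∀ P : ParabolicRect n, P.Valid → Disjoint (P.toSet p) E →
      ∫⁻ z in P.toSet p, ENNReal.ofReal (parabolicInfDist p z E) ^ (-(β * (n + p))) ≤
        ENNReal.ofReal (A * P.side ^ (-(β * (n + p)))) * volume (P.toSet p))
    (himp : IsImprovingWith p d E θ c₀ δ₀ α K) {R : ParabolicRect n} (hR : R.Valid)
    {M : ParabolicRect n} {m₀ : ℕ} (hM : M ∈ (R.shift p θ).dyadicLayer p d m₀)
    (hMvol : volume.real ((R.shift p θ).maximalHole p d E) = M.vol p) :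
    ∫⁻ z in R.toSet p, ENNReal.ofReal (parabolicInfDist p z E) ^ (-(β * (n + p))) ≤
      ENNReal.ofReal (A * M.side ^ (-(β * (n + p))) * (1 + ((2 : ℝ) ^ d) ^ (β * (n + p)) *
        (max K (δ₀ ^ (-α)) * 2 ^ α) * (1 - ((2 : ℝ) ^ d) ^ ((β - α) * (n + p)))⁻¹)) *
        volume (R.toSet p) := by
  have hp0 : 0 < p := by linarith
  have hN : (0 : ℝ) < n + p := by positivity
  set s := β * (n + p) with hs
  set D : ℝ := 2 ^ d with hD
  have hD1 : 1 < D := one_lt_pow₀ (by norm_num) (ne_zero_of_three_le h3)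
  have hD0 : 0 < D := by linarith
  set K' := max K (δ₀ ^ (-α)) * 2 ^ α with hK'
  have hK'0 : 0 < K' := mul_pos (lt_max_of_lt_right (by positivity)) (by positivity)
  set η := D ^ (-(α * (n + p))) with hη
  have hη0 : 0 < η := by positivity
  have hη1 : η < 1 := Real.rpow_lt_one_of_one_lt_of_neg hD1 (by nlinarith [mul_pos hα hN])
  -- Each further layer multiplies the average of the weight by D^s and the measure bound by
  -- D^(-α(n+p)); the product is below 1 because β < α.
  set ϱ := D ^ ((β - α) * (n + p)) with hϱ
  have hϱ0 : 0 < ϱ := by positivity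
  have hϱ1 : ϱ < 1 :=
    Real.rpow_lt_one_of_one_lt_of_neg hD1 (mul_neg_of_neg_of_pos (by linarith) hN)
  have hϱη : D ^ s * η = ϱ := by
    rw [hη, ← Real.rpow_add hD0, hs, hϱ]
    congr 1
    ring
  have hMv := (hR.shift p θ).of_mem_dyadicLayer h3 hM
  set h := M.side with hh
  have hh0 : 0 < h := hMv.1
  have hRh : R.side / D ^ m₀ = h := (side_of_mem_dyadicLayer hM).symm
  have hnf : ∀ i, volume (R.nonfree p d E (m₀ + i)) ≤
      ENNReal.ofReal (K' * η ^ i) * volume (R.toSet p) :=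
    volume_nonfree_le_geometric hp h3 hδ₀ hα himp hR hM hMvol
  -- The weight is infinite on E, so this part must be null; it lies in the non-free part of every
  -- layer.
  have hnull : volume (R.toSet p ∩ E) = 0 := by
    have hlim : Filter.Tendsto (fun i : ℕ => ENNReal.ofReal (K' * η ^ i) * volume (R.toSet p))
        Filter.atTop (nhds 0) := by
      have h1 := (tendsto_pow_atTop_nhds_zero_of_lt_one hη0.le hη1).const_mul K'
      rw [mul_zero] at h1
      have h2 := ENNReal.Tendsto.mul_const (b := volume (R.toSet p)) (ENNReal.tendsto_ofReal h1)
        (Or.inr (by rw [hR.volume_toSet]; exact ENNReal.ofReal_ne_top))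
      simpa using h2
    exact le_antisymm (ge_of_tendsto' hlim fun i =>
      (measure_mono (inter_subset_nonfree h3 hR _)).trans (hnf i)) zero_le
  have hterm : ∀ i : ℕ, ∫⁻ z in ⋃ P ∈ {P | (P ∈ R.dyadicLayer p d (m₀ + i + 1) ∧
      Disjoint (P.toSet p) E) ∧ P.toSet p ⊆ R.nonfree p d E (m₀ + i)}, P.toSet p,
        ENNReal.ofReal (parabolicInfDist p z E) ^ (-s) ≤
      ENNReal.ofReal (A * h ^ (-s) * (D ^ s * K')) * volume (R.toSet p) *
        ENNReal.ofReal ϱ ^ i := by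
    intro i
    refine (lintegral_biUnion_free_le h3 hA hR (m := m₀ + i + 1) fun P hP => hP.1).trans ?_
    have e1 : (R.side / D ^ (m₀ + i + 1)) ^ (-s) = h ^ (-s) * (D ^ s * (D ^ s) ^ i) := by
      rw [add_assoc, pow_add, ← div_div, hRh, Real.div_rpow hh0.le (by positivity),
        Real.rpow_neg (by positivity : (0 : ℝ) ≤ D ^ (i + 1)), div_inv_eq_mul, ← Real.rpow_natCast,
        ← Real.rpow_mul hD0.le, mul_comm _ s, Real.rpow_mul hD0.le, Real.rpow_natCast, pow_succ']
    calc ENNReal.ofReal (A * (R.side / D ^ (m₀ + i + 1)) ^ (-s)) * volume (⋃ P ∈ {P |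
          (P ∈ R.dyadicLayer p d (m₀ + i + 1) ∧ Disjoint (P.toSet p) E) ∧
            P.toSet p ⊆ R.nonfree p d E (m₀ + i)}, P.toSet p)
        ≤ ENNReal.ofReal (A * (R.side / D ^ (m₀ + i + 1)) ^ (-s)) *
          (ENNReal.ofReal (K' * η ^ i) * volume (R.toSet p)) := by
          gcongr
          exact (measure_mono (iUnion₂_subset fun P hP => hP.2)).trans (hnf i)
      _ = _ := by
          have hp1 : 0 < (R.side / D ^ (m₀ + i + 1)) ^ (-s) := by rw [e1]; positivity
          rw [← mul_assoc, ← ENNReal.ofReal_mul (by positivity),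
            mul_right_comm (ENNReal.ofReal _) (volume _),
            ← ENNReal.ofReal_pow hϱ0.le, ← ENNReal.ofReal_mul (by positivity), e1, ← hϱη, mul_pow]
          congr 2
          ring
  refine (lintegral_mono_set (subset_free_union_nonfree hp h3 hE hc hR m₀)).trans ?_
  refine (lintegral_union_le _ _ _).trans ?_
  rw [setLIntegral_measure_zero _ _ hnull, zero_add]
  refine (lintegral_union_le _ _ _).trans ?_
  refine (add_le_add (lintegral_biUnion_free_le h3 hA hR (m := m₀) fun P hP => hP)
    ((lintegral_iUnion_le _ _).trans (ENNReal.tsum_le_tsum hterm))).trans ?_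
  have hinv : 0 < (1 - ϱ)⁻¹ := inv_pos.2 (by linarith)
  rw [ENNReal.tsum_mul_left, ENNReal.tsum_geometric, ← ENNReal.ofReal_one,
    ← ENNReal.ofReal_sub _ hϱ0.le, ← ENNReal.ofReal_inv_of_pos (by linarith), mul_right_comm,
    ← ENNReal.ofReal_mul (by positivity)]
  have hsub : (⋃ P ∈ {P | P ∈ R.dyadicLayer p d m₀ ∧ Disjoint (P.toSet p) E}, P.toSet p) ⊆
      R.toSet p := iUnion₂_subset fun P hP => toSet_subset_of_mem_dyadicLayer h3 hR hP.1
  refine (add_le_add_left (mul_le_mul_right (measure_mono hsub) _) _).trans_eq ?_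
  rw [← hD, hRh, ← add_mul, ← ENNReal.ofReal_add (by positivity) (by positivity)]
  congr 2
  ring

end ParabolicRect

/-- When u(y) is large compared with the box the weight is essentially constant there. Otherwise the
hole of the shifted box has side at least u(y)/b, and the integral estimate in terms of that side
becomes one in terms of u(y). -/
lemma IsImprovingWith.exists_hasIntegralBound (hp : 1 < p) (h3 : 3 ≤ (2 : ℝ) ^ (d * p))
    {c₀ δ₀ α K θ β : ℝ} (hδ₀ : 0 < δ₀) (hα : 0 < α) (hβ : 0 < β) (hβα : β < α)
    (hβ1 : β * (n + p) < 1) (hθ : 1 < θ) :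
    ∃ A > 0, ∀ E : Set (SpaceTime n), E.Nonempty → IsClosed E →
      IsImprovingWith p d E θ c₀ δ₀ α K →
        HasIntegralBound p (fun z => parabolicInfDist p z E) θ 1 (β * (n + p)) A := by
  have hp0 : 0 < p := by linarith
  have hN : (0 : ℝ) < n + p := by positivity
  have hs : 0 < β * (n + p) := by positivity
  obtain ⟨A, hA, hfree⟩ := ParabolicRect.exists_lintegral_free_le n hp hs hβ1
  set F := 1 + ((2 : ℝ) ^ d) ^ (β * (n + p)) *
        (max K (δ₀ ^ (-α)) * 2 ^ α) * (1 - ((2 : ℝ) ^ d) ^ ((β - α) * (n + p)))⁻¹ with hF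
  have hF0 : 0 < F := by
    have h1 : 0 < max K (δ₀ ^ (-α)) := lt_max_of_lt_right (by positivity)
    have h2 : ((2 : ℝ) ^ d) ^ ((β - α) * (n + p)) < 1 :=
      Real.rpow_lt_one_of_one_lt_of_neg
        (one_lt_pow₀ (by norm_num) (ParabolicRect.ne_zero_of_three_le h3))
        (mul_neg_of_neg_of_pos (by linarith) hN)
    have h4 : 0 < (1 - ((2 : ℝ) ^ d) ^ ((β - α) * (n + p)))⁻¹ := inv_pos.2 (by linarith)
    positivity
  set s := β * (n + p) with hsdef
  set b : ℝ := 2 ^ d * (2 * (θ + 1)) with hb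
  have hb0 : 0 < b := by positivity
  refine ⟨(1 / 2) ^ (-s) + A * (1 / b) ^ (-s) * F, by positivity,
    fun E hE hc himp x l t hl y hy => ?_⟩
  have hlp := Real.rpow_pos_of_pos hl p
  rw [one_mul] at hy ⊢
  rcases (parabolicInfDist_nonneg p y E).eq_or_lt with h0 | hpos
  · exact ofReal_mul_top_rpow_neg (by positivity) hs h0.symm _
  set u := parabolicInfDist p y E with hu
  have hvol : volume (pbox x l t (l ^ p)) = ENNReal.ofReal (l ^ n * l ^ p) := volume_pbox _ hl.le _ _
  by_cases hfar : 2 * (θ + 1) * l ≤ u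
  · calc ∫⁻ z in pbox x l t (l ^ p), ENNReal.ofReal (parabolicInfDist p z E) ^ (-s)
        ≤ ∫⁻ _ in pbox x l t (l ^ p), ENNReal.ofReal (1 / 2 * u) ^ (-s) :=
          setLIntegral_mono' (measurableSet_pbox _ _ _ _) fun z hz =>
            rpow_neg_le_rpow_neg hs.le (ENNReal.ofReal_le_ofReal
              (half_le_of_mem_pbox hp hE (by linarith) hl hlp le_rfl hy hz hfar))
      _ = ENNReal.ofReal ((1 / 2) ^ (-s) * (l ^ n * l ^ p)) * ENNReal.ofReal u ^ (-s) := by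
          rw [setLIntegral_const, ofReal_mul_rpow_neg (by norm_num) hpos.le hs, hvol, mul_right_comm,
            ← ENNReal.ofReal_mul (by positivity)]
      _ ≤ _ := by
          gcongr
          have : 0 < A * (1 / b) ^ (-s) * F := by positivity
          linarith
  · push Not at hfar
    set R := ParabolicRect.ofBox p x l t (l ^ p) with hR
    have hRv : R.Valid := ParabolicRect.valid_ofBox x hl (by linarith) le_rfl
    have hRset : R.toSet p = pbox x l t (l ^ p) := ParabolicRect.toSet_ofBox x t _ hl
    have hys : y ∈ (R.shift p θ).toSet p := by rwa [hR, ParabolicRect.toSet_shift_ofBox x t _ θ hl]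
    obtain ⟨M, m₀, hM, hMvol, hMs⟩ := ParabolicRect.exists_hole_of_lt hp h3 (hRv.shift p θ) hys hpos
      (by linarith : 1 ≤ 2 * (θ + 1)) hfar
    have hint := ParabolicRect.lintegral_le_of_improving hp h3 hE hc hδ₀ hα hβα hA (hfree E hE hc)
      himp hRv hM hMvol
    rw [hRset, ← hF] at hint
    refine hint.trans ?_
    have h1 : M.side ^ (-s) ≤ (1 / b) ^ (-s) * u ^ (-s) := by
      rw [← Real.mul_rpow (by positivity) hpos.le, one_div_mul_eq_div]
      exact Real.rpow_le_rpow_of_nonpos (by positivity) hMs (by linarith)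
    rw [hvol, ENNReal.ofReal_rpow_of_pos hpos, ← ENNReal.ofReal_mul' (by positivity),
      ← ENNReal.ofReal_mul (by positivity)]
    apply ENNReal.ofReal_le_ofReal
    calc A * M.side ^ (-s) * F * (l ^ n * l ^ p)
        ≤ A * ((1 / b) ^ (-s) * u ^ (-s)) * F * (l ^ n * l ^ p) := by gcongr
      _ = (A * (1 / b) ^ (-s) * F) * (l ^ n * l ^ p) * u ^ (-s) := by ring
      _ ≤ _ := by
        gcongr
        have : (0 : ℝ) < (1 / 2) ^ (-s) := by positivity
        linarith

/-- The global bound holds for every y in the upper rectangle, hence for the essential infimum;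
measured from the top of the lower rectangle, the lag of y lies between 2γ L^p and (1+γ) L^p. Local
integrability follows from the same bound once some y outside E exists. -/
lemma HasIntegralBound.exists_isParabolicA1With {a b s A γ : ℝ} (hp : 1 < p) (ha : 0 < a)
    (hb : 0 < b) (hs : 0 < s) (hA : 0 < A) (hγ0 : 0 < γ) (hγ1 : γ < 1) :
    ∃ C > 0, ∀ E : Set (SpaceTime n), E.Nonempty →
      (∀ R : ParabolicRect n, R.Valid → ¬ R.toSet p ⊆ E) → IsClosed E →
      HasIntegralBound p (fun z => parabolicInfDist p z E) a b s A →
        IsParabolicA1With p γ (parabolicDistWeight p E s) C := by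
  have hp0 : 0 < p := by linarith
  have hγ : 0 < 1 - γ := by linarith
  obtain ⟨A', hA', hglob⟩ := HasIntegralBound.exists_global (n := n) (a := a) (b := b) (s := s)
    (A := A) (σ := 1 - γ) (τ := 2 * γ) (τ' := 1 + γ) (D := 1) hp ha hb hs hA hγ (by positivity)
    zero_le_one
  refine ⟨A' / (1 - γ), by positivity, fun E hE hnot hc hint => ?_⟩
  have hlow : ∀ (x : Fin n → ℝ) (t L : ℝ), 0 < L → ∀ y ∈ upperRect p x t L γ,
      ∫⁻ z in lowerRect p x t L γ, parabolicDistWeight p E s z ≤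
        ENNReal.ofReal (A' * (L ^ n * L ^ p)) * parabolicDistWeight p E s y := by
    intro x t L hL y hy
    have hy2 : t + γ * L ^ p < y.2 ∧ y.2 < t + L ^ p := hy.2
    have hg := hglob _ (fun z => parabolicInfDist_nonneg p z E) hint x (t - γ * L ^ p) L y hL
      (by linarith) (by linarith) ((norm_sub_center_le hL.le hy.1).trans (by linarith))
    refine (lintegral_mono_set ?_).trans hg
    intro z hz
    have hz2 : t - L ^ p < z.2 ∧ z.2 < t - γ * L ^ p := hz.2
    exact ⟨hz.1, by linarith, by linarith⟩
  refine ⟨(measurable_parabolicDistWeight hp hE s).aemeasurable, fun K hK => ?_, fun x t L hL => ?_⟩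
  · obtain ⟨r, hr⟩ := hK.isBounded.subset_closedBall 0
    set r' := max r 0 with hr'
    -- A side so large that the lower rectangle centered at time 0 contains the compact set.
    set L := 2 * r' / (1 - γ) + 2 * r' + 1 with hLdef
    have hr0 : 0 ≤ r' := le_max_right _ _
    have hr1 : 0 ≤ 2 * r' / (1 - γ) := by positivity
    have hL1 : 1 ≤ L := by linarith
    have hL0 : 0 < L := by linarith
    have hLp : L ≤ L ^ p := by
      simpa using Real.rpow_le_rpow_of_exponent_le hL1 hp.le
    have hLγ : 2 * r' < (1 - γ) * L ^ p := by
      have h1 : 2 * r' / (1 - γ) < L ^ p := by linarith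
      rw [div_lt_iff₀ hγ] at h1
      linarith
    set t := (1 + γ) * L ^ p / 2 with ht
    have hKsub : K ⊆ lowerRect p 0 t L γ := by
      intro z hz
      have h1 := hr hz
      rw [mem_closedBall_zero_iff, Prod.norm_def, max_le_iff] at h1
      have h2 : r ≤ r' := le_max_left _ _
      have h3 := abs_le.1 h1.2
      refine ⟨fun i => ?_, ?_, ?_⟩
      · have h4 := abs_le.1 ((norm_le_pi_norm z.1 i).trans h1.1)
        simp only [Pi.zero_apply]
        constructor <;> linarith
      · linarith
      · linarith
    -- A box of side ρ L fits into the upper rectangle, starting a quarter of the way up; it is not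
    -- contained in E, which yields a point y with finite weight.
    set ρ := (1 - γ) / 2 with hρ
    have hρ0 : 0 < ρ := by positivity
    have hρ1 : ρ ≤ 1 := by rw [hρ]; linarith
    have hρp : (ρ * L) ^ p ≤ ρ * L ^ p := by
      rw [Real.mul_rpow hρ0.le hL0.le]
      gcongr
      simpa using Real.rpow_le_rpow_of_exponent_ge hρ0 hρ1 hp.le
    have hρL : 0 < ρ * L := by positivity
    have hρLp := Real.rpow_pos_of_pos hρL p
    obtain ⟨y, hy, hyE⟩ := Set.not_subset.1 (hnot
      (ParabolicRect.ofBox p (0 : Fin n → ℝ) (ρ * L) (t + γ * L ^ p + (1 - γ) * L ^ p / 4)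
        ((ρ * L) ^ p)) (ParabolicRect.valid_ofBox _ hρL (by linarith) le_rfl))
    rw [ParabolicRect.toSet_ofBox _ _ _ hρL] at hy
    have hyup : y ∈ upperRect p 0 t L γ := by
      have h2 := (mem_pbox.1 hy).2
      have h3 : ρ * L ≤ L := mul_le_of_le_one_left hL0.le hρ1
      have h4 : ρ * L ^ p = (1 - γ) * L ^ p / 2 := by rw [hρ]; ring
      have h5 : 0 < (1 - γ) * L ^ p := by positivity
      refine ⟨halfOpenCube_subset ?_ hy.1, ?_, ?_⟩
      · rw [sub_self, norm_zero]; linarith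
      · linarith
      · linarith
    refine (lintegral_mono_set hKsub).trans_lt ((hlow 0 t L hL0 y hyup).trans_lt ?_)
    rw [parabolicDistWeight, ENNReal.ofReal_rpow_of_pos (parabolicInfDist_pos hp hE hc hyE)]
    exact ENNReal.mul_lt_top ENNReal.ofReal_lt_top ENNReal.ofReal_lt_top
  · have hLp := Real.rpow_pos_of_pos hL p
    have hvol : volume (lowerRect p x t L γ) = ENNReal.ofReal ((1 - γ) * (L ^ n * L ^ p)) := by
      have h1 : volume (halfOpenCube x L) = ENNReal.ofReal (L ^ n) := by
        have : halfOpenCube x L = Set.pi univ fun i => Ico (x i - L / 2) (x i + L / 2) := by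
          ext; simp [halfOpenCube]
        rw [this, Real.volume_pi_Ico, ENNReal.ofReal_pow hL.le]
        have : ∀ i, x i + L / 2 - (x i - L / 2) = L := fun i => by ring
        simp [this]
      rw [lowerRect, Measure.volume_eq_prod, Measure.prod_prod, h1, Real.volume_Ioo,
        ← ENNReal.ofReal_mul (by positivity)]
      congr 1
      ring
    have hvol0 : volume (lowerRect p x t L γ) ≠ 0 := by
      rw [hvol, Ne, ENNReal.ofReal_eq_zero, not_le]; positivity
    have hvolt : volume (lowerRect p x t L γ) ≠ ⊤ := by rw [hvol]; exact ENNReal.ofReal_ne_top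
    have hC0 : ENNReal.ofReal (A' / (1 - γ)) ≠ 0 := by
      rw [Ne, ENNReal.ofReal_eq_zero, not_le]; positivity
    have havg : ∀ y ∈ upperRect p x t L γ, ⨍⁻ z in lowerRect p x t L γ, parabolicDistWeight p E s z
        ∂volume ≤ ENNReal.ofReal (A' / (1 - γ)) * parabolicDistWeight p E s y := by
      intro y hy
      rw [setLAverage_eq, ENNReal.div_le_iff hvol0 hvolt]
      refine (hlow x t L hL y hy).trans_eq ?_
      rw [hvol, mul_right_comm, ← ENNReal.ofReal_mul (by positivity)]
      congr 2
      field_simp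
    have hupm : MeasurableSet (upperRect p x t L γ) := by
      have : upperRect p x t L γ = (Set.pi univ fun i => Ico (x i - L / 2) (x i + L / 2)) ×ˢ
          Ioo (t + γ * L ^ p) (t + L ^ p) := by
        ext; simp [upperRect, halfOpenCube]
      rw [this]
      exact (MeasurableSet.univ_pi fun i => measurableSet_Ico).prod measurableSet_Ioo
    rw [← ENNReal.div_le_iff' hC0 ENNReal.ofReal_ne_top]
    refine le_essInf_of_ae_le _ ((ae_restrict_iff' hupm).2 (Filter.Eventually.of_forall fun y hy => ?_))
    rw [ENNReal.div_le_iff' hC0 ENNReal.ofReal_ne_top]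
    exact havg y hy

/-- By continuity u > u(y)/2 on a nonempty open set near y, which has positive measure. Openness of
U is essential, since y could otherwise sit on the boundary of S. -/
lemma essInf_parabolicDistWeight_le (hp : 1 < p) (hE : E.Nonempty) {s : ℝ} (hs : 0 < s)
    {U S : Set (SpaceTime n)} (hU : IsOpen U) (hUS : U ⊆ S) {y : SpaceTime n} (hy : y ∈ U)
    (hpos : 0 < parabolicInfDist p y E) :
    essInf (parabolicDistWeight p E s) (volume.restrict S) ≤
      ENNReal.ofReal (1 / 2 * parabolicInfDist p y E) ^ (-s) := by
  by_contra! hlt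
  have hae := ae_lt_of_lt_essInf hlt
  set O := U ∩ {z | 1 / 2 * parabolicInfDist p y E < parabolicInfDist p z E} with hO
  have hOo : IsOpen O :=
    hU.inter (isOpen_lt continuous_const (continuous_parabolicInfDist hp hE))
  have hOn : O.Nonempty := ⟨y, hy, by simp only [mem_ofPred_eq]; linarith⟩
  have hsub : O ⊆ {z | ¬ ENNReal.ofReal (1 / 2 * parabolicInfDist p y E) ^ (-s) <
      parabolicDistWeight p E s z} := fun z hz => not_lt.2
    (rpow_neg_le_rpow_neg hs.le (ENNReal.ofReal_le_ofReal (le_of_lt hz.2)))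
  have h0 : (volume.restrict S) O = 0 := measure_mono_null hsub (ae_iff.1 hae)
  rw [Measure.restrict_apply hOo.measurableSet,
    inter_eq_self_of_subset_left (inter_subset_left.trans hUS)] at h0
  exact (hOo.measure_pos volume hOn).ne' h0

/-- The A₁⁺ condition is used at side 2l, so that the box of side l around the same center is
interior to the larger cube and the essential infimum can be compared with the pointwise value u(y).
-/
lemma IsParabolicA1With.exists_hasIntegralBound {s C γ : ℝ} (hp : 1 < p) (hs : 0 < s) (hC : 0 < C) (hγ0 : 0 < γ)
    (hγ1 : γ < 1) :
    ∃ A > 0, ∀ E : Set (SpaceTime n), E.Nonempty →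
      IsParabolicA1With p γ (parabolicDistWeight p E s) C →
        HasIntegralBound p (fun z => parabolicInfDist p z E) ((1 + γ) * 2 ^ p)
          ((1 - γ) * 2 ^ p / 2) s A := by
  refine ⟨C * (2 ^ n * 2 ^ p) * (1 / 2) ^ (-s), by positivity, fun E hE hA1 x l t hl y hy => ?_⟩
  have hlp := Real.rpow_pos_of_pos hl p
  rcases (parabolicInfDist_nonneg p y E).eq_or_lt with h0 | hpos
  · exact ofReal_mul_top_rpow_neg (by positivity) hs h0.symm _
  have e : (2 * l) ^ p = 2 ^ p * l ^ p := Real.mul_rpow (by norm_num) hl.le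
  have hl2 : 0 < 2 * l := by positivity
  have hH : 0 < (1 - γ) * (2 * l) ^ p := mul_pos (by linarith) (by positivity)
  -- Places the two small boxes, of half the temporal length, in the middle of the lower and the
  -- upper rectangle, with a quarter of margin on each side.
  set t' := t + (2 * l) ^ p - (1 - γ) * (2 * l) ^ p / 4 with ht'
  have hsub : pbox x l t ((1 - γ) * 2 ^ p / 2 * l ^ p) ⊆ lowerRect p x t' (2 * l) γ := by
    intro z hz
    have hz2 := (mem_pbox.1 hz).2
    rw [show (1 - γ) * 2 ^ p / 2 * l ^ p = (1 - γ) * (2 * l) ^ p / 2 by rw [e]; ring] at hz2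
    refine ⟨halfOpenCube_subset ?_ hz.1, ?_, ?_⟩
    · rw [sub_self, norm_zero]; linarith
    · linarith
    · linarith
  set U : Set (SpaceTime n) :=
    Metric.ball x l ×ˢ Ioo (t' + γ * (2 * l) ^ p) (t' + (2 * l) ^ p) with hU
  have hUS : U ⊆ upperRect p x t' (2 * l) γ := by
    refine prod_mono (fun z hz i => ?_) subset_rfl
    rw [mem_ball_iff_norm] at hz
    have h1 := abs_lt.1 ((abs_apply_sub_le_norm z x i).trans_lt hz)
    constructor <;> linarith
  have hyU : y ∈ U := by
    have hy2 := (mem_pbox.1 hy).2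
    rw [show (1 - γ) * 2 ^ p / 2 * l ^ p = (1 - γ) * (2 * l) ^ p / 2 by rw [e]; ring,
      show (1 + γ) * 2 ^ p * l ^ p = (1 + γ) * (2 * l) ^ p by rw [e]; ring] at hy2
    refine ⟨?_, ?_, ?_⟩
    · rw [mem_ball_iff_norm]
      linarith [norm_sub_center_le hl.le hy.1]
    · linarith
    · linarith
  have hess := essInf_parabolicDistWeight_le hp hE hs (Metric.isOpen_ball.prod isOpen_Ioo) hUS hyU hpos
  have hvol : volume (lowerRect p x t' (2 * l) γ) ≤ ENNReal.ofReal ((2 * l) ^ n * (2 * l) ^ p) := by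
    rw [← volume_pbox x hl2.le (t' - (2 * l) ^ p)]
    refine measure_mono fun z hz => ?_
    have hz2 : t' - (2 * l) ^ p < z.2 ∧ z.2 < t' - γ * (2 * l) ^ p := hz.2
    have h6 : 0 ≤ γ * (2 * l) ^ p := by positivity
    exact ⟨hz.1, by linarith, by linarith⟩
  calc ∫⁻ z in pbox x l t ((1 - γ) * 2 ^ p / 2 * l ^ p),
        ENNReal.ofReal (parabolicInfDist p z E) ^ (-s)
      ≤ ∫⁻ z in lowerRect p x t' (2 * l) γ, parabolicDistWeight p E s z := lintegral_mono_set hsub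
    _ = volume (lowerRect p x t' (2 * l) γ) *
          ⨍⁻ z in lowerRect p x t' (2 * l) γ, parabolicDistWeight p E s z ∂volume :=
        (measure_mul_setLAverage _ (hvol.trans_lt ENNReal.ofReal_lt_top).ne).symm
    _ ≤ ENNReal.ofReal ((2 * l) ^ n * (2 * l) ^ p) *
          (ENNReal.ofReal C * ENNReal.ofReal (1 / 2 * parabolicInfDist p y E) ^ (-s)) := by
        gcongr
        refine (hA1.2.2 x t' (2 * l) hl2).trans ?_
        gcongr
    _ = _ := by
        rw [ofReal_mul_rpow_neg (by norm_num) hpos.le hs, ← mul_assoc, ← mul_assoc,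
          ← ENNReal.ofReal_mul (by positivity), ← ENNReal.ofReal_mul (by positivity), e, mul_pow]
        congr 2
        ring

/-- Chebyshev's inequality for u^(-s), after the integral bound has been moved to the lag θ; the gap
between the box and its shift is (θ-1) h ≥ (θ-1) l^p / 2. -/
lemma HasIntegralBound.exists_hasDecay {a b s A θ : ℝ} (hp : 1 < p) (ha : 0 < a)
    (hb : 0 < b) (hs : 0 < s) (hA : 0 < A) (hθ : 1 < θ) :
    ∃ A' > 0, ∀ u : SpaceTime n → ℝ, (∀ z, 0 ≤ u z) → Measurable u →
      HasIntegralBound p u a b s A → HasDecay p u θ s A' := by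
  obtain ⟨A', hA', hglob⟩ := HasIntegralBound.exists_global (n := n) (a := a) (b := b) (s := s)
    (A := A) (σ := 1) (τ := (θ - 1) / 2) (τ' := θ + 1) (D := 1) hp ha hb hs hA one_pos
    (by linarith) zero_le_one
  refine ⟨2 * A', by positivity, fun u hu0 hum hu x l t h hl hh1 hh2 y hy σ hσ => ?_⟩
  have hlp := Real.rpow_pos_of_pos hl p
  rcases (hu0 y).eq_or_lt with h0 | hpos
  · have : {z ∈ pbox x l t h | u z < σ * u y} = ∅ := by
      rw [← h0, mul_zero]
      exact Set.eq_empty_of_forall_notMem fun z hz => absurd hz.2 (not_lt.2 (hu0 z))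
    rw [this, measure_empty]
    exact zero_le
  have hy2 := (mem_pbox.1 hy).2
  have hθh : (θ - 1) * (l ^ p / 2) ≤ (θ - 1) * h := mul_le_mul_of_nonneg_left hh1 (by linarith)
  have hθh' : θ * h ≤ θ * l ^ p := mul_le_mul_of_nonneg_left hh2 (by linarith)
  have hg := hglob u hu0 hu x (t + h) l y hl (by linarith) (by linarith)
    ((norm_sub_center_le hl.le hy.1).trans (by linarith))
  set X := {z ∈ pbox x l t h | u z < σ * u y} with hX
  have hXm : MeasurableSet X :=
    (measurableSet_pbox _ _ _ _).inter (measurableSet_lt hum measurable_const)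
  have hsub : X ⊆ pbox x l (t + h - 1 * l ^ p) (1 * l ^ p) :=
    (sep_subset _ _).trans (pbox_subset (by simp) (by linarith) (by linarith))
  have hcheb : ENNReal.ofReal (σ * u y) ^ (-s) * volume X ≤
      ENNReal.ofReal (A' * (l ^ n * l ^ p)) * ENNReal.ofReal (u y) ^ (-s) := by
    refine le_trans ?_ ((lintegral_mono_set hsub).trans hg)
    rw [← setLIntegral_const]
    exact setLIntegral_mono' hXm fun z hz =>
      rpow_neg_le_rpow_neg hs.le (ENNReal.ofReal_le_ofReal hz.2.le)
  have h4 : ENNReal.ofReal (u y) ^ (-s) ≠ 0 := by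
    rw [ENNReal.ofReal_rpow_of_pos hpos, Ne, ENNReal.ofReal_eq_zero, not_le]; positivity
  have h5 : ENNReal.ofReal (u y) ^ (-s) ≠ ⊤ := by
    rw [ENNReal.ofReal_rpow_of_pos hpos]; exact ENNReal.ofReal_ne_top
  rw [ofReal_mul_rpow_neg hσ hpos.le hs, mul_right_comm, ENNReal.mul_le_mul_iff_left h4 h5] at hcheb
  calc volume X = ENNReal.ofReal (σ ^ s) * (ENNReal.ofReal (σ ^ (-s)) * volume X) := by
        rw [← mul_assoc, ← ENNReal.ofReal_mul (by positivity), ← Real.rpow_add hσ, add_neg_cancel,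
          Real.rpow_zero, ENNReal.ofReal_one, one_mul]
    _ ≤ ENNReal.ofReal (σ ^ s) * ENNReal.ofReal (A' * (l ^ n * l ^ p)) := by gcongr
    _ ≤ _ := by
        rw [volume_pbox _ hl.le, ← ENNReal.ofReal_mul (by positivity),
          ← ENNReal.ofReal_mul (by positivity)]
        apply ENNReal.ofReal_le_ofReal
        have h6 : A' * σ ^ s * (l ^ n * l ^ p) ≤ A' * σ ^ s * (l ^ n * (2 * h)) := by
          gcongr
          linarith
        linarith

/-- The weight is infinite on E, so a rectangle inside E would contradict local integrability. -/
lemma IsParabolicA1With.not_subset {s C γ : ℝ} (hp : 1 < p) (hs : 0 < s)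
    (h : IsParabolicA1With p γ (parabolicDistWeight p E s) C) {R : ParabolicRect n} (hR : R.Valid) :
    ¬ R.toSet p ⊆ E := by
  intro hsub
  obtain ⟨x, hx, -⟩ := ParabolicRect.toSet_eq_pbox_of_valid (R := R) p
  have hsubK : R.toSet p ⊆
      Metric.closedBall x (R.side / 2) ×ˢ Icc R.bottom (R.bottom + R.timeLength p) := by
    rw [hx]
    refine fun z hz => ⟨?_, hz.2.1, hz.2.2.le⟩
    rw [mem_closedBall_iff_norm]
    exact norm_sub_center_le hR.1.le hz.1
  have hfin := h.2.1 _ ((isCompact_closedBall x (R.side / 2)).prod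
    (isCompact_Icc (a := R.bottom) (b := R.bottom + R.timeLength p)))
  refine absurd ((lintegral_mono_set hsubK).trans_lt hfin) ?_
  have htop : ∫⁻ z in R.toSet p, parabolicDistWeight p E s z = ⊤ := by
    rw [setLIntegral_congr_fun (ParabolicRect.measurableSet_toSet p R) (g := fun _ => ⊤)
      (fun z hz => ?_), setLIntegral_const, ENNReal.top_mul]
    · rw [hR.volume_eq_ofReal_vol, Ne, ENNReal.ofReal_eq_zero, not_le]
      exact hR.vol_pos
    · simp only [parabolicDistWeight]
      rw [parabolicInfDist_eq_zero hp (hsub hz), ENNReal.ofReal_zero,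
        ENNReal.zero_rpow_of_neg (by linarith)]
  rw [htop]
  exact lt_irrefl _

/-- Weakly porous sets are improving. -/
theorem IsWeaklyPorous.exists_isImprovingWith (hp : 1 < p) (h3 : 3 ≤ (2 : ℝ) ^ (d * p)) {c δ θ : ℝ}
    (hc : c ∈ Ioo (0 : ℝ) 1) (hδ : δ ∈ Ioo (0 : ℝ) 1) (hθ : 1 < θ) :
    ∃ α > 0, ∃ K > 0, ∀ E : Set (SpaceTime n), E.Nonempty → IsClosed E →
      IsWeaklyPorous p d E c δ θ → IsImprovingWith p d E θ c δ α K := by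
  have hp0 : 0 < p := by linarith
  have hN : (0 : ℝ) < n + p := by positivity
  obtain ⟨κ, hκ, c', hc', -, hlv⟩ :=
    IsWeaklyPorous.exists_hasLargeValues (n := n) hp h3 hc.1 hc.2 hδ.1 hθ
  obtain ⟨s, hs, A, hA, hdec⟩ := HasLargeValues.exists_hasDecay (n := n) hp hθ hκ hc'
  have hα : 0 < s / (n + p) := by positivity
  obtain ⟨A', hA', hwp⟩ := HasDecay.exists_isWeaklyPorous (n := n) (θ := θ) (α := s / (n + p)) hp h3 hA
  refine ⟨s / (n + p), hα, max A' (2 ^ (s / (n + p))), lt_max_of_lt_left hA', fun E hE hEc hE' => ?_⟩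
  set α := s / (n + p) with hαdef
  refine ⟨hE', fun δ' hδ'0 hδ'1 => ?_⟩
  have hd := hdec _ (continuous_parabolicInfDist hp hE) (fun z => parabolicInfDist_nonneg p z E)
    (hlv E hE hE')
  rw [← div_mul_cancel₀ s hN.ne', ← hαdef] at hd
  have hδα : 0 < δ' ^ α := by positivity
  rcases le_or_gt δ' (1 / 2) with hhalf | hhalf
  -- The value 1 - A' δ'^α may fail to be positive; when it does not exceed c, the original c
  -- already satisfies the required inequality.
  · rcases le_or_gt (1 - A' * δ' ^ α) c with hle | hlt
    · refine ⟨c, hc, hE'.mono le_rfl hδ'1, ?_⟩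
      have : A' * δ' ^ α ≤ max A' (2 ^ α) * δ' ^ α := by gcongr; exact le_max_left _ _
      linarith
    · refine ⟨1 - A' * δ' ^ α, ⟨hc.1.trans hlt, by linarith [mul_pos hA' hδα]⟩,
        hwp E hE hEc hd (fun R hR => hE'.not_subset hc.1 h3 hR) δ' hδ'0 hhalf _ (by linarith), ?_⟩
      rw [sub_sub_cancel]
      gcongr
      exact le_max_left _ _
  -- Here δ' > 1/2, outside the range of the decay argument; the lower bound 2^α on K makes K δ'^α ≥
  -- 1, so c serves.
  · refine ⟨c, hc, hE'.mono le_rfl hδ'1, ?_⟩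
    have h1 : 1 ≤ max A' (2 ^ α) * δ' ^ α := by
      calc (1 : ℝ) = 2 ^ α * (1 / 2) ^ α := by
            rw [← Real.mul_rpow (by norm_num) (by norm_num)]; norm_num
        _ ≤ _ := by
          gcongr
          exact le_max_right _ _
    linarith [hc.1]

/-- Negative powers of the distance to an improving set are parabolic `A₁` weights. -/
theorem IsImprovingWith.exists_isParabolicA1With (hp : 1 < p) (h3 : 3 ≤ (2 : ℝ) ^ (d * p))
    {c₀ δ₀ α K θ β γ : ℝ} (hc₀ : 0 < c₀) (hδ₀ : 0 < δ₀) (hα : 0 < α) (hβ : 0 < β) (hβα : β < α)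
    (hβ1 : β * (n + p) < 1) (hθ : 1 < θ) (hγ0 : 0 < γ) (hγ1 : γ < 1) :
    ∃ C > 0, ∀ E : Set (SpaceTime n), E.Nonempty → IsClosed E →
      IsImprovingWith p d E θ c₀ δ₀ α K →
        IsParabolicA1With p γ (parabolicDistWeight p E (β * (n + p))) C := by
  have hp0 : 0 < p := by linarith
  obtain ⟨A, hA, hint⟩ := IsImprovingWith.exists_hasIntegralBound (n := n) (c₀ := c₀) (K := K)
    hp h3 hδ₀ hα hβ hβα hβ1 hθ
  obtain ⟨C, hC, hA1⟩ := HasIntegralBound.exists_isParabolicA1With (n := n) (a := θ) (b := 1)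
    (s := β * (n + p)) hp (by linarith) one_pos (by positivity) hA hγ0 hγ1
  exact ⟨C, hC, fun E hE hEc himp => hA1 E hE
    (fun R hR => himp.1.not_subset hc₀ h3 hR) hEc (hint E hE hEc himp)⟩

/-- If a negative power of the distance to `E` is a parabolic `A₁` weight, then `E` is improving. -/
theorem IsParabolicA1With.exists_isImprovingWith (hp : 1 < p) (h3 : 3 ≤ (2 : ℝ) ^ (d * p))
    {θ β γ C : ℝ} (hβ : 0 < β) (hC : 0 < C) (hθ : 1 < θ) (hγ0 : 0 < γ) (hγ1 : γ < 1) :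
    ∃ c₀ ∈ Ioo (0 : ℝ) 1, ∃ δ₀ ∈ Ioo (0 : ℝ) 1, ∃ K > 0,
      ∀ E : Set (SpaceTime n), E.Nonempty → IsClosed E →
        IsParabolicA1With p γ (parabolicDistWeight p E (β * (n + p))) C →
          IsImprovingWith p d E θ c₀ δ₀ β K := by
  have hp0 : 0 < p := by linarith
  have hs : 0 < β * (n + p) := by positivity
  obtain ⟨A, hA, hint⟩ := IsParabolicA1With.exists_hasIntegralBound (n := n) hp hs hC hγ0 hγ1
  obtain ⟨A₁, hA₁, hdec⟩ := HasIntegralBound.exists_hasDecay (n := n) (θ := θ)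
    (a := (1 + γ) * 2 ^ p) (b := (1 - γ) * 2 ^ p / 2) hp (by positivity)
    (by have : 0 < 1 - γ := by linarith
        positivity) hs hA hθ
  obtain ⟨A', hA', hwp⟩ := HasDecay.exists_isWeaklyPorous (n := n) (θ := θ) (α := β) hp h3 hA₁
  -- Ensures A' δ^β ≤ 1/2 for all δ ≤ δ₀, so that c = 1 - A' δ^β stays in (0, 1) and c₀ = 1/2 is
  -- attained at δ₀.
  set δ₀ := min (1 / 2) ((1 / (2 * A')) ^ (1 / β)) with hδ₀
  have hδ₀0 : 0 < δ₀ := lt_min (by norm_num) (by positivity)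
  have hδ₀1 : δ₀ ≤ 1 / 2 := min_le_left _ _
  have hδ₀A : A' * δ₀ ^ β ≤ 1 / 2 := by
    calc A' * δ₀ ^ β ≤ A' * ((1 / (2 * A')) ^ (1 / β)) ^ β := by
          gcongr
          exact min_le_right _ _
      _ = 1 / 2 := by
          rw [← Real.rpow_mul (by positivity), one_div_mul_cancel hβ.ne', Real.rpow_one]
          field_simp
  refine ⟨1 / 2, by norm_num, δ₀, ⟨hδ₀0, by linarith⟩, A', hA', fun E hE hEc hA1 => ?_⟩
  have hw := hwp E hE hEc (hdec _ (fun z => parabolicInfDist_nonneg p z E)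
    (continuous_parabolicInfDist hp hE).measurable (hint E hE hA1))
    (fun R hR => hA1.not_subset hp hs hR)
  refine ⟨hw δ₀ hδ₀0 hδ₀1 _ (by linarith), fun δ hδ hδ1 => ?_⟩
  have hmono : A' * δ ^ β ≤ A' * δ₀ ^ β := by gcongr
  have hpos : 0 < A' * δ ^ β := by positivity
  exact ⟨1 - A' * δ ^ β, ⟨by linarith, by linarith⟩,
    hw δ hδ (hδ1.trans hδ₀1) _ (by linarith), by linarith⟩

end Muckenhoupt

/-! ### The equivalence assembled from the three quantitative implications. -/

theorem mainTheorem1 (n : ℕ) (p : ℝ) (hp : 1 < p) (d : ℕ) (hd : Real.logb 2 9 ≤ d * p)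
    (θ : ℝ) (hθ : 1 < θ) (γ : ℝ) (hγ0 : 0 < γ) (hγ1 : γ < 1) :
    (∀ E : Set (SpaceTime n), E.Nonempty → IsClosed E →
      List.TFAE [
        ∃ c ∈ Ioo (0 : ℝ) 1, ∃ δ ∈ Ioo (0 : ℝ) 1, IsWeaklyPorous p d E c δ θ,
        ∃ α > 0, IsImproving p d E θ α,
        ∃ β > 0, IsParabolicA1 p γ (parabolicDistWeight p E (β * (n + p)))]) ∧
    (∀ c ∈ Ioo (0 : ℝ) 1, ∀ δ ∈ Ioo (0 : ℝ) 1, ∃ α > 0, ∃ K > 0,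
      ∀ E : Set (SpaceTime n), E.Nonempty → IsClosed E →
        IsWeaklyPorous p d E c δ θ → IsImprovingWith p d E θ c δ α K) ∧
    (∀ c₀ ∈ Ioo (0 : ℝ) 1, ∀ δ₀ ∈ Ioo (0 : ℝ) 1, ∀ α > 0, ∀ K > 0,
      ∀ β > 0, β < α → β * (n + p) < 1 → ∃ C > 0,
        ∀ E : Set (SpaceTime n), E.Nonempty → IsClosed E →
          IsImprovingWith p d E θ c₀ δ₀ α K →
            IsParabolicA1With p γ (parabolicDistWeight p E (β * (n + p))) C) ∧
    (∀ β > 0, ∀ C > 0,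
      ∃ c₀ ∈ Ioo (0 : ℝ) 1, ∃ δ₀ ∈ Ioo (0 : ℝ) 1, ∃ K > 0,
        ∀ E : Set (SpaceTime n), E.Nonempty → IsClosed E →
          IsParabolicA1With p γ (parabolicDistWeight p E (β * (n + p))) C →
            IsImprovingWith p d E θ c₀ δ₀ β K) := by
  have hN : (0 : ℝ) < n + p := by positivity
  have h3 : 3 ≤ (2 : ℝ) ^ (d * p) := by
    have h9 : (9 : ℝ) ≤ 2 ^ (d * p) := by
      rwa [Real.logb_le_iff_le_rpow (by norm_num) (by norm_num)] at hd
    linarith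
  have ha := fun c (hc : c ∈ Ioo (0 : ℝ) 1) δ (hδ : δ ∈ Ioo (0 : ℝ) 1) =>
    IsWeaklyPorous.exists_isImprovingWith (n := n) hp h3 hc hδ hθ
  have hb := fun c₀ (hc₀ : c₀ ∈ Ioo (0 : ℝ) 1) δ₀ (hδ₀ : δ₀ ∈ Ioo (0 : ℝ) 1) α (hα : α > 0) K
      (_ : K > (0 : ℝ)) β (hβ : β > 0) (hβα : β < α) (hβ1 : β * (n + p) < 1) =>
    IsImprovingWith.exists_isParabolicA1With (n := n) (K := K) hp h3 hc₀.1 hδ₀.1 hα hβ hβα hβ1 hθ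
      hγ0 hγ1
  have hc := fun β (hβ : β > (0 : ℝ)) C (hC : C > 0) =>
    IsParabolicA1With.exists_isImprovingWith (n := n) hp h3 hβ hC hθ hγ0 hγ1
  refine ⟨fun E hE hEc => ?_, ha, hb, hc⟩
  tfae_have 1 → 2 := by
    rintro ⟨c, hc, δ, hδ, hwp⟩
    obtain ⟨α, hα, K, hK, h⟩ := ha c hc δ hδ
    exact ⟨α, hα, c, hc, δ, hδ, K, hK, h E hE hEc hwp⟩
  tfae_have 2 → 3 := by
    rintro ⟨α, hα, c₀, hc₀, δ₀, hδ₀, K, hK, himp⟩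
    -- Any β below both α and 1/(n+p) is allowed; half of each is taken.
    have hβ : 0 < min (α / 2) (1 / (2 * (n + p))) := lt_min (by positivity) (by positivity)
    obtain ⟨C, hC, h⟩ := hb c₀ hc₀ δ₀ hδ₀ α hα K hK _ hβ
      ((min_le_left _ _).trans_lt (by linarith)) (by
        calc min (α / 2) (1 / (2 * (n + p))) * (n + p) ≤ 1 / (2 * (n + p)) * (n + p) := by
              gcongr
              exact min_le_right _ _
          _ = 1 / 2 := by field_simp
          _ < 1 := by norm_num)
    exact ⟨_, hβ, C, hC, h E hE hEc himp⟩
  tfae_have 3 → 1 := by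
    rintro ⟨β, hβ, C, hC, hA1⟩
    obtain ⟨c₀, hc₀, δ₀, hδ₀, K, -, h⟩ := hc β hβ C hC
    exact ⟨c₀, hc₀, δ₀, hδ₀, (h E hE hEc hA1).1⟩
  tfae_finish
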